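/- For $n\ge 1$ let $G_n=\mathrm{SL}_n(\mathbb C)$, $K_n=\mathrm{SU}(n)$ and $\Gamma_n=\mathrm{SL}_n(\mathbb Z[i])$. Let $\mathrm{Pos}_n(\mathbb C)$ be the space of positive definite Hermitian $n\times n$ matrices, with the measure $$d\mu_n(Y)=|\det Y|^{-n}\prod_{j} dy_{jj}\prod_{j<k} d\,\mathrm{Re}(y_{jk})\,d\,\mathrm{Im}(y_{jk}),$$ and let $\mathrm{SPos}_n(\mathbb C)=\{Z\in\mathrm{Pos}_n(\mathbb C):\det Z=1\}$, on which $G_n$ acts by $Z\mapsto gZg^*$. Let $\mu_n^{(1)}$ be the ($\sigma$-finite) $G_n$-invariant measure on $\mathrm{SPos}_n(\mathbb C)$ such that $d\mu_n(Y)=\frac{dr}{r}\,d\mu_n^{(1)}(Z)$ in the coordinates $Y=r^{1/n}Z$, $r>0$, $Z\in\mathrm{SPos}_n(\mathbb C)$. The symmetrically normalized measure on $G_n$ is the Haar measure $dg$ such that $$\int_{\mathrm{SPos}_n(\mathbb C)}f(Z)\,d\mu_n^{(1)}(Z)=\int_{G_n/K_n}f(gg^*)\,d\overline g\qquad\text{for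 all } f\in L^1(\mathrm{SPos}_n(\mathbb C)),$$ where $K_n$ is given total mass $1$; equivalently, the image of $dg$ under $g\mapsto gg^*$ is $\mu_n^{(1)}$. Let $\zeta_{\mathbb Q(i)}(s)=\sum_{0\ne I\subseteq\mathbb Z[i]}\#(\mathbb Z[i]/I)^{-s}$ (sum over nonzero ideals) and $\Lambda\zeta_{\mathbb Q(i)}(s)=\pi^{-s}\Gamma(s)\zeta_{\mathbb Q(i)}(s)$. Then for every $n\ge1$ the symmetrically normalized measure exists and is unique, and with respect to it $\Gamma_n\backslash G_n$ has finite volume $V_n$ (the measure of a fundamental domain for the action of $\Gamma_n$ on $G_n$ by left multiplication, which exists). Moreover $$V_n=\Lambda\zeta_{\mathbb Q(i)}(n)\,V_{n-1}\quad(n\ge2),\qquad V_n=\prod_{k=2}^n\Lambda\zeta_{\mathbb Q(i)}(k)=\prod_{k=2}^n\pi^{-k}\Gamma(k)\zeta_{\mathbb Q(i)}(k)\quad(n\ge1).$$ In particular $V_1=1$. -/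

import Mathlib

open MeasureTheory Matrix
open scoped ComplexOrder ENNReal

noncomputable section

namespace GaussianCovolume

/-! ### Groups -/

/-- `G_n = SL_n(ℂ)`, with its usual topology. -/
abbrev G (n : ℕ) : Type := Matrix.SpecialLinearGroup (Fin n) ℂ

/-- `Γ_n = SL_n(ℤ[i])`, as a subgroup of `SL_n(ℂ)`. -/
def Γ (n : ℕ) : Subgroup (G n) :=
  (Matrix.SpecialLinearGroup.map (n := Fin n) GaussianInt.toComplex).range

/-- The Borel sigma-algebra on complex matrices. -/
instance instMeasurableSpaceMatrix (n : ℕ) : MeasurableSpace (Matrix (Fin n) (Fin n) ℂ) :=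
  borel _

instance instBorelSpaceMatrix (n : ℕ) : BorelSpace (Matrix (Fin n) (Fin n) ℂ) := ⟨rfl⟩

/-- The Borel sigma-algebra on `SL_n(ℂ)`. -/
instance instMeasurableSpaceG (n : ℕ) : MeasurableSpace (G n) := borel _

instance instBorelSpaceG (n : ℕ) : BorelSpace (G n) := ⟨rfl⟩

/-! ### The invariant measure on positive definite Hermitian matrices -/

/-- Coordinates on Hermitian `n × n` matrices: the real diagonal entries `y_ii`, and the complex
entries `y_ij` with `i < j`. -/
abbrev HermCoord (n : ℕ) : Type := (Fin n → ℝ) × ({p : Fin n × Fin n // p.1 < p.2} → ℂ)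

/-- The Hermitian matrix with given coordinates. -/
def hermMatrix (n : ℕ) (c : HermCoord n) : Matrix (Fin n) (Fin n) ℂ :=
  Matrix.of fun i j =>
    if h : i < j then c.2 ⟨(i, j), h⟩
    else if h' : j < i then star (c.2 ⟨(j, i), h'⟩)
    else (c.1 i : ℂ)

/-- The Lebesgue measure `dμ_euc(Y)` on Hermitian matrices: the product of the `d y_ii` and of the
`d Re(y_ij) d Im(y_ij)` for `i < j` (viewed as a measure on all matrices). -/
def hermLebesgue (n : ℕ) : Measure (Matrix (Fin n) (Fin n) ℂ) :=
  Measure.map (hermMatrix n) volume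

/-- The measure `dμ_n(Y) = |det Y|^{-n} dμ_euc(Y)` on the space `Pos_n(ℂ)` of positive definite
Hermitian matrices (viewed as a measure on all matrices). -/
def posMeasure (n : ℕ) : Measure (Matrix (Fin n) (Fin n) ℂ) :=
  ((hermLebesgue n).restrict {Y | Y.PosDef}).withDensity
    fun Y => ENNReal.ofReal ((‖Y.det‖ ^ n)⁻¹)

/-- `SPos_n(ℂ)`: the positive definite Hermitian matrices of determinant `1`. -/
abbrev SPos (n : ℕ) : Type := {Z : Matrix (Fin n) (Fin n) ℂ // Z.PosDef ∧ Z.det = 1}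

/-- The action `Z ↦ g Z g*` of `SL_n(ℂ)` on `SPos_n(ℂ)`. -/
def act {n : ℕ} (g : G n) (Z : SPos n) : SPos n :=
  ⟨(g : Matrix (Fin n) (Fin n) ℂ) * (Z : Matrix (Fin n) (Fin n) ℂ) *
      (g : Matrix (Fin n) (Fin n) ℂ)ᴴ,
    Z.2.1.mul_mul_conjTranspose_same (B := (g : Matrix (Fin n) (Fin n) ℂ))
      (Matrix.vecMul_injective_of_isUnit
        ((Matrix.isUnit_iff_isUnit_det _).2 (by simp))),
    by simp [Matrix.det_conjTranspose, Z.2.2]⟩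

/-- The base point `1 ∈ SPos_n(ℂ)`, whose stabilizer in `SL_n(ℂ)` is `SU(n)`. -/
def basePoint (n : ℕ) : SPos n := ⟨1, Matrix.PosDef.one, Matrix.det_one⟩

/-- The measure `dr/r` on the positive half-line (viewed as a measure on `ℝ`). -/
def dilationMeasure : Measure ℝ :=
  (volume.restrict (Set.Ioi 0)).withDensity fun r => ENNReal.ofReal r⁻¹

/-- `ν` is the measure `μ_n^{(1)}` on `SPos_n(ℂ)`: it is `SL_n(ℂ)`-invariant, and
`dμ_n(Y) = (dr/r) dν(Z)` in the coordinates `Y = r^{1/n} Z` with `r > 0` and `Z ∈ SPos_n(ℂ)`. -/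
structure IsSPosMeasure (n : ℕ) (ν : Measure (SPos n)) : Prop where
  sigmaFinite : SigmaFinite ν
  invariant : ∀ g : G n, ν.map (act g) = ν
  decomposition :
    (dilationMeasure.prod ν).map
      (fun p : ℝ × SPos n => (p.1 ^ (1 / (n : ℝ))) • (p.2 : Matrix (Fin n) (Fin n) ℂ)) =
    posMeasure n

/-- The symmetrically normalized measure on `SL_n(ℂ)`: the Haar measure `μ` such that
`∫_{SPos_n} f(Z) dμ_n^{(1)}(Z) = ∫_{G_n/K_n} f(g g*) dμ` for all `f`, where `K_n = SU(n)` has total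
mass one; that is, the image of `μ` under `g ↦ g g*` is `μ_n^{(1)}`. -/
structure IsSymmetricallyNormalized (n : ℕ) (μ : Measure (G n)) : Prop where
  isHaar : μ.IsHaarMeasure
  map_eq : IsSPosMeasure n (μ.map fun g => act g (basePoint n))

/-! ### The completed zeta function -/

/-- The Dedekind zeta function of `ℚ(i)`: the sum of `N(I)^{-s}` over the nonzero ideals `I` of
`ℤ[i]`, where `N(I)` is the cardinality of `ℤ[i]/I`. -/
def zetaQi (s : ℂ) : ℂ :=
  ∑' I : {I : Ideal GaussianInt // I ≠ ⊥}, (Nat.card (GaussianInt ⧸ I.1) : ℂ) ^ (-s)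

/-- `Λζ_{ℚ(i)}(s) = π^{-s} Γ(s) ζ_{ℚ(i)}(s)`. -/
def lambdaZeta (s : ℂ) : ℂ := (Real.pi : ℂ) ^ (-s) * Complex.Gamma s * zetaQi s

/-- The volume `V_n` of `Γ_n \ G_n` for a measure `μ` on `G_n`: the `μ`-measure of a fundamental
domain for the action of `Γ_n` on `G_n` by left multiplication. -/
def V (n : ℕ) (μ : Measure (G n)) : ℝ≥0∞ := covolume (Γ n) (G n) μ

end GaussianCovolume

end

noncomputable section

namespace GaussianCovolume

/-! ### Topology and measurability on matrices and on `SL_n(ℂ)` -/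

/-! Everything rests on one recursion, from `m` to `n = m + 1`. `SL_n(ℂ)` acts from the right on row
vectors; the stabilizer of the first basis vector consists of the matrices `[1 0; b A]` with `A` in
`SL_m(ℂ)` and `b` in `ℂ^m`, and the orbit map sends `g` to its first row `x`. A Haar measure `dA` on
`SL_m(ℂ)` therefore gives a Haar measure `dA db dx` on `SL_n(ℂ)` (`rowMeasure`,
`isHaarMeasure_rowMeasure`). Only right invariance is checked directly; left invariance follows
because `SL_n(ℂ)` is unimodular, which is seen on the bi-invariant cone measure.

Normalization. Writing positive definite matrices as `[1 0; b 1] diag(y, Y) [1 0; b 1]*` expresses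
`μ_n` through `μ_m`, `dy` and `db` (`lintegral_posMeasure_succ`). On the group side the corner of `g
g*` is `|x|²`, whose distribution under Lebesgue measure on `ℂ^{m+1}` is `(π^{m+1}/m!) u^m du`.
Comparing the two shows that if `dA` is symmetrically normalized, so is `(m!/π^{m+1}) dA db dx`
(`isDecomposed_rowMeasure`). Existence follows by induction from the trivial group `SL_1`;
uniqueness holds because Haar measures are proportional.

Volume. This is Siegel's mean value argument. Let `F_n` be an exact fundamental domain. Unfolding
the sum over first rows of elements of `SL_n(ℤ[i])` gives `∫_{F_n} ∑ f(v g) = vol(F_m) ∫ f`. Since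
`ℤ[i]` is principal, every nonzero vector is uniquely a chosen generator of a nonzero ideal times
such a row, so the sum over all nonzero vectors acquires the factor `ζ(n)`
(`lintegral_tsum_ne_zero_rowMeasure`). Take for `f` the indicator of a ball of radius `k` and divide
by `k^{2n}`: the integrand tends to the volume of the unit ball, because `ℤ[i]^n g` has covolume
`1`, while the right side does not depend on `k`. Passing to the limit gives `vol(F_n) = ζ(n)
vol(F_m)` for `dA db dx` (`rowMeasure_fundamentalSet`). Multiplying by `m!/π^{m+1}` turns `ζ(n)`
into `Λζ(n)`. -/

instance instSecondCountableMatrix (n : ℕ) :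
    SecondCountableTopology (Matrix (Fin n) (Fin n) ℂ) :=
  inferInstanceAs (SecondCountableTopology (Fin n → Fin n → ℂ))

instance instSecondCountableG (n : ℕ) : SecondCountableTopology (G n) :=
  Matrix.SpecialLinearGroup.isClosedEmbedding_val.isEmbedding.secondCountableTopology

instance instLocallyCompactG (n : ℕ) : LocallyCompactSpace (G n) := by
  have : LocallyCompactSpace (Matrix (Fin n) (Fin n) ℂ) :=
    inferInstanceAs (LocallyCompactSpace (Fin n → Fin n → ℂ))
  exact Matrix.SpecialLinearGroup.isClosedEmbedding_val.locallyCompactSpace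

theorem measurable_entry {n : ℕ} (i j : Fin n) :
    Measurable fun M : Matrix (Fin n) (Fin n) ℂ => M i j :=
  (continuous_id.matrix_elem i j).measurable

theorem instMeasurableSpaceMatrix_eq_pi (n : ℕ) :
    instMeasurableSpaceMatrix n = (MeasurableSpace.pi : MeasurableSpace (Fin n → Fin n → ℂ)) :=
  (BorelSpace.measurable_eq (α := Fin n → Fin n → ℂ)).symm

theorem measurable_matrix_iff {α : Type*} [MeasurableSpace α] {n : ℕ}
    {f : α → Matrix (Fin n) (Fin n) ℂ} :
    Measurable f ↔ ∀ i j, Measurable fun a => f a i j := by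
  refine ⟨fun h i j => (measurable_entry i j).comp h, fun h => ?_⟩
  rw [instMeasurableSpaceMatrix_eq_pi]
  exact measurable_pi_iff.2 fun i => measurable_pi_iff.2 fun j => h i j

theorem measurable_of (n : ℕ) :
    Measurable fun M : Fin n → Fin n → ℂ => (Matrix.of M : Matrix (Fin n) (Fin n) ℂ) :=
  measurable_matrix_iff.2 fun i j => (measurable_pi_apply j).comp (measurable_pi_apply i)

theorem measurableEmbedding_coeG (n : ℕ) :
    MeasurableEmbedding fun g : G n => (g : Matrix (Fin n) (Fin n) ℂ) :=
  have h : Topology.IsClosedEmbedding fun g : G n => (g : Matrix (Fin n) (Fin n) ℂ) :=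
    Matrix.SpecialLinearGroup.isClosedEmbedding_val
  h.measurableEmbedding

theorem measurable_coeG (n : ℕ) :
    Measurable fun g : G n => (g : Matrix (Fin n) (Fin n) ℂ) :=
  (measurableEmbedding_coeG n).measurable

/-- The element of `SL_n(ℂ)` given by a matrix of determinant `1`. -/
def mkG {n : ℕ} (M : Matrix (Fin n) (Fin n) ℂ) (h : M.det = 1) : G n := ⟨M, h⟩

@[simp]
theorem coe_mkG {n : ℕ} (M : Matrix (Fin n) (Fin n) ℂ) (h : M.det = 1) :
    (mkG M h : Matrix (Fin n) (Fin n) ℂ) = M := rfl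

theorem G_ext {n : ℕ} {g h : G n}
    (e : (g : Matrix (Fin n) (Fin n) ℂ) = (h : Matrix (Fin n) (Fin n) ℂ)) : g = h :=
  Subtype.ext e

theorem det_coeG {n : ℕ} (g : G n) : (g : Matrix (Fin n) (Fin n) ℂ).det = 1 := g.2

theorem measurable_G_iff {α : Type*} [MeasurableSpace α] {n : ℕ} {f : α → G n} :
    Measurable f ↔ ∀ i j, Measurable fun a => f a i j := by
  exact ((measurableEmbedding_coeG n).measurable_comp_iff (f := f)).symm.trans
    measurable_matrix_iff

theorem measurable_G_entry {n : ℕ} (i j : Fin n) : Measurable fun g : G n => g i j :=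
  measurable_G_iff.1 measurable_id i j

theorem measurable_det (n : ℕ) : Measurable fun M : Matrix (Fin n) (Fin n) ℂ => M.det :=
  (continuous_id.matrix_det).measurable

theorem measurable_vecMul (n : ℕ) (h : Matrix (Fin n) (Fin n) ℂ) :
    Measurable fun x : Fin n → ℂ => x ᵥ* h :=
  (Continuous.matrix_vecMul continuous_id continuous_const).measurable

/-! ### Linear changes of variables -/

/-- A complex linear map scales the volume of `ℂ^ι` by `|det|^{-2}`. -/
theorem map_complexLinearMap_volume {ι : Type*} [Fintype ι]
    (f : (ι → ℂ) →ₗ[ℂ] (ι → ℂ)) (hf : LinearMap.det f ≠ 0) :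
    Measure.map f (volume : Measure (ι → ℂ)) =
      ENNReal.ofReal ((‖LinearMap.det f‖ ^ 2)⁻¹) • volume := by
  have hdet : LinearMap.det (f.restrictScalars ℝ) = ‖LinearMap.det f‖ ^ 2 := by
    rw [LinearMap.det_restrictScalars, Algebra.norm_complex_apply, Complex.normSq_eq_norm_sq]
  have h := Measure.map_linearMap_addHaar_eq_smul_addHaar (volume : Measure (ι → ℂ))
    (f := f.restrictScalars ℝ) (by rw [hdet]; positivity)
  rw [hdet, abs_of_nonneg (by positivity)] at h
  exact h

theorem measurePreserving_vecMul {n : ℕ} (h : G n) :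
    MeasurePreserving (fun x : Fin n → ℂ => x ᵥ* (h : Matrix (Fin n) (Fin n) ℂ)) := by
  refine ⟨measurable_vecMul n _, ?_⟩
  have hd : LinearMap.det (Matrix.toLin' (h : Matrix (Fin n) (Fin n) ℂ)ᵀ) = 1 := by
    rw [LinearMap.det_toLin', Matrix.det_transpose]; exact h.2
  have := map_complexLinearMap_volume (Matrix.toLin' (h : Matrix (Fin n) (Fin n) ℂ)ᵀ)
    (by rw [hd]; exact one_ne_zero)
  rw [hd] at this
  simpa [Matrix.toLin'_apply', Matrix.mulVecLin_transpose, Matrix.coe_vecMulLinear] using this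

theorem measurePreserving_mulVec {n : ℕ} (h : G n) :
    MeasurePreserving (fun x : Fin n → ℂ => (h : Matrix (Fin n) (Fin n) ℂ) *ᵥ x) := by
  refine ⟨(Continuous.matrix_mulVec continuous_const continuous_id).measurable, ?_⟩
  have hd : LinearMap.det (Matrix.toLin' (h : Matrix (Fin n) (Fin n) ℂ)) = 1 := by
    rw [LinearMap.det_toLin']; exact h.2
  have := map_complexLinearMap_volume (Matrix.toLin' (h : Matrix (Fin n) (Fin n) ℂ))
    (by rw [hd]; exact one_ne_zero)
  rw [hd] at this
  simpa [Matrix.toLin'_apply', Matrix.coe_mulVecLin] using this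

instance instIsAddHaarMeasureRows (m n : ℕ) :
    (volume : Measure (Fin m → Fin n → ℂ)).IsAddHaarMeasure :=
  Measure.pi.isAddHaarMeasure _

/-- Right multiplication by `h` on families of rows. -/
def rowMul {n : ℕ} (h : G n) (M : Fin n → Fin n → ℂ) : Fin n → Fin n → ℂ :=
  fun i => M i ᵥ* (h : Matrix (Fin n) (Fin n) ℂ)

/-- Left multiplication by `h` on families of rows. -/
def mulRow {n : ℕ} (h : G n) (M : Fin n → Fin n → ℂ) : Fin n → Fin n → ℂ :=
  fun i j => ∑ k, h i k * M k j

theorem of_rowMul {n : ℕ} (h : G n) (M : Fin n → Fin n → ℂ) :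
    Matrix.of (rowMul h M) = Matrix.of M * (h : Matrix (Fin n) (Fin n) ℂ) := rfl

theorem of_mulRow {n : ℕ} (h : G n) (M : Fin n → Fin n → ℂ) :
    Matrix.of (mulRow h M) = (h : Matrix (Fin n) (Fin n) ℂ) * Matrix.of M := rfl

theorem measurePreserving_rowMul {n : ℕ} (h : G n) :
    MeasurePreserving (rowMul h) volume volume :=
  volume_preserving_pi (f := fun _ : Fin n => fun x : Fin n → ℂ =>
    x ᵥ* (h : Matrix (Fin n) (Fin n) ℂ)) fun _ => measurePreserving_vecMul h

theorem measurable_mulRow {n : ℕ} (h : G n) : Measurable (mulRow h) :=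
  measurable_pi_iff.2 fun i => measurable_pi_iff.2 fun j => Finset.measurable_sum _ fun k _ =>
    (show Measurable fun M : Fin n → Fin n → ℂ => M k j from
      (measurable_pi_apply j).comp (measurable_pi_apply k)).const_mul (h i k)

/-- Left multiplication mixes the rows, so it is conjugated by the transposition `τ` into a right
multiplication. By uniqueness of Haar measure `τ` scales Lebesgue measure by some `c`; since `τ` is
an involution the constant cancels and never has to be computed. -/
theorem measurePreserving_mulRow {n : ℕ} (h : G n) :
    MeasurePreserving (mulRow h) volume volume := by
  refine ⟨measurable_mulRow h, ?_⟩
  let τ : (Fin n → Fin n → ℂ) ≃L[ℝ] (Fin n → Fin n → ℂ) :=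
    { toFun := fun M i j => M j i
      invFun := fun M i j => M j i
      map_add' := fun _ _ => rfl
      map_smul' := fun _ _ => rfl
      left_inv := fun _ => rfl
      right_inv := fun _ => rfl
      continuous_toFun := by fun_prop
      continuous_invFun := by fun_prop }
  have hτm : Measurable τ := τ.continuous.measurable
  have hR := measurePreserving_rowMul h.transpose
  have : (Measure.map τ (volume : Measure (Fin n → Fin n → ℂ))).IsAddHaarMeasure :=
    τ.isAddHaarMeasure_map volume
  obtain ⟨c, hc⟩ : ∃ c : NNReal, Measure.map τ (volume : Measure (Fin n → Fin n → ℂ)) =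
      c • volume :=
    ⟨_, Measure.isAddLeftInvariant_eq_smul
      (Measure.map τ (volume : Measure (Fin n → Fin n → ℂ))) volume⟩
  have hττ : Measure.map τ (Measure.map τ (volume : Measure (Fin n → Fin n → ℂ))) = volume := by
    rw [Measure.map_map hτm hτm]
    exact Measure.map_id
  have hL : mulRow h = τ ∘ rowMul h.transpose ∘ τ := by
    funext M i j
    change _ = ∑ k, M k j * h i k
    simp [mulRow, mul_comm]
  rw [hL, ← Measure.map_map hτm (hR.measurable.comp hτm), ← Measure.map_map hR.measurable hτm, hc,
    Measure.map_smul, hR.map_eq, ← hc, hττ]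

/-! ### Uniqueness of invariant measures -/

/-- The constant is the ratio of the two masses of one set, taken from the spanning sets of `μ + ν`
so that both masses are finite. This version asks only for sigma-finiteness, since the cone measure
and `rowMeasure` are not known beforehand to be finite on compact sets. -/
theorem exists_eq_smul_of_isMulLeftInvariant {H : Type*} [Group H] [MeasurableSpace H]
    [MeasurableMul₂ H] [MeasurableInv H] (μ ν : Measure H) [SigmaFinite μ] [SigmaFinite ν]
    [μ.IsMulLeftInvariant] [ν.IsMulLeftInvariant] (hν : ν ≠ 0) :
    ∃ c : ℝ≥0∞, c ≠ ⊤ ∧ μ = c • ν := by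
  obtain ⟨k, hk⟩ : ∃ k, ν (spanningSets (μ + ν) k) ≠ 0 := by
    by_contra! hcon
    refine hν (Measure.measure_univ_eq_zero.1 ?_)
    rw [← iUnion_spanningSets (μ + ν)]
    exact measure_iUnion_null hcon
  have hlt := measure_spanningSets_lt_top (μ + ν) k
  rw [Measure.add_apply, ENNReal.add_lt_top] at hlt
  exact ⟨_, ENNReal.div_ne_top hlt.1.ne hk,
    measure_eq_div_smul μ ν hk hlt.2.ne⟩

theorem exists_eq_smul_of_isMulRightInvariant {H : Type*} [Group H] [MeasurableSpace H]
    [MeasurableMul₂ H] [MeasurableInv H] (μ ν : Measure H) [SigmaFinite μ] [SigmaFinite ν]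
    [μ.IsMulRightInvariant] [ν.IsMulRightInvariant] (hν : ν ≠ 0) :
    ∃ c : ℝ≥0∞, c ≠ ⊤ ∧ μ = c • ν := by
  have hinv : ∀ κ : Measure H, Measure.map Inv.inv (Measure.map Inv.inv κ) = κ := fun κ => by
    rw [Measure.map_map measurable_inv measurable_inv]
    simp
  have h1 : SigmaFinite μ.inv := (MeasurableEquiv.inv H).sigmaFinite_map
  have h2 : SigmaFinite ν.inv := (MeasurableEquiv.inv H).sigmaFinite_map
  obtain ⟨c, hc, h⟩ := exists_eq_smul_of_isMulLeftInvariant μ.inv ν.inv (fun h => hν (by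
    rw [← hinv ν]; change Measure.map _ ν.inv = 0; rw [h, Measure.map_zero]))
  refine ⟨c, hc, ?_⟩
  rw [← hinv μ, ← hinv ν]
  change Measure.map _ μ.inv = c • Measure.map _ ν.inv
  rw [h, Measure.map_smul]

/-! ### The cone measure; unimodularity -/

/-- The radial projection of invertible matrices to `SL_n(ℂ)`. -/
def unitDet (n : ℕ) (M : Fin n → Fin n → ℂ) : G n :=
  if h : ((Matrix.of M).det ^ (-(1 / (n : ℂ))) • Matrix.of M).det = 1 then mkG _ h else 1

/-- The open set of matrices with determinant in the punctured unit disk. -/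
def detDisk (n : ℕ) : Set (Fin n → Fin n → ℂ) :=
  {M | (Matrix.of M).det ≠ 0 ∧ ‖(Matrix.of M).det‖ < 1}

/-- The cone measure on `SL_n(ℂ)`. -/
def coneMeasure (n : ℕ) : Measure (G n) :=
  Measure.map (unitDet n) (volume.restrict (detDisk n))

theorem det_cpow_smul {n : ℕ} (hn : n ≠ 0) {M : Matrix (Fin n) (Fin n) ℂ} (hM : M.det ≠ 0) :
    (M.det ^ (-(1 / (n : ℂ))) • M).det = 1 := by
  rw [Matrix.det_smul, Fintype.card_fin, ← Complex.cpow_nat_mul]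
  have : (n : ℂ) * -(1 / (n : ℂ)) = -1 := by
    field_simp
  rw [this, Complex.cpow_neg_one, inv_mul_cancel₀ hM]

theorem coe_unitDet {n : ℕ} (hn : n ≠ 0) {M : Fin n → Fin n → ℂ} (hM : (Matrix.of M).det ≠ 0) :
    (unitDet n M : Matrix (Fin n) (Fin n) ℂ) =
      (Matrix.of M).det ^ (-(1 / (n : ℂ))) • Matrix.of M := by
  rw [unitDet, dif_pos (det_cpow_smul hn hM), coe_mkG]

theorem measurable_of_det (n : ℕ) :
    Measurable fun M : Fin n → Fin n → ℂ => (Matrix.of M).det :=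
  (measurable_det n).comp (measurable_of n)

theorem measurableSet_detDisk (n : ℕ) : MeasurableSet (detDisk n) :=
  ((measurableSet_singleton 0).compl.preimage (measurable_of_det n)).inter
    (measurableSet_lt (measurable_of_det n).norm measurable_const)

theorem measurable_unitDet (n : ℕ) : Measurable (unitDet n) := by
  have hm : Measurable fun M : Fin n → Fin n → ℂ =>
      (Matrix.of M).det ^ (-(1 / (n : ℂ))) • Matrix.of M :=
    measurable_matrix_iff.2 fun i j => by
      simp only [Matrix.smul_apply, smul_eq_mul]
      exact ((measurable_of_det n).pow_const _).mul
        ((measurable_pi_apply j).comp (measurable_pi_apply i))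
  refine measurable_G_iff.2 fun i j => ?_
  have : (fun M => (unitDet n M) i j) = fun M : Fin n → Fin n → ℂ =>
      if ((Matrix.of M).det ^ (-(1 / (n : ℂ))) • Matrix.of M).det = 1 then
        ((Matrix.of M).det ^ (-(1 / (n : ℂ))) • Matrix.of M) i j else (1 : G n) i j := by
    funext M
    unfold unitDet
    split_ifs <;> rfl
  rw [this]
  exact Measurable.ite ((measurableSet_singleton 1).preimage ((measurable_det n).comp hm))
    ((measurable_entry i j).comp hm) measurable_const

theorem det_of_rowMul {n : ℕ} (h : G n) (M : Fin n → Fin n → ℂ) :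
    (Matrix.of (rowMul h M)).det = (Matrix.of M).det := by
  rw [of_rowMul, Matrix.det_mul, det_coeG, mul_one]

theorem det_of_mulRow {n : ℕ} (h : G n) (M : Fin n → Fin n → ℂ) :
    (Matrix.of (mulRow h M)).det = (Matrix.of M).det := by
  rw [of_mulRow, Matrix.det_mul, det_coeG, one_mul]

/-- The branch of the `n`-th root does no harm: multiplication by `h` leaves the determinant, hence
the chosen root, unchanged. -/
theorem unitDet_rowMul {n : ℕ} (hn : n ≠ 0) {M : Fin n → Fin n → ℂ}
    (hM : (Matrix.of M).det ≠ 0) (h : G n) : unitDet n (rowMul h M) = unitDet n M * h := by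
  apply G_ext
  rw [Matrix.SpecialLinearGroup.coe_mul, coe_unitDet hn (by rwa [det_of_rowMul]),
    coe_unitDet hn hM, det_of_rowMul, Matrix.smul_mul, of_rowMul]

theorem unitDet_mulRow {n : ℕ} (hn : n ≠ 0) {M : Fin n → Fin n → ℂ}
    (hM : (Matrix.of M).det ≠ 0) (h : G n) : unitDet n (mulRow h M) = h * unitDet n M := by
  apply G_ext
  rw [Matrix.SpecialLinearGroup.coe_mul, coe_unitDet hn (by rwa [det_of_mulRow]),
    coe_unitDet hn hM, det_of_mulRow, Matrix.mul_smul, of_mulRow]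

/-- An equivariance criterion for the invariance of the cone measure. -/
theorem map_coneMeasure_eq {n : ℕ} (φ : G n → G n) (hφ : Measurable φ)
    (L : (Fin n → Fin n → ℂ) → (Fin n → Fin n → ℂ)) (hL : MeasurePreserving L volume volume)
    (hd : ∀ M, (Matrix.of (L M)).det = (Matrix.of M).det)
    (he : ∀ M, (Matrix.of M).det ≠ 0 → unitDet n (L M) = φ (unitDet n M)) :
    Measure.map φ (coneMeasure n) = coneMeasure n := by
  have hpre : L ⁻¹' detDisk n = detDisk n := by
    ext M; simp only [detDisk, Set.mem_preimage, Set.mem_ofPred_eq, hd]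
  have h1 : Measure.map L (volume.restrict (detDisk n)) = volume.restrict (detDisk n) := by
    conv_rhs => rw [← hL.map_eq, Measure.restrict_map hL.measurable (measurableSet_detDisk n), hpre]
  unfold coneMeasure
  rw [Measure.map_map hφ (measurable_unitDet n)]
  conv_rhs => rw [← h1, Measure.map_map (measurable_unitDet n) hL.measurable]
  refine Measure.map_congr ?_
  filter_upwards [ae_restrict_mem (measurableSet_detDisk n)] with M hM
  exact (he M hM.1).symm

theorem coneMeasure_isMulRightInvariant {n : ℕ} (hn : n ≠ 0) :
    (coneMeasure n).IsMulRightInvariant :=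
  ⟨fun h => map_coneMeasure_eq _ (measurable_mul_const h) _ (measurePreserving_rowMul h)
    (det_of_rowMul h) fun _ hM => unitDet_rowMul hn hM h⟩

theorem coneMeasure_isMulLeftInvariant {n : ℕ} (hn : n ≠ 0) :
    (coneMeasure n).IsMulLeftInvariant :=
  ⟨fun h => map_coneMeasure_eq _ (measurable_const_mul h) _ (measurePreserving_mulRow h)
    (det_of_mulRow h) fun _ hM => unitDet_mulRow hn hM h⟩

theorem coneMeasure_ne_zero (n : ℕ) (hn : n ≠ 0) : coneMeasure n ≠ 0 := by
  have hopen : IsOpen (detDisk n : Set (Fin n → Fin n → ℂ)) := by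
    have hc : Continuous fun M : Fin n → Fin n → ℂ => (Matrix.of M).det :=
      Continuous.matrix_det continuous_id
    exact (isOpen_compl_singleton.preimage hc).inter (isOpen_lt hc.norm continuous_const)
  have hne : (detDisk n).Nonempty := by
    refine ⟨((1 / 2 : ℂ) • (1 : Matrix (Fin n) (Fin n) ℂ) : Matrix (Fin n) (Fin n) ℂ), ?_⟩
    have : (Matrix.of ((1 / 2 : ℂ) • (1 : Matrix (Fin n) (Fin n) ℂ))).det = (1 / 2) ^ n := by
      change ((1 / 2 : ℂ) • (1 : Matrix (Fin n) (Fin n) ℂ)).det = _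
      rw [Matrix.det_smul]; simp
    refine ⟨by rw [this]; positivity, ?_⟩
    rw [this, norm_pow]
    exact pow_lt_one₀ (by positivity) (by norm_num) hn
  intro h
  have := congrArg (fun μ : Measure (G n) => μ Set.univ) h
  simp only [coneMeasure, Measure.map_apply (measurable_unitDet n) MeasurableSet.univ,
    Set.preimage_univ, Measure.restrict_apply MeasurableSet.univ, Set.univ_inter,
    Measure.coe_zero, Pi.zero_apply] at this
  exact (hopen.measure_pos (volume : Measure (Fin n → Fin n → ℂ)) hne).ne' this

/-- On `detDisk` the rescaling factor has modulus `|det M|^{-1/n} ≥ 1`, so a bound on the entries of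
`unitDet n M` is a bound on those of `M`, and bounded sets of matrices have finite Lebesgue measure.
This is why the determinant is confined to the unit disk. -/
theorem coneMeasure_sigmaFinite {n : ℕ} (hn : n ≠ 0) : SigmaFinite (coneMeasure n) := by
  let S : ℕ → Set (G n) := fun k => {g | ∀ i j, ‖g i j‖ ≤ k}
  have hS : ∀ k, MeasurableSet (S k) := fun k => by
    simp only [S, Set.ofPred_forall]
    exact MeasurableSet.iInter fun i => MeasurableSet.iInter fun j =>
      measurableSet_le (measurable_G_entry i j).norm measurable_const
  refine ⟨⟨⟨S, fun _ => trivial, fun k => ?_, ?_⟩⟩⟩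
  · rw [coneMeasure, Measure.map_apply (measurable_unitDet n) (hS k),
      Measure.restrict_apply ((hS k).preimage (measurable_unitDet n))]
    refine lt_of_le_of_lt (measure_mono ?_)
      (measure_closedBall_lt_top (x := (0 : Fin n → Fin n → ℂ)) (r := k))
    rintro M ⟨hM, hM0, hM1⟩
    rw [mem_closedBall_zero_iff]
    refine (pi_norm_le_iff_of_nonneg (Nat.cast_nonneg k)).2 fun i =>
      (pi_norm_le_iff_of_nonneg (Nat.cast_nonneg k)).2 fun j => ?_
    have h1 : ‖(unitDet n M : Matrix (Fin n) (Fin n) ℂ) i j‖ ≤ k := hM i j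
    rw [coe_unitDet hn hM0, Matrix.smul_apply, norm_smul] at h1
    refine le_trans ?_ h1
    refine le_mul_of_one_le_left (norm_nonneg _) ?_
    have : (-(1 / (n : ℂ))) = ((-(1 / (n : ℝ)) : ℝ) : ℂ) := by push_cast; rfl
    rw [this, Complex.norm_cpow_real]
    exact Real.one_le_rpow_of_pos_of_le_one_of_nonpos (norm_pos_iff.2 hM0) hM1.le
      (by simp)
  · refine Set.eq_univ_of_forall fun g => Set.mem_iUnion.2 ?_
    obtain ⟨k, hk⟩ := exists_nat_ge (∑ i, ∑ j, ‖g i j‖)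
    refine ⟨k, fun i j => le_trans ?_ hk⟩
    refine le_trans ?_ (Finset.single_le_sum (f := fun i => ∑ j, ‖g i j‖)
      (fun i _ => Finset.sum_nonneg fun j _ => norm_nonneg _) (Finset.mem_univ i))
    exact Finset.single_le_sum (f := fun j => ‖g i j‖) (fun j _ => norm_nonneg _)
      (Finset.mem_univ j)

/-- `SL_n(ℂ)` is unimodular. -/
theorem isMulRightInvariant_of_isHaarMeasure {n : ℕ} (hn : n ≠ 0) (μ : Measure (G n))
    [μ.IsHaarMeasure] : μ.IsMulRightInvariant := by
  have := coneMeasure_isMulRightInvariant hn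
  have := coneMeasure_isMulLeftInvariant hn
  have := coneMeasure_sigmaFinite hn
  -- Left invariance alone determines `μ` up to scale, and the cone measure is also right invariant.
  obtain ⟨c, -, hc⟩ := exists_eq_smul_of_isMulLeftInvariant μ (coneMeasure n)
    (coneMeasure_ne_zero n hn)
  rw [hc]
  infer_instance

/-- A nonzero, sigma-finite, right invariant measure on `SL_n(ℂ)` is a Haar measure. -/
theorem isHaarMeasure_of_isMulRightInvariant {n : ℕ} (hn : n ≠ 0) (ρ : Measure (G n))
    [SigmaFinite ρ] [ρ.IsMulRightInvariant] (hρ : ρ ≠ 0) : ρ.IsHaarMeasure := by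
  let μ : Measure (G n) := Measure.haar
  have := isMulRightInvariant_of_isHaarMeasure hn μ
  obtain ⟨c, hc, h⟩ := exists_eq_smul_of_isMulRightInvariant ρ μ
    (Measure.measure_univ_ne_zero.1 (isOpen_univ.measure_ne_zero μ Set.univ_nonempty))
  rw [h]
  refine Measure.IsHaarMeasure.smul μ ?_ hc
  rintro rfl
  exact hρ (by rw [h, zero_smul])

/-! ### The stabilizer of the first basis vector -/

theorem matrix_ext_succ {R : Type*} {m : ℕ} {M N : Matrix (Fin (m + 1)) (Fin (m + 1)) R} (h00 : M 0 0 = N 0 0)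
    (h0 : ∀ j : Fin m, M 0 j.succ = N 0 j.succ) (h1 : ∀ i : Fin m, M i.succ 0 = N i.succ 0)
    (h : ∀ i j : Fin m, M i.succ j.succ = N i.succ j.succ) : M = N := by
  ext i j
  refine Fin.cases ?_ (fun i => ?_) i <;> refine Fin.cases ?_ (fun j => ?_) j
  exacts [h00, h0 j, h1 i, h i j]

/-- The block matrix `[1 0; b A]`. -/
def lowerMat {R : Type*} [CommRing R] {m : ℕ} (A : Matrix (Fin m) (Fin m) R) (b : Fin m → R) :
    Matrix (Fin (m + 1)) (Fin (m + 1)) R :=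
  Matrix.of (Fin.cons (Fin.cons 1 0) fun i => Fin.cons (b i) (A i))

section lowerMat
variable {R : Type*} [CommRing R] {m : ℕ}

@[simp] theorem lowerMat_zero_zero (A : Matrix (Fin m) (Fin m) R) (b : Fin m → R) :
    lowerMat A b 0 0 = 1 := rfl

@[simp] theorem lowerMat_zero_succ (A : Matrix (Fin m) (Fin m) R) (b : Fin m → R) (j : Fin m) :
    lowerMat A b 0 j.succ = 0 := rfl

@[simp] theorem lowerMat_succ_zero (A : Matrix (Fin m) (Fin m) R) (b : Fin m → R) (i : Fin m) :
    lowerMat A b i.succ 0 = b i := rfl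

@[simp] theorem lowerMat_succ_succ (A : Matrix (Fin m) (Fin m) R) (b : Fin m → R) (i j : Fin m) :
    lowerMat A b i.succ j.succ = A i j := rfl

theorem det_lowerMat (A : Matrix (Fin m) (Fin m) R) (b : Fin m → R) :
    (lowerMat A b).det = A.det := by
  rw [Matrix.det_succ_row_zero, Fin.sum_univ_succ]
  simp only [lowerMat_zero_zero, lowerMat_zero_succ, mul_zero, zero_mul, Finset.sum_const_zero,
    add_zero, Fin.val_zero, pow_zero, one_mul]
  congr 1

theorem lowerMat_mul (A B : Matrix (Fin m) (Fin m) R) (a b : Fin m → R) :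
    lowerMat A a * lowerMat B b = lowerMat (A * B) (a + A *ᵥ b) := by
  apply matrix_ext_succ <;> intros <;>
    simp [Matrix.mul_apply, Fin.sum_univ_succ, Matrix.mulVec, dotProduct]

theorem eq_lowerMat {M : Matrix (Fin (m + 1)) (Fin (m + 1)) R} (h0 : M 0 0 = 1)
    (h : ∀ j : Fin m, M 0 j.succ = 0) :
    M = lowerMat (M.submatrix Fin.succ Fin.succ) fun i => M i.succ 0 := by
  apply matrix_ext_succ <;> intros <;> simp [h0, h]

end lowerMat

/-- The element `[1 0; b A]` of `SL_{m+1}(ℂ)`. -/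
def lower {m : ℕ} (A : G m) (b : Fin m → ℂ) : G (m + 1) :=
  mkG (lowerMat A b) (by rw [det_lowerMat, det_coeG])

@[simp]
theorem coe_lower {m : ℕ} (A : G m) (b : Fin m → ℂ) :
    (lower A b : Matrix (Fin (m + 1)) (Fin (m + 1)) ℂ) = lowerMat A b := rfl

theorem lower_mul {m : ℕ} (A B : G m) (a b : Fin m → ℂ) :
    lower A a * lower B b =
      lower (A * B) (a + (A : Matrix (Fin m) (Fin m) ℂ) *ᵥ b) := by
  apply G_ext
  rw [Matrix.SpecialLinearGroup.coe_mul, coe_lower, coe_lower, coe_lower, lowerMat_mul,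
    Matrix.SpecialLinearGroup.coe_mul]

theorem measurable_lower (m : ℕ) :
    Measurable fun p : G m × (Fin m → ℂ) => lower p.1 p.2 := by
  refine measurable_G_iff.2 fun i j => ?_
  refine Fin.cases ?_ (fun i => ?_) i <;> refine Fin.cases ?_ (fun j => ?_) j
  · exact measurable_const
  · exact measurable_const
  · exact (measurable_pi_apply i).comp measurable_snd
  · exact (measurable_G_entry i j).comp measurable_fst

/-- The first row of a matrix. -/
def row0 {m : ℕ} (g : G (m + 1)) : Fin (m + 1) → ℂ := fun j => g 0 j

theorem measurable_row0 (m : ℕ) : Measurable (row0 (m := m)) :=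
  measurable_pi_iff.2 fun j => measurable_G_entry 0 j

theorem row0_mul {m : ℕ} (g h : G (m + 1)) :
    row0 (g * h) = row0 g ᵥ* (h : Matrix (Fin (m + 1)) (Fin (m + 1)) ℂ) := by
  funext j
  simp [row0, Matrix.SpecialLinearGroup.coe_mul, Matrix.mul_apply, Matrix.vecMul, dotProduct]

theorem row0_lower {m : ℕ} (A : G m) (b : Fin m → ℂ) : row0 (lower A b) = Pi.single 0 1 := by
  funext j
  refine Fin.cases ?_ (fun j => ?_) j <;> simp [row0]

theorem row0_lower_mul {m : ℕ} (A : G m) (b : Fin m → ℂ) (g : G (m + 1)) :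
    row0 (lower A b * g) = row0 g := by
  rw [row0_mul, row0_lower]
  funext j
  simp [row0]

theorem row0_one {m : ℕ} : row0 (1 : G (m + 1)) = Pi.single 0 1 := by
  funext j
  simp [row0, Matrix.one_apply, Pi.single_apply, eq_comm]

theorem exists_eq_lower {m : ℕ} {q : G (m + 1)} (h : row0 q = Pi.single 0 1) :
    ∃ A b, q = lower A b := by
  have h0 : q 0 0 = 1 := by simpa [row0] using congrFun h 0
  have h1 : ∀ j : Fin m, q 0 j.succ = 0 := fun j => by simpa [row0] using congrFun h j.succ
  have he := eq_lowerMat h0 h1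
  refine ⟨mkG _ (?_ : ((q : Matrix (Fin (m + 1)) (Fin (m + 1)) ℂ).submatrix
    Fin.succ Fin.succ).det = 1), fun i => q i.succ 0, G_ext he⟩
  rw [← det_lowerMat _ fun i => q i.succ 0, ← he, det_coeG]

/-- The fibres of `row0` are the cosets of the stabilizer of the first basis vector, as `g * g'⁻¹`
fixes that vector. -/
theorem exists_eq_lower_mul {m : ℕ} {g g' : G (m + 1)} (h : row0 g = row0 g') :
    ∃ A b, g = lower A b * g' := by
  obtain ⟨A, b, e⟩ := exists_eq_lower (q := g * g'⁻¹) (by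
    rw [row0_mul, h, ← row0_mul, mul_inv_cancel, row0_one])
  exact ⟨A, b, by rw [← e, inv_mul_cancel_right]⟩

/-! ### A section of the first row -/

/-- A matrix with first row `x`, of determinant `1` if `x 0 ≠ 0`. -/
def sectionMat {m : ℕ} (x : Fin (m + 1) → ℂ) : Matrix (Fin (m + 1)) (Fin (m + 1)) ℂ :=
  Matrix.of (Fin.cons x fun i => Fin.cons 0
    (Matrix.diagonal (fun k : Fin m => if (k : ℕ) = 0 then (x 0)⁻¹ else 1) i))

/-- The entry `(x 0)⁻¹` that compensates the corner sits in the first slot of the lower block, which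
exists only if `m ≠ 0`. -/
theorem det_sectionMat {m : ℕ} (hm : m ≠ 0) {x : Fin (m + 1) → ℂ} (hx : x 0 ≠ 0) :
    (sectionMat x).det = 1 := by
  rw [Matrix.det_succ_column_zero, Fin.sum_univ_succ]
  have h0 : ∀ i : Fin m, sectionMat x i.succ 0 = 0 := fun i => rfl
  have h1 : (sectionMat x).submatrix (Fin.succAbove 0) Fin.succ =
      Matrix.diagonal (fun k : Fin m => if (k : ℕ) = 0 then (x 0)⁻¹ else 1) := rfl
  have h2 : sectionMat x 0 0 = x 0 := rfl
  simp only [h0, h1, h2, mul_zero, zero_mul, Finset.sum_const_zero, add_zero, Fin.val_zero,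
    pow_zero, one_mul, Matrix.det_diagonal]
  obtain ⟨k, rfl⟩ := Nat.exists_eq_succ_of_ne_zero hm
  rw [Fin.prod_univ_succ]
  simp [hx]

/-- A measurable section of `row0`, defined where the first coordinate does not vanish. -/
def rowSection {m : ℕ} (x : Fin (m + 1) → ℂ) : G (m + 1) :=
  if h : (sectionMat x).det = 1 then mkG _ h else 1

theorem row0_rowSection {m : ℕ} (hm : m ≠ 0) {x : Fin (m + 1) → ℂ} (hx : x 0 ≠ 0) :
    row0 (rowSection x) = x := by
  rw [rowSection, dif_pos (det_sectionMat hm hx)]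
  rfl

theorem measurable_dite_mkG {α : Type*} [MeasurableSpace α] {n : ℕ}
    {f : α → Matrix (Fin n) (Fin n) ℂ} (hf : Measurable f) :
    Measurable fun a => if h : (f a).det = 1 then mkG (f a) h else (1 : G n) := by
  refine measurable_G_iff.2 fun i j => ?_
  have : (fun a => (if h : (f a).det = 1 then mkG (f a) h else (1 : G n)) i j) =
      fun a => if (f a).det = 1 then f a i j else (1 : G n) i j := by
    funext a
    split_ifs <;> rfl
  rw [this]
  exact Measurable.ite ((measurableSet_singleton 1).preimage ((measurable_det n).comp hf))
    ((measurable_entry i j).comp hf) measurable_const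

theorem measurable_rowSection (m : ℕ) : Measurable (rowSection (m := m)) := by
  refine measurable_dite_mkG (measurable_matrix_iff.2 fun i j => ?_)
  refine Fin.cases (measurable_pi_apply j) (fun i => ?_) i
  refine Fin.cases measurable_const (fun j => ?_) j
  change Measurable fun x : Fin (m + 1) → ℂ =>
    Matrix.diagonal (fun k : Fin m => if (k : ℕ) = 0 then (x 0)⁻¹ else 1) i j
  simp only [Matrix.diagonal_apply]
  split_ifs
  · exact (measurable_pi_apply 0).inv
  · exact measurable_const
  · exact measurable_const

theorem ae_zero_ne (m : ℕ) : ∀ᵐ x : Fin (m + 1) → ℂ, x 0 ≠ 0 :=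
  Measure.ae_eval_ne (μ := fun _ : Fin (m + 1) => (volume : Measure ℂ)) 0 0

/-! ### The Haar measure in coordinates -/

/-- The measure `dA db` on the stabilizer `{[1 0; b A]}`. -/
abbrev lowerMeasure {m : ℕ} (κ : Measure (G m)) : Measure (G m × (Fin m → ℂ)) :=
  κ.prod volume

/-- The map `(A, b, x) ↦ [1 0; b A] s(x)`. -/
def assemble {m : ℕ} (q : (G m × (Fin m → ℂ)) × (Fin (m + 1) → ℂ)) : G (m + 1) :=
  lower q.1.1 q.1.2 * rowSection q.2

theorem measurable_assemble (m : ℕ) : Measurable (assemble (m := m)) :=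
  ((measurable_lower m).comp measurable_fst).mul ((measurable_rowSection m).comp measurable_snd)

/-- The measure `dA db dx` on `SL_{m+1}(ℂ)`, in the coordinates `[1 0; b A] s(x)`. -/
def rowMeasure {m : ℕ} (κ : Measure (G m)) : Measure (G (m + 1)) :=
  Measure.map assemble ((lowerMeasure κ).prod volume)

theorem lintegral_rowMeasure {m : ℕ} (κ : Measure (G m)) [SFinite κ] {F : G (m + 1) → ℝ≥0∞}
    (hF : Measurable F) :
    ∫⁻ g, F g ∂(rowMeasure κ) =
      ∫⁻ x : Fin (m + 1) → ℂ, ∫⁻ p, F (lower p.1 p.2 * rowSection x) ∂(lowerMeasure κ) := by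
  rw [rowMeasure, lintegral_map hF (measurable_assemble m),
    lintegral_prod_symm' (fun q => F (assemble q)) (hF.comp (measurable_assemble m))]
  rfl

/-- By `lower_mul` this map is right multiplication by `lower B c`, seen in the coordinates `(A,
b)`. It is a skew product: right translation in `A` and, for fixed `A`, a translation in `b`. -/
theorem measurePreserving_lowerMeasure {m : ℕ} (κ : Measure (G m)) [SFinite κ]
    [κ.IsMulRightInvariant] (B : G m) (c : Fin m → ℂ) :
    MeasurePreserving (fun p : G m × (Fin m → ℂ) =>
      (p.1 * B, p.2 + (p.1 : Matrix (Fin m) (Fin m) ℂ) *ᵥ c))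
      (lowerMeasure κ) (lowerMeasure κ) := by
  refine (measurePreserving_mul_right κ B).skew_product (g := fun A b =>
    b + (A : Matrix (Fin m) (Fin m) ℂ) *ᵥ c) ?_ (Filter.Eventually.of_forall fun A => ?_)
  · refine measurable_pi_iff.2 fun i => ?_
    change Measurable fun p : G m × (Fin m → ℂ) => p.2 i + ∑ j, p.1 i j * c j
    refine ((measurable_pi_apply i).comp measurable_snd).add
      (Finset.measurable_sum _ fun j _ => ?_)
    exact ((measurable_G_entry i j).comp measurable_fst).mul_const _
  · exact (measurePreserving_add_right volume _).map_eq

/-- The integral over a coset of the stabilizer does not depend on the representative. Hence the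
section can be exchanged at will: for the invariance of `rowMeasure`, and later for a representative
with diagonal Gram matrix. -/
theorem lintegral_lower_mul_congr {m : ℕ} (κ : Measure (G m)) [SFinite κ]
    [κ.IsMulRightInvariant] {F : G (m + 1) → ℝ≥0∞} (hF : Measurable F) {g g' : G (m + 1)}
    (h : row0 g = row0 g') :
    ∫⁻ p, F (lower p.1 p.2 * g) ∂(lowerMeasure κ) =
      ∫⁻ p, F (lower p.1 p.2 * g') ∂(lowerMeasure κ) := by
  obtain ⟨B, c, rfl⟩ := exists_eq_lower_mul h
  rw [← (measurePreserving_lowerMeasure κ B c).lintegral_comp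
    (f := fun p => F (lower p.1 p.2 * g')) (hF.comp ((measurable_lower m).mul_const g'))]
  simp only [← mul_assoc, lower_mul]

/-- Right translation by `h` moves `x` to `x h`, which preserves `dx`; moreover `s(x) h` and `s(x
h)` have the same first row and so represent the same coset. The points where the section fails at
`x` or at `x h` form a null set. -/
theorem rowMeasure_isMulRightInvariant {m : ℕ} (hm : m ≠ 0) (κ : Measure (G m)) [SFinite κ]
    [κ.IsMulRightInvariant] : (rowMeasure κ).IsMulRightInvariant := by
  refine ⟨fun h => Measure.ext_of_lintegral _ fun F hF => ?_⟩
  rw [lintegral_map hF (measurable_mul_const h), lintegral_rowMeasure κ hF,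
    lintegral_rowMeasure κ (F := fun g => F (g * h)) (hF.comp (measurable_mul_const h))]
  have hm' : Measurable fun x : Fin (m + 1) → ℂ =>
      ∫⁻ p, F (lower p.1 p.2 * rowSection x) ∂(lowerMeasure κ) :=
    (hF.comp (measurable_assemble m)).lintegral_prod_left'
  rw [← (measurePreserving_vecMul h).lintegral_comp hm']
  refine lintegral_congr_ae ?_
  filter_upwards [ae_zero_ne m,
    (measurePreserving_vecMul h).quasiMeasurePreserving.ae (ae_zero_ne m)] with x hx hx'
  simp only [mul_assoc]
  refine lintegral_lower_mul_congr κ hF ?_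
  rw [row0_mul, row0_rowSection hm hx, row0_rowSection hm hx']

/-- A left inverse of `assemble`. -/
def disassemble {m : ℕ} (g : G (m + 1)) : (G m × (Fin m → ℂ)) × (Fin (m + 1) → ℂ) :=
  ((if h : ((g * (rowSection (row0 g))⁻¹ : G (m + 1)).1.submatrix Fin.succ Fin.succ).det = 1
      then mkG _ h else 1, fun i => (g * (rowSection (row0 g))⁻¹) i.succ 0), row0 g)

theorem measurable_disassemble (m : ℕ) : Measurable (disassemble (m := m)) := by
  have hq : Measurable fun g : G (m + 1) => g * (rowSection (row0 g))⁻¹ :=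
    measurable_id.mul ((measurable_rowSection m).comp (measurable_row0 m)).inv
  refine ((measurable_dite_mkG (measurable_matrix_iff.2 fun i j => ?_)).prodMk
    (measurable_pi_iff.2 fun i => ?_)).prodMk (measurable_row0 m)
  · exact (measurable_G_entry i.succ j.succ).comp hq
  · exact (measurable_G_entry i.succ 0).comp hq

theorem disassemble_assemble {m : ℕ} (hm : m ≠ 0) {q : (G m × (Fin m → ℂ)) × (Fin (m + 1) → ℂ)}
    (hq : q.2 0 ≠ 0) : disassemble (assemble q) = q := by
  obtain ⟨⟨A, b⟩, x⟩ := q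
  have hrow : row0 (assemble ((A, b), x)) = x := by
    rw [assemble, row0_lower_mul, row0_rowSection hm hq]
  have hs : (lowerMat (A : Matrix (Fin m) (Fin m) ℂ) b).submatrix Fin.succ Fin.succ =
    (A : Matrix (Fin m) (Fin m) ℂ) := rfl
  have hmul : assemble ((A, b), x) * (rowSection x)⁻¹ = lower A b := by
    simp [assemble]
  unfold disassemble
  rw [hrow, hmul]
  refine Prod.ext (Prod.ext ?_ rfl) rfl
  have h1 : ((lower A b).1.submatrix Fin.succ Fin.succ).det = 1 := det_coeG A
  simp only [dif_pos h1]
  rfl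

/-- `disassemble` carries `rowMeasure κ` back to the product measure, and sigma-finiteness of an
image passes to the source. -/
theorem rowMeasure_sigmaFinite {m : ℕ} (hm : m ≠ 0) (κ : Measure (G m)) [SigmaFinite κ] :
    SigmaFinite (rowMeasure κ) := by
  refine SigmaFinite.of_map (f := disassemble) _ (measurable_disassemble m).aemeasurable ?_
  rw [rowMeasure, Measure.map_map (measurable_disassemble m) (measurable_assemble m)]
  have : disassemble ∘ assemble =ᵐ[(lowerMeasure κ).prod volume] id := by
    have h := Measure.quasiMeasurePreserving_snd (μ := lowerMeasure κ)
      (ν := (volume : Measure (Fin (m + 1) → ℂ)))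
    filter_upwards [h.ae (ae_zero_ne m)] with q hq
    exact disassemble_assemble hm hq
  rw [Measure.map_congr this, Measure.map_id]
  infer_instance

theorem rowMeasure_ne_zero {m : ℕ} (κ : Measure (G m)) [SFinite κ] (hκ : κ ≠ 0) :
    rowMeasure κ ≠ 0 := by
  intro h
  have := congrArg (fun μ : Measure (G (m + 1)) => μ Set.univ) h
  simp only [rowMeasure, Measure.map_apply (measurable_assemble m) MeasurableSet.univ,
    Set.preimage_univ, Measure.coe_zero, Pi.zero_apply] at this
  rw [← Set.univ_prod_univ, Measure.prod_prod, ← Set.univ_prod_univ, Measure.prod_prod] at this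
  simp only [mul_eq_zero, Measure.measure_univ_eq_zero, hκ, false_or] at this
  exact this.elim (NeZero.ne _) (NeZero.ne _)

theorem isHaarMeasure_rowMeasure {m : ℕ} (hm : m ≠ 0) (κ : Measure (G m)) [κ.IsHaarMeasure] :
    (rowMeasure κ).IsHaarMeasure := by
  have := isMulRightInvariant_of_isHaarMeasure hm κ
  have := rowMeasure_isMulRightInvariant hm κ
  have := rowMeasure_sigmaFinite hm κ
  exact isHaarMeasure_of_isMulRightInvariant (Nat.succ_ne_zero m) _ (rowMeasure_ne_zero κ
    (Measure.measure_univ_ne_zero.1 (isOpen_univ.measure_ne_zero κ Set.univ_nonempty)))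

/-! ### The radial part of Lebesgue measure on `ℂ^{m+1}` -/

/-- The squared Euclidean norm. -/
def sqNorm {m : ℕ} (x : Fin m → ℂ) : ℝ := ∑ i, ‖x i‖ ^ 2

theorem measurable_sqNorm (m : ℕ) : Measurable (sqNorm (m := m)) :=
  Finset.measurable_sum _ fun i _ => (measurable_pi_apply i).norm.pow_const 2

theorem volume_sqNorm_le (m : ℕ) {t : ℝ} (ht : 0 ≤ t) :
    volume {x : Fin (m + 1) → ℂ | sqNorm x ≤ t} =
      ENNReal.ofReal (Real.pi ^ (m + 1) / (m + 1).factorial * t ^ (m + 1)) := by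
  have h := Complex.volume_sum_rpow_le (Fin (m + 1)) (p := 2) (by norm_num) (Real.sqrt t)
  have hs : {x : Fin (m + 1) → ℂ | (∑ i, ‖x i‖ ^ (2 : ℝ)) ^ (1 / (2 : ℝ)) ≤ Real.sqrt t} =
      {x : Fin (m + 1) → ℂ | sqNorm x ≤ t} := by
    ext x
    simp only [Set.mem_ofPred_eq, Real.rpow_two, ← Real.sqrt_eq_rpow]
    rw [Real.sqrt_le_sqrt_iff ht]
    rfl
  rw [hs] at h
  rw [h, Fintype.card_fin, ← ENNReal.ofReal_pow (Real.sqrt_nonneg t),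
    ← ENNReal.ofReal_mul (by positivity), pow_mul, Real.sq_sqrt ht]
  congr 1
  have h1 : Real.Gamma (2 / 2 + 1) = 1 := by norm_num [Real.Gamma_two]
  have h2 : Real.Gamma (2 * ((m + 1 : ℕ) : ℝ) / 2 + 1) = (m + 1).factorial := by
    rw [mul_div_cancel_left₀ _ (two_ne_zero), Real.Gamma_nat_eq_factorial]
  rw [h1, h2]
  ring

/-- The measure `u^m du` on the positive half-line. -/
def powMeasure (m : ℕ) : Measure ℝ :=
  (volume.restrict (Set.Ioi 0)).withDensity fun u => ENNReal.ofReal (u ^ m)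

theorem powMeasure_Iic (m : ℕ) {t : ℝ} (ht : 0 ≤ t) :
    powMeasure m (Set.Iic t) = ENNReal.ofReal (t ^ (m + 1) / (m + 1)) := by
  rw [powMeasure, withDensity_apply _ measurableSet_Iic, Measure.restrict_restrict
    measurableSet_Iic, Set.inter_comm, Set.Ioi_inter_Iic,
    ← ofReal_integral_eq_lintegral_ofReal]
  · rw [← intervalIntegral.integral_of_le ht, integral_pow]
    simp
  · exact (continuous_pow m).integrableOn_Ioc
  · filter_upwards [ae_restrict_mem measurableSet_Ioc] with u hu
    exact pow_nonneg hu.1.le m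

theorem powMeasure_Iic_of_neg (m : ℕ) {t : ℝ} (ht : t < 0) : powMeasure m (Set.Iic t) = 0 := by
  rw [powMeasure, withDensity_apply _ measurableSet_Iic, Measure.restrict_restrict
    measurableSet_Iic, Set.inter_comm, Set.Ioi_inter_Iic, Set.Ioc_eq_empty (not_lt.2 ht.le)]
  simp

/-- Both sides give a half-line the volume `π^{m+1} t^{m+1} / (m+1)!` of a Euclidean ball, and
half-lines form a generating π-system. This is the source of the constant `m!/π^{m+1}` in the
recursion. -/
theorem map_sqNorm_volume (m : ℕ) :
    Measure.map sqNorm (volume : Measure (Fin (m + 1) → ℂ)) =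
      ENNReal.ofReal (Real.pi ^ (m + 1) / m.factorial) • powMeasure m := by
  have hval : ∀ t : ℝ, Measure.map sqNorm (volume : Measure (Fin (m + 1) → ℂ)) (Set.Iic t) =
      (ENNReal.ofReal (Real.pi ^ (m + 1) / m.factorial) • powMeasure m) (Set.Iic t) := fun t => by
    rw [Measure.map_apply (measurable_sqNorm _) measurableSet_Iic, Measure.smul_apply, smul_eq_mul]
    rcases le_or_gt 0 t with ht | ht
    · change volume {x : Fin (m + 1) → ℂ | sqNorm x ≤ t} = _
      rw [powMeasure_Iic m ht, volume_sqNorm_le m ht, ← ENNReal.ofReal_mul (by positivity)]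
      congr 1
      rw [Nat.factorial_succ]
      push_cast
      field_simp
    · rw [powMeasure_Iic_of_neg m ht, mul_zero]
      convert measure_empty (μ := (volume : Measure (Fin (m + 1) → ℂ)))
      refine Set.eq_empty_of_forall_notMem fun x hx => ?_
      have : 0 ≤ sqNorm x := Finset.sum_nonneg fun i _ => by positivity
      exact absurd (lt_of_le_of_lt (this.trans hx) ht) (lt_irrefl _)
  refine Measure.ext_of_generateFrom_of_iUnion (Set.range Set.Iic) (fun k : ℕ => Set.Iic (k : ℝ))
    ?_ isPiSystem_Iic ?_ (fun k => ⟨_, rfl⟩) (fun k => ?_) ?_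
  · rw [BorelSpace.measurable_eq (α := ℝ), borel_eq_generateFrom_Iic]
  · refine Set.eq_univ_of_forall fun t => Set.mem_iUnion.2 ?_
    exact exists_nat_ge t
  · rw [hval, Measure.smul_apply, powMeasure_Iic m (Nat.cast_nonneg k), smul_eq_mul]
    exact ENNReal.mul_ne_top ENNReal.ofReal_ne_top ENNReal.ofReal_ne_top
  · rintro _ ⟨t, rfl⟩
    exact hval t

/-- Integration of radial functions on `ℂ^{m+1}`. -/
theorem lintegral_sqNorm (m : ℕ) {H : ℝ → ℝ≥0∞} (hH : Measurable H) :
    ∫⁻ x : Fin (m + 1) → ℂ, H (sqNorm x) = ENNReal.ofReal (Real.pi ^ (m + 1) / m.factorial) *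
      ∫⁻ u in Set.Ioi 0, ENNReal.ofReal (u ^ m) * H u := by
  rw [← lintegral_map hH (measurable_sqNorm _), map_sqNorm_volume, lintegral_smul_measure,
    powMeasure, lintegral_withDensity_eq_lintegral_mul _ (by fun_prop) hH]
  rfl

/-! ### Hermitian block matrices -/

/-- The Hermitian block matrix `[y w; w* Y]`. -/
def hermBlock {m : ℕ} (y : ℝ) (w : Fin m → ℂ) (Y : Matrix (Fin m) (Fin m) ℂ) :
    Matrix (Fin (m + 1)) (Fin (m + 1)) ℂ :=
  Matrix.of (Fin.cons (Fin.cons (y : ℂ) w) fun i => Fin.cons (star (w i)) (Y i))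

section hermBlock
variable {m : ℕ} (y : ℝ) (w : Fin m → ℂ) (Y : Matrix (Fin m) (Fin m) ℂ)

@[simp] theorem hermBlock_zero_zero : hermBlock y w Y 0 0 = y := rfl
@[simp] theorem hermBlock_zero_succ (j : Fin m) : hermBlock y w Y 0 j.succ = w j := rfl
@[simp] theorem hermBlock_succ_zero (i : Fin m) : hermBlock y w Y i.succ 0 = star (w i) := rfl
@[simp] theorem hermBlock_succ_succ (i j : Fin m) : hermBlock y w Y i.succ j.succ = Y i j := rfl

theorem measurable_hermBlock : Measurable fun p : (ℝ × (Fin m → ℂ)) × Matrix (Fin m) (Fin m) ℂ =>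
    hermBlock p.1.1 p.1.2 p.2 := by
  refine measurable_matrix_iff.2 fun i j => ?_
  refine Fin.cases ?_ (fun i => ?_) i <;> refine Fin.cases ?_ (fun j => ?_) j
  · exact Complex.measurable_ofReal.comp (measurable_fst.comp measurable_fst)
  · exact (measurable_pi_apply j).comp (measurable_snd.comp measurable_fst)
  · exact continuous_star.measurable.comp
      ((measurable_pi_apply i).comp (measurable_snd.comp measurable_fst))
  · exact (measurable_entry i j).comp measurable_snd

/-- Completion of the square: a Hermitian matrix with corner `y ≠ 0` becomes block diagonal after
the substitution `w = y b*` in the first row and a translation of the lower block by the Hermitian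
matrix `y b b*`. -/
theorem lowerMat_one_conj (b : Fin m → ℂ) :
    lowerMat 1 b * hermBlock y 0 Y * (lowerMat 1 b)ᴴ =
      hermBlock y ((y : ℂ) • star b) (Y + (y : ℂ) • vecMulVec b (star b)) := by
  apply matrix_ext_succ <;> intros <;>
    simp [Matrix.mul_apply, Fin.sum_univ_succ, Matrix.one_apply, vecMulVec_apply, mul_comm,
      mul_left_comm, mul_assoc, add_comm]

theorem lowerMat_zero_conj (A : Matrix (Fin m) (Fin m) ℂ) :
    lowerMat A 0 * hermBlock y 0 Y * (lowerMat A 0)ᴴ = hermBlock y 0 (A * Y * Aᴴ) := by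
  apply matrix_ext_succ <;> intros <;>
    simp [Matrix.mul_apply, Fin.sum_univ_succ]

theorem det_hermBlock_zero : (hermBlock y 0 Y).det = y * Y.det := by
  rw [Matrix.det_succ_row_zero, Fin.sum_univ_succ]
  simp only [hermBlock_zero_zero, hermBlock_zero_succ, Pi.zero_apply, mul_zero, zero_mul,
    Finset.sum_const_zero, add_zero, Fin.val_zero, pow_zero, one_mul]
  congr 1

theorem smul_hermBlock_zero (a : ℝ) : a • hermBlock y 0 Y = hermBlock (a * y) 0 (a • Y) := by
  apply matrix_ext_succ <;> intros <;> simp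

theorem posDef_hermBlock_zero_iff : (hermBlock y 0 Y).PosDef ↔ 0 < y ∧ Y.PosDef := by
  have key : ∀ x : Fin (m + 1) → ℂ, star x ⬝ᵥ (hermBlock y 0 Y *ᵥ x) =
      star (x 0) * (y * x 0) + star (fun i : Fin m => x i.succ) ⬝ᵥ (Y *ᵥ fun i => x i.succ) := by
    intro x
    simp [dotProduct, Matrix.mulVec, Fin.sum_univ_succ]
  have hy : ∀ z : ℂ, star z * (y * z) = ((y * ‖z‖ ^ 2 : ℝ) : ℂ) := fun z => by
    have := Complex.conj_mul' z
    rw [Complex.star_def]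
    push_cast
    rw [← this]
    ring
  constructor
  · intro h
    refine ⟨?_, Matrix.PosDef.of_dotProduct_mulVec_pos ?_ fun x hx => ?_⟩
    · have := h.diag_pos (i := 0)
      simpa using this
    · ext i j
      have := congrFun (congrFun h.isHermitian i.succ) j.succ
      simpa [Matrix.conjTranspose_apply] using this
    · have h0 : (Fin.cons 0 x : Fin (m + 1) → ℂ) ≠ 0 := fun h0 => hx (by
        funext i
        simpa using congrFun h0 i.succ)
      have := h.dotProduct_mulVec_pos h0
      rw [key] at this
      simpa using this
  · rintro ⟨hy0, hY⟩
    refine Matrix.PosDef.of_dotProduct_mulVec_pos ?_ fun x hx => ?_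
    · apply matrix_ext_succ <;> intros <;> simp [Matrix.conjTranspose_apply]
      simpa using congrFun (congrFun hY.isHermitian _) _
    · rw [key, hy]
      by_cases hx0 : (fun i : Fin m => x i.succ) = 0
      · have h0 : x 0 ≠ 0 := fun h0 => hx (by
          funext i
          exact Fin.cases h0 (fun i => congrFun hx0 i) i)
        rw [hx0]
        simp only [star_zero, zero_dotProduct, add_zero]
        rw [Complex.zero_lt_real]
        positivity
      · refine add_pos_of_nonneg_of_pos ?_ (hY.dotProduct_mulVec_pos hx0)
        rw [Complex.zero_le_real]
        positivity

end hermBlock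

theorem isUnit_lowerMat_one {m : ℕ} (b : Fin m → ℂ) : IsUnit (lowerMat 1 b) := by
  rw [Matrix.isUnit_iff_isUnit_det, det_lowerMat, Matrix.det_one]
  exact isUnit_one

theorem posDef_lowerMat_conj_iff {m : ℕ} (y : ℝ) (b : Fin m → ℂ)
    (Y : Matrix (Fin m) (Fin m) ℂ) :
    (lowerMat 1 b * hermBlock y 0 Y * (lowerMat 1 b)ᴴ).PosDef ↔ 0 < y ∧ Y.PosDef := by
  rw [← posDef_hermBlock_zero_iff]
  exact (isUnit_lowerMat_one b).posDef_star_right_conjugate_iff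

theorem det_lowerMat_conj {m : ℕ} (y : ℝ) (b : Fin m → ℂ) (Y : Matrix (Fin m) (Fin m) ℂ) :
    (lowerMat 1 b * hermBlock y 0 Y * (lowerMat 1 b)ᴴ).det = y * Y.det := by
  simp [Matrix.det_mul, Matrix.det_conjTranspose, det_lowerMat, det_hermBlock_zero]

/-! ### Lebesgue measure on Hermitian matrices, recursively -/

/-- The index pairs of a Hermitian matrix of size `m + 1`. -/
def pairMap (m : ℕ) : Fin m ⊕ {p : Fin m × Fin m // p.1 < p.2} →
    {p : Fin (m + 1) × Fin (m + 1) // p.1 < p.2} :=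
  Sum.elim (fun j => ⟨(0, j.succ), Fin.succ_pos j⟩)
    fun p => ⟨(p.1.1.succ, p.1.2.succ), Fin.succ_lt_succ_iff.2 p.2⟩

theorem pairMap_bijective (m : ℕ) : Function.Bijective (pairMap m) := by
  constructor
  · rintro (j | ⟨⟨i, j⟩, h⟩) (j' | ⟨⟨i', j'⟩, h'⟩) e <;>
      simp_all [pairMap, Fin.ext_iff]
  · rintro ⟨⟨i, j⟩, h⟩
    induction j using Fin.cases with
    | zero => exact absurd h (Fin.not_lt_zero i)
    | succ j =>
      induction i using Fin.cases with
      | zero => exact ⟨Sum.inl j, rfl⟩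
      | succ i => exact ⟨Sum.inr ⟨(i, j), Fin.succ_lt_succ_iff.1 h⟩, rfl⟩

/-- The index pairs of a Hermitian matrix of size `m + 1`, as an equivalence. -/
def pairEquiv (m : ℕ) : Fin m ⊕ {p : Fin m × Fin m // p.1 < p.2} ≃
    {p : Fin (m + 1) × Fin (m + 1) // p.1 < p.2} :=
  Equiv.ofBijective _ (pairMap_bijective m)

/-- Hermitian coordinates in size `m + 1` from those in size `m`. -/
def consCoord (m : ℕ) : (ℝ × (Fin m → ℝ)) × ((Fin m → ℂ) × ({p : Fin m × Fin m // p.1 < p.2} → ℂ))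
    ≃ᵐ HermCoord (m + 1) :=
  MeasurableEquiv.prodCongr (MeasurableEquiv.piFinSuccAbove (fun _ : Fin (m + 1) => ℝ) 0).symm
    ((MeasurableEquiv.sumPiEquivProdPi
      (fun _ : Fin m ⊕ {p : Fin m × Fin m // p.1 < p.2} => ℂ)).symm.trans
      (MeasurableEquiv.piCongrLeft (fun _ => ℂ) (pairEquiv m)))

theorem measurePreserving_consCoord (m : ℕ) : MeasurePreserving (consCoord m) volume volume := by
  refine MeasurePreserving.prod
    (volume_preserving_piFinSuccAbove (fun _ : Fin (m + 1) => ℝ) 0).symm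
    ((volume_measurePreserving_sumPiEquivProdPi_symm _).trans
      (volume_measurePreserving_piCongrLeft _ (pairEquiv m)))

theorem hermMatrix_consCoord (m : ℕ) (y : ℝ) (d : Fin m → ℝ) (w : Fin m → ℂ)
    (o : {p : Fin m × Fin m // p.1 < p.2} → ℂ) :
    hermMatrix (m + 1) (consCoord m ((y, d), (w, o))) = hermBlock y w (hermMatrix m (d, o)) := by
  have h1 : ∀ j : Fin m, (consCoord m ((y, d), (w, o))).2 ⟨(0, j.succ), Fin.succ_pos j⟩ = w j :=
    fun j => Equiv.piCongrLeft_apply_apply (fun _ => ℂ) (pairEquiv m)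
      ((MeasurableEquiv.sumPiEquivProdPi
        (fun _ : Fin m ⊕ {p : Fin m × Fin m // p.1 < p.2} => ℂ)).symm (w, o)) (Sum.inl j)
  have h2 : ∀ (i j : Fin m) (h : i < j), (consCoord m ((y, d), (w, o))).2
      ⟨(i.succ, j.succ), Fin.succ_lt_succ_iff.2 h⟩ = o ⟨(i, j), h⟩ := fun i j h =>
    Equiv.piCongrLeft_apply_apply (fun _ => ℂ) (pairEquiv m)
      ((MeasurableEquiv.sumPiEquivProdPi
        (fun _ : Fin m ⊕ {p : Fin m × Fin m // p.1 < p.2} => ℂ)).symm (w, o))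
      (Sum.inr ⟨(i, j), h⟩)
  have h3 : (consCoord m ((y, d), (w, o))).1 0 = y := rfl
  have h4 : ∀ i : Fin m, (consCoord m ((y, d), (w, o))).1 i.succ = d i := fun i => rfl
  apply matrix_ext_succ
  · simp [hermMatrix, h3]
  · intro j
    simp [hermMatrix, h1]
  · intro i
    simp [hermMatrix, h1]
  · intro i j
    simp only [hermMatrix, Matrix.of_apply, Fin.succ_lt_succ_iff, hermBlock_succ_succ, h4]
    split_ifs with h h'
    · exact h2 i j h
    · rw [h2 j i h']
    · rfl

theorem measurable_hermMatrix (m : ℕ) : Measurable (hermMatrix m) := by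
  refine measurable_matrix_iff.2 fun i j => ?_
  simp only [hermMatrix, Matrix.of_apply]
  split_ifs
  · exact (measurable_pi_apply _).comp measurable_snd
  · exact continuous_star.measurable.comp ((measurable_pi_apply _).comp measurable_snd)
  · exact Complex.measurable_ofReal.comp ((measurable_pi_apply _).comp measurable_fst)

instance instSFiniteHermLebesgue (m : ℕ) : SFinite (hermLebesgue m) := by
  unfold hermLebesgue
  infer_instance

theorem lintegral_hermLebesgue_succ (m : ℕ) {φ : Matrix (Fin (m + 1)) (Fin (m + 1)) ℂ → ℝ≥0∞}
    (hφ : Measurable φ) :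
    ∫⁻ Y, φ Y ∂(hermLebesgue (m + 1)) =
      ∫⁻ y : ℝ, ∫⁻ w : Fin m → ℂ, ∫⁻ Y, φ (hermBlock y w Y) ∂(hermLebesgue m) := by
  have hm : Measurable fun q : (ℝ × (Fin m → ℝ)) ×
      ((Fin m → ℂ) × ({p : Fin m × Fin m // p.1 < p.2} → ℂ)) =>
      φ (hermBlock q.1.1 q.2.1 (hermMatrix m (q.1.2, q.2.2))) :=
    hφ.comp (measurable_hermBlock.comp (((measurable_fst.comp measurable_fst).prodMk
      (measurable_fst.comp measurable_snd)).prodMk ((measurable_hermMatrix m).comp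
      ((measurable_snd.comp measurable_fst).prodMk (measurable_snd.comp measurable_snd)))))
  rw [hermLebesgue, lintegral_map hφ (measurable_hermMatrix _),
    ← (measurePreserving_consCoord m).lintegral_comp
      (f := fun c => φ (hermMatrix (m + 1) c)) (hφ.comp (measurable_hermMatrix _))]
  have h1 : ∀ q : (ℝ × (Fin m → ℝ)) ×
      ((Fin m → ℂ) × ({p : Fin m × Fin m // p.1 < p.2} → ℂ)),
      φ (hermMatrix (m + 1) (consCoord m q)) =
        φ (hermBlock q.1.1 q.2.1 (hermMatrix m (q.1.2, q.2.2))) := fun q => by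
    rw [← hermMatrix_consCoord]
  simp only [h1]
  rw [Measure.volume_eq_prod, lintegral_prod _ hm.aemeasurable, Measure.volume_eq_prod,
    lintegral_prod _ hm.lintegral_prod_right'.aemeasurable]
  refine lintegral_congr fun y => ?_
  have hmy : Measurable fun q : (Fin m → ℝ) ×
      ((Fin m → ℂ) × ({p : Fin m × Fin m // p.1 < p.2} → ℂ)) =>
      φ (hermBlock y q.2.1 (hermMatrix m (q.1, q.2.2))) :=
    hm.comp ((measurable_const.prodMk measurable_fst).prodMk measurable_snd)
  have h2 : ∀ d : Fin m → ℝ, ∫⁻ p : (Fin m → ℂ) × ({p : Fin m × Fin m // p.1 < p.2} → ℂ),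
      φ (hermBlock y p.1 (hermMatrix m (d, p.2))) ∂(volume.prod volume) =
      ∫⁻ w : Fin m → ℂ, ∫⁻ o : {p : Fin m × Fin m // p.1 < p.2} → ℂ,
        φ (hermBlock y w (hermMatrix m (d, o))) := fun d =>
    lintegral_prod _ (hmy.comp (measurable_const.prodMk measurable_id)).aemeasurable
  simp only [Measure.volume_eq_prod (Fin m → ℂ), h2]
  -- The diagonal `d` of the lower block is moved inside the integral over `w`, next to the
  -- off-diagonal part `o`, so that the two recombine into `hermLebesgue m`.
  rw [lintegral_lintegral_swap]
  · refine lintegral_congr fun w => ?_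
    have hY : Measurable fun Y : Matrix (Fin m) (Fin m) ℂ => φ (hermBlock y w Y) :=
      hφ.comp (measurable_hermBlock.comp
        ((measurable_const (a := (y, w))).prodMk measurable_id))
    rw [hermLebesgue, lintegral_map hY (measurable_hermMatrix m), Measure.volume_eq_prod,
      lintegral_prod (fun c => φ (hermBlock y w (hermMatrix m c)))
        (hY.comp (measurable_hermMatrix m)).aemeasurable]
  · refine Measurable.aemeasurable ?_
    have hm3 : Measurable fun q : ((Fin m → ℝ) × (Fin m → ℂ)) ×
        ({p : Fin m × Fin m // p.1 < p.2} → ℂ) =>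
        φ (hermBlock y q.1.2 (hermMatrix m (q.1.1, q.2))) :=
      hmy.comp ((measurable_fst.comp measurable_fst).prodMk
        ((measurable_snd.comp measurable_fst).prodMk measurable_snd))
    exact hm3.lintegral_prod_right'

theorem exists_hermMatrix_eq {m : ℕ} {H : Matrix (Fin m) (Fin m) ℂ} (hH : H.IsHermitian) :
    ∃ c, hermMatrix m c = H := by
  refine ⟨(fun i => (H i i).re, fun p => H p.1.1 p.1.2), ?_⟩
  ext i j
  have h1 : ∀ i j, star (H j i) = H i j := fun i j => congrFun (congrFun hH i) j
  simp only [hermMatrix, Matrix.of_apply]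
  rcases lt_trichotomy i j with h | rfl | h
  · simp [h]
  · simpa using Complex.conj_eq_iff_re.1 (h1 i i)
  · simpa [h, h.not_gt] using h1 i j

theorem hermMatrix_add (m : ℕ) (c d : HermCoord m) :
    hermMatrix m (c + d) = hermMatrix m c + hermMatrix m d := by
  ext i j
  simp only [hermMatrix, Matrix.of_apply, Matrix.add_apply]
  split_ifs <;> simp

/-- Translation by Hermitian matrices preserves Lebesgue measure. -/
theorem lintegral_hermLebesgue_add {m : ℕ} {φ : Matrix (Fin m) (Fin m) ℂ → ℝ≥0∞}
    (hφ : Measurable φ) {H : Matrix (Fin m) (Fin m) ℂ} (hH : H.IsHermitian) :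
    ∫⁻ Y, φ (Y + H) ∂(hermLebesgue m) = ∫⁻ Y, φ Y ∂(hermLebesgue m) := by
  obtain ⟨c, rfl⟩ := exists_hermMatrix_eq hH
  have hadd : Measurable fun Y : Matrix (Fin m) (Fin m) ℂ => Y + hermMatrix m c :=
    measurable_matrix_iff.2 fun i j => (measurable_entry i j).add_const _
  rw [hermLebesgue, lintegral_map (f := fun Y => φ (Y + hermMatrix m c)) (hφ.comp hadd)
      (measurable_hermMatrix m),
    lintegral_map hφ (measurable_hermMatrix m)]
  simp only [← hermMatrix_add]
  exact ((measurePreserving_add_right volume c.1).prod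
    (measurePreserving_add_right volume c.2)).lintegral_comp
    (f := fun d => φ (hermMatrix m d)) (hφ.comp (measurable_hermMatrix m))

/-! ### Scaling -/

theorem lintegral_Ioi_comp_mul {a : ℝ} (ha : 0 < a) {H : ℝ → ℝ≥0∞} (hH : Measurable H) :
    ∫⁻ y in Set.Ioi 0, H y = ENNReal.ofReal a * ∫⁻ u in Set.Ioi 0, H (a * u) := by
  have hm : Measurable fun u : ℝ => a * u := measurable_const_mul a
  have h := Real.smul_map_volume_mul_left ha.ne'
  rw [abs_of_pos ha] at h
  rw [← lintegral_indicator measurableSet_Ioi, ← lintegral_indicator measurableSet_Ioi]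
  conv_lhs => rw [← h]
  rw [lintegral_smul_measure, lintegral_map (hH.indicator measurableSet_Ioi) hm, smul_eq_mul]
  congr 1
  refine lintegral_congr fun u => ?_
  by_cases hu : 0 < u
  · rw [Set.indicator_of_mem (by simpa using mul_pos ha hu), Set.indicator_of_mem (by simpa)]
  · rw [Set.indicator_of_notMem (by simpa [ha] using hu),
      Set.indicator_of_notMem (by simpa using hu)]

theorem measurePreserving_star_pi (m : ℕ) :
    MeasurePreserving (fun b : Fin m → ℂ => star b) volume volume :=
  volume_preserving_pi (f := fun _ : Fin m => fun z : ℂ => star z) fun _ =>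
    Complex.conjLIE.measurePreserving

theorem lintegral_comp_smul {ι : Type*} [Fintype ι] {z : ℂ} (hz : z ≠ 0)
    {H : (ι → ℂ) → ℝ≥0∞} (hH : Measurable H) :
    ∫⁻ w, H w = ENNReal.ofReal (‖z‖ ^ (2 * Fintype.card ι)) * ∫⁻ b, H (z • b) := by
  have hdet : LinearMap.det (z • (LinearMap.id : (ι → ℂ) →ₗ[ℂ] (ι → ℂ))) =
      z ^ Fintype.card ι := by
    rw [LinearMap.det_smul, LinearMap.det_id, mul_one, Module.finrank_fintype_fun_eq_card]
  have h := map_complexLinearMap_volume (z • (LinearMap.id : (ι → ℂ) →ₗ[ℂ] (ι → ℂ)))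
    (by rw [hdet]; exact pow_ne_zero _ hz)
  have hm : Measurable (z • (LinearMap.id : (ι → ℂ) →ₗ[ℂ] (ι → ℂ))) := by
    change Measurable fun b : ι → ℂ => z • b
    exact measurable_const_smul z
  have h2 := lintegral_map (μ := volume) hH hm
  rw [h, lintegral_smul_measure, hdet, norm_pow, ← pow_mul, mul_comm _ 2, smul_eq_mul] at h2
  have h3 : 0 < ‖z‖ ^ (2 * Fintype.card ι) := by positivity
  change _ = ∫⁻ b, H (z • b) at h2
  rw [← h2, ← mul_assoc, ← ENNReal.ofReal_mul h3.le, mul_inv_cancel₀ h3.ne', ENNReal.ofReal_one,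
    one_mul]

/-! ### The measure on positive definite matrices, recursively -/

theorem isClosed_posSemidef (n : ℕ) :
    IsClosed {Y : Matrix (Fin n) (Fin n) ℂ | Y.PosSemidef} := by
  have : {Y : Matrix (Fin n) (Fin n) ℂ | Y.PosSemidef} =
      {Y | Yᴴ = Y} ∩ ⋂ x : Fin n → ℂ, {Y | 0 ≤ star x ⬝ᵥ (Y *ᵥ x)} := by
    ext Y
    simp only [Set.mem_ofPred_eq, Matrix.posSemidef_iff_dotProduct_mulVec, Set.mem_inter_iff,
      Set.mem_iInter]
    rfl
  rw [this]
  refine (isClosed_eq continuous_id.matrix_conjTranspose continuous_id).inter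
    (isClosed_iInter fun x => ?_)
  exact isClosed_le continuous_const
    (Continuous.dotProduct continuous_const (continuous_id.matrix_mulVec continuous_const))

theorem measurableSet_posDef (n : ℕ) :
    MeasurableSet {Y : Matrix (Fin n) (Fin n) ℂ | Y.PosDef} := by
  have : {Y : Matrix (Fin n) (Fin n) ℂ | Y.PosDef} =
      {Y | Y.PosSemidef} ∩ {Y | Y.det ≠ 0} := by
    ext Y
    constructor
    · exact fun h => ⟨h.posSemidef, h.det_pos.ne'⟩
    · rintro ⟨h, h0⟩
      exact h.posDef_iff_isUnit.2 ((Matrix.isUnit_iff_isUnit_det _).2 (isUnit_iff_ne_zero.2 h0))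
  rw [this]
  exact (isClosed_posSemidef n).measurableSet.inter
    ((measurableSet_singleton 0).compl.preimage (measurable_det n))

/-- The density of `μ_n` with respect to Lebesgue measure on Hermitian matrices. -/
def posDensity (n k : ℕ) : Matrix (Fin n) (Fin n) ℂ → ℝ≥0∞ :=
  {Y | Y.PosDef}.indicator fun Y => ENNReal.ofReal ((‖Y.det‖ ^ k)⁻¹)

theorem measurable_detPow (n k : ℕ) :
    Measurable fun Y : Matrix (Fin n) (Fin n) ℂ => ENNReal.ofReal ((‖Y.det‖ ^ k)⁻¹) :=
  ((measurable_det n).norm.pow_const k).inv.ennreal_ofReal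

theorem measurable_posDensity (n k : ℕ) : Measurable (posDensity n k) :=
  (measurable_detPow n k).indicator (measurableSet_posDef n)

theorem lintegral_posMeasure (n : ℕ) {φ : Matrix (Fin n) (Fin n) ℂ → ℝ≥0∞} (hφ : Measurable φ) :
    ∫⁻ Y, φ Y ∂(posMeasure n) = ∫⁻ Y, posDensity n n Y * φ Y ∂(hermLebesgue n) := by
  rw [posMeasure, lintegral_withDensity_eq_lintegral_mul _ (measurable_detPow n n) hφ,
    ← lintegral_indicator (measurableSet_posDef n)]
  refine lintegral_congr fun Y => ?_
  by_cases h : Y ∈ {Y : Matrix (Fin n) (Fin n) ℂ | Y.PosDef}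
  · rw [posDensity, Set.indicator_of_mem h, Set.indicator_of_mem h, Pi.mul_apply]
  · rw [posDensity, Set.indicator_of_notMem h, Set.indicator_of_notMem h, zero_mul]

/-- The matrix `[1 0; b 1] diag(y, Y) [1 0; b 1]*`. -/
def conjBlock {m : ℕ} (y : ℝ) (b : Fin m → ℂ) (Y : Matrix (Fin m) (Fin m) ℂ) :
    Matrix (Fin (m + 1)) (Fin (m + 1)) ℂ :=
  lowerMat 1 b * hermBlock y 0 Y * (lowerMat 1 b)ᴴ

theorem Measurable.hermBlock {α : Type*} [MeasurableSpace α] {m : ℕ} {y : α → ℝ}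
    {w : α → Fin m → ℂ} {Y : α → Matrix (Fin m) (Fin m) ℂ} (hy : Measurable y)
    (hw : Measurable w) (hY : Measurable Y) :
    Measurable fun a => hermBlock (y a) (w a) (Y a) :=
  measurable_hermBlock.comp (f := fun a => ((y a, w a), Y a)) ((hy.prodMk hw).prodMk hY)

theorem Measurable.conjBlock {α : Type*} [MeasurableSpace α] {m : ℕ} {y : α → ℝ}
    {b : α → Fin m → ℂ} {Y : α → Matrix (Fin m) (Fin m) ℂ} (hy : Measurable y)
    (hb : Measurable b) (hY : Measurable Y) :
    Measurable fun a => conjBlock (y a) (b a) (Y a) := by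
  have hyc : Measurable fun a => (y a : ℂ) := Complex.measurable_ofReal.comp hy
  have hbi : ∀ i, Measurable fun a => b a i := fun i => (measurable_pi_apply i).comp hb
  have hsb : ∀ i, Measurable fun a => star (b a i) := fun i =>
    continuous_star.measurable.comp (hbi i)
  have h1 : Measurable fun a => (y a : ℂ) • star (b a) :=
    measurable_pi_iff.2 fun i => hyc.mul (hsb i)
  have h2 : Measurable fun a => Y a + (y a : ℂ) • vecMulVec (b a) (star (b a)) :=
    measurable_matrix_iff.2 fun i j =>
      ((measurable_entry i j).comp hY).add (hyc.mul ((hbi i).mul (hsb j)))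
  have : (fun a => GaussianCovolume.conjBlock (y a) (b a) (Y a)) = fun a =>
      GaussianCovolume.hermBlock (y a) ((y a : ℂ) • star (b a))
        (Y a + (y a : ℂ) • vecMulVec (b a) (star (b a))) := by
    funext a
    exact lowerMat_one_conj _ _ _
  rw [this]
  exact Measurable.hermBlock hy h1 h2

/-- The determinant is `y * Y.det`. The exponent is `m + 1` on the left but `m` in `posDensity m m`,
which leaves one extra factor `|det Y|⁻¹`. -/
theorem posDensity_conjBlock {m : ℕ} {y : ℝ} (hy : 0 < y) (b : Fin m → ℂ)
    (Y : Matrix (Fin m) (Fin m) ℂ) :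
    posDensity (m + 1) (m + 1) (conjBlock y b Y) = ENNReal.ofReal ((y ^ (m + 1))⁻¹) *
      (posDensity m m Y * ENNReal.ofReal (‖Y.det‖⁻¹)) := by
  have hiff : (conjBlock y b Y).PosDef ↔ 0 < y ∧ Y.PosDef := posDef_lowerMat_conj_iff y b Y
  by_cases hY : Y.PosDef
  · rw [posDensity, posDensity, Set.indicator_of_mem (show Y ∈ {Y | Y.PosDef} from hY),
      Set.indicator_of_mem (show conjBlock y b Y ∈ {Y | Y.PosDef} from hiff.2 ⟨hy, hY⟩),
      conjBlock, det_lowerMat_conj, ← ENNReal.ofReal_mul (by positivity),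
      ← ENNReal.ofReal_mul (by positivity)]
    congr 1
    rw [norm_mul, Complex.norm_real, Real.norm_of_nonneg hy.le, mul_pow, pow_succ ‖Y.det‖,
      mul_inv, mul_inv]
  · rw [posDensity, posDensity, Set.indicator_of_notMem (show Y ∉ {Y | Y.PosDef} from hY),
      Set.indicator_of_notMem (show conjBlock y b Y ∉ {Y | Y.PosDef} from
        fun h => hY (hiff.1 h).2)]
    simp

/-- For `y > 0`, the fibre of the measure on positive definite matrices over the corner `y`. -/
theorem lintegral_posDensity_hermBlock {m : ℕ} {φ : Matrix (Fin (m + 1)) (Fin (m + 1)) ℂ → ℝ≥0∞}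
    (hφ : Measurable φ) {y : ℝ} (hy : 0 < y) (b : Fin m → ℂ) :
    ∫⁻ Y, posDensity (m + 1) (m + 1) (hermBlock y ((y : ℂ) • star b) Y) *
      φ (hermBlock y ((y : ℂ) • star b) Y) ∂(hermLebesgue m) =
    ENNReal.ofReal ((y ^ (m + 1))⁻¹) *
      ∫⁻ Y, ENNReal.ofReal (‖Y.det‖⁻¹) * φ (conjBlock y b Y) ∂(posMeasure m) := by
  have hH : ((y : ℂ) • vecMulVec b (star b)).IsHermitian := by
    ext i j
    simp [vecMulVec_apply, mul_comm]
  have hconj : Measurable fun Y : Matrix (Fin m) (Fin m) ℂ => φ (conjBlock y b Y) :=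
    hφ.comp (Measurable.conjBlock measurable_const measurable_const measurable_id)
  have hd1 : Measurable fun Y : Matrix (Fin m) (Fin m) ℂ => ENNReal.ofReal (‖Y.det‖⁻¹) :=
    (measurable_det m).norm.inv.ennreal_ofReal
  have hψ : Measurable fun Y => posDensity (m + 1) (m + 1) Y * φ Y :=
    (measurable_posDensity _ _).mul hφ
  rw [← lintegral_hermLebesgue_add (φ := fun Y => posDensity (m + 1) (m + 1)
      (hermBlock y ((y : ℂ) • star b) Y) * φ (hermBlock y ((y : ℂ) • star b) Y))
      (hψ.comp (Measurable.hermBlock measurable_const measurable_const measurable_id)) hH,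
    lintegral_posMeasure m (φ := fun Y => ENNReal.ofReal (‖Y.det‖⁻¹) * φ (conjBlock y b Y))
      (hd1.mul hconj), ← lintegral_const_mul' _ _ ENNReal.ofReal_ne_top]
  refine lintegral_congr fun Y => ?_
  rw [← lowerMat_one_conj]
  change posDensity (m + 1) (m + 1) (conjBlock y b Y) * φ (conjBlock y b Y) = _
  rw [posDensity_conjBlock hy, mul_assoc, mul_assoc]

/-- The factor `y^{2m}` is the real Jacobian of `w = y b*` on `ℂ^m`, and `y^{-(m+1)}` comes from the
density. Corners `y ≤ 0` contribute nothing, because a positive definite matrix has positive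
diagonal. -/
theorem lintegral_posMeasure_succ (m : ℕ) {φ : Matrix (Fin (m + 1)) (Fin (m + 1)) ℂ → ℝ≥0∞}
    (hφ : Measurable φ) :
    ∫⁻ Y, φ Y ∂(posMeasure (m + 1)) =
      ∫⁻ y in Set.Ioi 0, ENNReal.ofReal (y ^ (2 * m) * (y ^ (m + 1))⁻¹) *
        ∫⁻ b : Fin m → ℂ, ∫⁻ Y, ENNReal.ofReal (‖Y.det‖⁻¹) * φ (conjBlock y b Y)
          ∂(posMeasure m) := by
  have hψ : Measurable fun Y => posDensity (m + 1) (m + 1) Y * φ Y :=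
    (measurable_posDensity _ _).mul hφ
  rw [lintegral_posMeasure _ hφ, lintegral_hermLebesgue_succ m hψ,
    ← lintegral_indicator measurableSet_Ioi]
  refine lintegral_congr fun y => ?_
  by_cases hy : 0 < y
  swap
  · rw [Set.indicator_of_notMem (by simpa using hy)]
    have h0 : ∀ (w : Fin m → ℂ) (Y : Matrix (Fin m) (Fin m) ℂ),
        posDensity (m + 1) (m + 1) (hermBlock y w Y) = 0 := fun w Y =>
      Set.indicator_of_notMem (fun h => hy (by
        have := (show (hermBlock y w Y).PosDef from h).diag_pos (i := 0)
        simpa using this)) _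
    simp [h0]
  rw [Set.indicator_of_mem (by simpa using hy)]
  have hyc : (y : ℂ) ≠ 0 := by exact_mod_cast hy.ne'
  have hcont : Measurable fun w : Fin m → ℂ => ∫⁻ Y, posDensity (m + 1) (m + 1) (hermBlock y w Y) *
      φ (hermBlock y w Y) ∂(hermLebesgue m) := by
    have : Measurable fun p : (Fin m → ℂ) × Matrix (Fin m) (Fin m) ℂ =>
        posDensity (m + 1) (m + 1) (hermBlock y p.1 p.2) * φ (hermBlock y p.1 p.2) :=
      hψ.comp (Measurable.hermBlock measurable_const measurable_fst measurable_snd)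
    exact this.lintegral_prod_right'
  rw [lintegral_comp_smul hyc hcont, ← (measurePreserving_star_pi m).lintegral_comp
    (f := fun b => ∫⁻ Y, posDensity (m + 1) (m + 1) (hermBlock y ((y : ℂ) • b) Y) *
      φ (hermBlock y ((y : ℂ) • b) Y) ∂(hermLebesgue m)) (hcont.comp (measurable_const_smul _)),
    Fintype.card_fin, Complex.norm_real, Real.norm_of_nonneg hy.le,
    ENNReal.ofReal_mul (by positivity), mul_assoc]
  congr 1
  rw [← lintegral_const_mul' _ _ ENNReal.ofReal_ne_top]
  exact lintegral_congr fun b => lintegral_posDensity_hermBlock hφ hy b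

/-! ### Group elements with a given first row and diagonal Gram matrix -/

theorem exists_unitary_row {m : ℕ} {x : Fin (m + 1) → ℂ} (hx : sqNorm x = 1) :
    ∃ k : Matrix (Fin (m + 1)) (Fin (m + 1)) ℂ, k * kᴴ = 1 ∧ k 0 = x := by
  let E := EuclideanSpace ℂ (Fin (m + 1))
  -- Only the value at the index `0` matters: the one-element orthonormal family `{x}` is extended
  -- to a basis, whose vectors become the rows of `k`.
  let v : Fin (m + 1) → E := fun _ => WithLp.toLp 2 x
  have hv : Orthonormal ℂ (({0} : Set (Fin (m + 1))).domRestrict v) := by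
    rw [orthonormal_iff_ite]
    intro i j
    have hij : i = j := Subsingleton.elim i j
    rw [if_pos hij]
    change inner ℂ (WithLp.toLp 2 x : E) (WithLp.toLp 2 x) = 1
    have h1 : ‖(WithLp.toLp 2 x : E)‖ ^ 2 = 1 := (EuclideanSpace.norm_sq_eq _).trans hx
    rw [inner_self_eq_norm_sq_to_K]
    rw [← RCLike.ofReal_pow, h1, RCLike.ofReal_one]
  obtain ⟨b, hb⟩ := hv.exists_orthonormalBasis_extension_of_card_eq (by simp [E])
  refine ⟨Matrix.of fun i j => b i j, ?_, ?_⟩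
  · ext i j
    have := orthonormal_iff_ite.1 b.orthonormal j i
    rw [PiLp.inner_apply] at this
    simp only [Matrix.mul_apply, Matrix.conjTranspose_apply, Matrix.of_apply, Matrix.one_apply]
    simp only [RCLike.inner_apply, eq_comm (a := j)] at this
    exact this
  · funext j
    rw [Matrix.of_apply, hb 0 rfl]

theorem sqNorm_pos {m : ℕ} {x : Fin (m + 1) → ℂ} (hx : x 0 ≠ 0) : 0 < sqNorm x :=
  lt_of_lt_of_le (pow_pos (norm_pos_iff.2 hx) 2)
    (Finset.single_le_sum (f := fun i => ‖x i‖ ^ 2) (fun i _ => by positivity)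
      (Finset.mem_univ 0))

/-- Take `g = diag(ρ, e, …, e) k` with `ρ = |x|` and `k` unitary with first row `x/ρ`. The choice
`e² = u^{-1/m}`, where `u = ρ²`, gives the diagonal matrix determinant `1`; the phase `(det k)⁻¹` is
put into one of the last `m` diagonal entries, where it corrects `det g` without changing `g g*`. -/
theorem exists_row0_eq {m : ℕ} (hm : m ≠ 0) {x : Fin (m + 1) → ℂ} (hx : x 0 ≠ 0) :
    ∃ g : G (m + 1), row0 g = x ∧
      (g : Matrix (Fin (m + 1)) (Fin (m + 1)) ℂ) * (g : Matrix (Fin (m + 1)) (Fin (m + 1)) ℂ)ᴴ =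
        hermBlock (sqNorm x) 0 ((sqNorm x ^ (-(1 / (m : ℝ)))) • 1) := by
  have hu := sqNorm_pos hx
  set u := sqNorm x with hudef
  have hρ : 0 < Real.sqrt u := Real.sqrt_pos.2 hu
  set ρ := Real.sqrt u with hρdef
  have hρ2 : ρ ^ 2 = u := Real.sq_sqrt hu.le
  have hρc : (ρ : ℂ) ≠ 0 := by exact_mod_cast hρ.ne'
  have hv : 0 < u ^ (-(1 / (m : ℝ))) := Real.rpow_pos_of_pos hu _
  set v := u ^ (-(1 / (m : ℝ))) with hvdef
  have he : 0 < Real.sqrt v := Real.sqrt_pos.2 hv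
  set e := Real.sqrt v with hedef
  have he2 : e ^ 2 = v := Real.sq_sqrt hv.le
  have hvm : v ^ m = u⁻¹ := by
    rw [hvdef, ← Real.rpow_natCast, ← Real.rpow_mul hu.le]
    have : -(1 / (m : ℝ)) * m = -1 := by
      field_simp
    rw [this, Real.rpow_neg_one]
  have hem : e ^ m * ρ = 1 := by
    have h2 : (e ^ m * ρ) ^ 2 = 1 := by
      rw [mul_pow, ← pow_mul, mul_comm m 2, pow_mul, he2, hρ2, hvm, inv_mul_cancel₀ hu.ne']
    exact (pow_eq_one_iff_of_nonneg (by positivity) two_ne_zero).1 h2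
  obtain ⟨k, hk, hk0⟩ := exists_unitary_row (x := (ρ : ℂ)⁻¹ • x) (by
    have : sqNorm ((ρ : ℂ)⁻¹ • x) = (ρ ^ 2)⁻¹ * sqNorm x := by
      simp only [sqNorm, Pi.smul_apply, norm_smul, mul_pow, Finset.mul_sum, norm_inv,
        Complex.norm_real, Real.norm_of_nonneg hρ.le, inv_pow]
    rw [this, hρ2, inv_mul_cancel₀ hu.ne'])
  have hdet : k.det * star k.det = 1 := by
    have := congrArg Matrix.det hk
    rwa [Matrix.det_mul, Matrix.det_conjTranspose, Matrix.det_one] at this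
  have hdet0 : k.det ≠ 0 := left_ne_zero_of_mul_eq_one hdet
  let d : Fin (m + 1) → ℂ := Fin.cons (ρ : ℂ) fun i : Fin m =>
    (e : ℂ) * if (i : ℕ) = 0 then (k.det)⁻¹ else 1
  have hprod : (∏ i : Fin m, (if (i : ℕ) = 0 then (k.det)⁻¹ else 1)) = (k.det)⁻¹ := by
    obtain ⟨l, rfl⟩ := Nat.exists_eq_succ_of_ne_zero hm
    rw [Fin.prod_univ_succ]
    simp
  have hd : (Matrix.diagonal d * k).det = 1 := by
    rw [Matrix.det_mul, Matrix.det_diagonal, Fin.prod_univ_succ]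
    simp only [d, Fin.cons_zero, Fin.cons_succ, Finset.prod_mul_distrib, Finset.prod_const,
      Finset.card_univ, Fintype.card_fin, hprod]
    have : (e : ℂ) ^ m * ρ = 1 := by exact_mod_cast hem
    calc (ρ : ℂ) * (e ^ m * (k.det)⁻¹) * k.det = (e ^ m * ρ) * ((k.det)⁻¹ * k.det) := by ring
      _ = 1 := by rw [this, inv_mul_cancel₀ hdet0, mul_one]
  refine ⟨mkG _ hd, ?_, ?_⟩
  · funext j
    change (Matrix.diagonal d * k) 0 j = x j
    rw [Matrix.diagonal_mul, hk0]
    simp [d, hρc]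
  · rw [coe_mkG, Matrix.conjTranspose_mul, Matrix.mul_assoc, ← Matrix.mul_assoc k, hk,
      Matrix.one_mul, Matrix.diagonal_conjTranspose, Matrix.diagonal_mul_diagonal]
    have hρ2c : (ρ : ℂ) * ρ = u := by rw [← sq]; exact_mod_cast hρ2
    have he2c : (e : ℂ) * e = v := by rw [← sq]; exact_mod_cast he2
    apply matrix_ext_succ
    · simp [d, hρ2c]
    · intro j
      simp [(Fin.succ_ne_zero _).symm]
    · intro i
      simp [Fin.succ_ne_zero]
    · intro i j
      simp only [Matrix.diagonal_apply, hermBlock_succ_succ, Matrix.smul_apply, Matrix.one_apply,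
        Fin.succ_inj]
      split_ifs with hij
      · simp only [d, Fin.cons_succ, Pi.star_apply, star_mul']
        have h1 : ∀ z : ℂ, z * star z = 1 → (e : ℂ) * z * (star (e : ℂ) * star z) = v := by
          intro z hz
          rw [Complex.star_def, Complex.conj_ofReal]
          calc (e : ℂ) * z * (e * star z) = (e * e) * (z * star z) := by ring
            _ = v := by rw [hz, he2c, mul_one]
        rw [h1]
        · simp
        · split_ifs
          · rw [star_inv₀, ← mul_inv, hdet, inv_one]
          · simp
      · simp

/-! ### The recursion for the symmetrically normalized measure -/

/-- The positive definite matrix `g g*`. -/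
def gram {n : ℕ} (g : G n) : Matrix (Fin n) (Fin n) ℂ :=
  (g : Matrix (Fin n) (Fin n) ℂ) * (g : Matrix (Fin n) (Fin n) ℂ)ᴴ

theorem measurable_gram (n : ℕ) : Measurable (gram (n := n)) := by
  have hc : Continuous fun M : Matrix (Fin n) (Fin n) ℂ => M * Mᴴ :=
    continuous_id.mul continuous_id.matrix_conjTranspose
  exact hc.measurable.comp (measurable_coeG n)

theorem det_gram {n : ℕ} (g : G n) : (gram g).det = 1 := by
  rw [gram, Matrix.det_mul, Matrix.det_conjTranspose, det_coeG, star_one, mul_one]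

theorem gram_mul {n : ℕ} (g h : G n) :
    gram (g * h) = (g : Matrix (Fin n) (Fin n) ℂ) * gram h *
      (g : Matrix (Fin n) (Fin n) ℂ)ᴴ := by
  simp only [gram, Matrix.SpecialLinearGroup.coe_mul, Matrix.conjTranspose_mul, Matrix.mul_assoc]

theorem measurable_smul_matrix {α : Type*} [MeasurableSpace α] {n : ℕ} {c : α → ℝ}
    {Y : α → Matrix (Fin n) (Fin n) ℂ} (hc : Measurable c) (hY : Measurable Y) :
    Measurable fun a => c a • Y a :=
  measurable_matrix_iff.2 fun i j => hc.smul ((measurable_entry i j).comp hY)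

/-- The decomposition `dμ_n(Y) = (dr/r) dg` with `Y = r^{1/n} g g*`, for a measure on `SL_n(ℂ)`. -/
def IsDecomposed (n : ℕ) (κ : Measure (G n)) : Prop :=
  ∀ φ : Matrix (Fin n) (Fin n) ℂ → ℝ≥0∞, Measurable φ →
    ∫⁻ r in Set.Ioi 0, ENNReal.ofReal r⁻¹ * ∫⁻ g, φ (r ^ (1 / (n : ℝ)) • gram g) ∂κ =
      ∫⁻ Y, φ Y ∂(posMeasure n)

/-- The integral of `φ` over the matrices `[1 0; b 1] diag(y, t^{1/m} A A*) [1 0; b 1]*`. -/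
def fiberInt {m : ℕ} (κ : Measure (G m)) (φ : Matrix (Fin (m + 1)) (Fin (m + 1)) ℂ → ℝ≥0∞)
    (y t : ℝ) : ℝ≥0∞ :=
  ∫⁻ b : Fin m → ℂ, ∫⁻ A, φ (conjBlock y b (t ^ (1 / (m : ℝ)) • gram A)) ∂κ

section
variable {m : ℕ} {κ : Measure (G m)} [SFinite κ]
  {φ : Matrix (Fin (m + 1)) (Fin (m + 1)) ℂ → ℝ≥0∞}

theorem measurable_fiberInt (hφ : Measurable φ) :
    Measurable fun q : ℝ × ℝ => fiberInt κ φ q.1 q.2 := by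
  have h1 : Measurable fun q : ((ℝ × ℝ) × (Fin m → ℂ)) × G m =>
      φ (conjBlock q.1.1.1 q.1.2 (q.1.1.2 ^ (1 / (m : ℝ)) • gram q.2)) :=
    hφ.comp (Measurable.conjBlock (measurable_fst.comp (measurable_fst.comp measurable_fst))
      (measurable_snd.comp measurable_fst) (measurable_smul_matrix
        ((measurable_snd.comp (measurable_fst.comp measurable_fst)).pow_const _)
        ((measurable_gram m).comp measurable_snd)))
  have h2 := h1.lintegral_prod_right' (ν := κ)
  exact h2.lintegral_prod_right' (ν := (volume : Measure (Fin m → ℂ)))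

/-- With `a = r^{1/(m+1)}` the scaled matrix has determinant `r` and corner `y = a u`, so its lower
block has determinant `r / y` and equals `(r/y)^{1/m}` times a matrix of determinant `1`. -/
theorem mul_rpow_eq_div_rpow (hm : m ≠ 0) {r u : ℝ} (hr : 0 < r) (hu : 0 < u) :
    r ^ (1 / ((m + 1 : ℕ) : ℝ)) * u ^ (-(1 / (m : ℝ))) =
      (r / (r ^ (1 / ((m + 1 : ℕ) : ℝ)) * u)) ^ (1 / (m : ℝ)) := by
  have ha : 0 < r ^ (1 / ((m + 1 : ℕ) : ℝ)) := Real.rpow_pos_of_pos hr _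
  have har : (r ^ (1 / ((m + 1 : ℕ) : ℝ))) ^ (m + 1) = r := by
    rw [one_div, Real.rpow_inv_natCast_pow hr.le (Nat.succ_ne_zero m)]
  set a := r ^ (1 / ((m + 1 : ℕ) : ℝ))
  have : r / (a * u) = a ^ m / u := by
    rw [← har, pow_succ']
    field_simp
  rw [this, Real.div_rpow (by positivity) hu.le, Real.rpow_neg hu.le, div_eq_mul_inv]
  congr 1
  rw [one_mul, Real.pow_rpow_inv_natCast ha.le hm]

theorem smul_gram_lower_mul (a u v : ℝ) {g : G (m + 1)}
    (hg : gram g = hermBlock u 0 (v • 1)) (A : G m) (b : Fin m → ℂ) :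
    a • gram (lower A b * g) = conjBlock (a * u) b ((a * v) • gram A) := by
  have hl : (lowerMat (A : Matrix (Fin m) (Fin m) ℂ) b) =
      lowerMat 1 b * lowerMat (A : Matrix (Fin m) (Fin m) ℂ) 0 := by
    rw [lowerMat_mul]; simp
  rw [gram_mul, hg, coe_lower, hl, Matrix.conjTranspose_mul]
  have : lowerMat 1 b * lowerMat (A : Matrix (Fin m) (Fin m) ℂ) 0 * hermBlock u 0 (v • 1) *
      ((lowerMat (A : Matrix (Fin m) (Fin m) ℂ) 0)ᴴ * (lowerMat 1 b)ᴴ) =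
      lowerMat 1 b * (lowerMat (A : Matrix (Fin m) (Fin m) ℂ) 0 * hermBlock u 0 (v • 1) *
        (lowerMat (A : Matrix (Fin m) (Fin m) ℂ) 0)ᴴ) * (lowerMat 1 b)ᴴ := by
    simp only [Matrix.mul_assoc]
  rw [this, lowerMat_zero_conj, conjBlock, ← Matrix.smul_mul, ← Matrix.mul_smul,
    smul_hermBlock_zero]
  congr 3
  rw [Matrix.mul_smul, Matrix.mul_one, Matrix.smul_mul, smul_smul]
  rfl

theorem det_rpow_smul_gram (hm : m ≠ 0) {t : ℝ} (ht : 0 < t) (A : G m) :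
    (t ^ (1 / (m : ℝ)) • gram A).det = t := by
  have : (t ^ (1 / (m : ℝ)) • gram A) = ((t ^ (1 / (m : ℝ)) : ℝ) : ℂ) • gram A := by
    ext i j; simp
  rw [this, Matrix.det_smul, det_gram, mul_one, Fintype.card_fin, ← Complex.ofReal_pow, one_div,
    Real.rpow_inv_natCast_pow ht.le hm]

/-- The integral over the fibres of the corner coordinate, as an integral over `r`. -/
theorem lintegral_conjBlock_eq (hm : m ≠ 0) (hκ : IsDecomposed m κ) (hφ : Measurable φ) (y : ℝ) :
    ∫⁻ b : Fin m → ℂ, ∫⁻ Y, ENNReal.ofReal (‖Y.det‖⁻¹) * φ (conjBlock y b Y) ∂(posMeasure m) =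
      ∫⁻ t in Set.Ioi 0, ENNReal.ofReal t⁻¹ * (ENNReal.ofReal t⁻¹ * fiberInt κ φ y t) := by
  have hinv : Measurable fun r : ℝ => ENNReal.ofReal r⁻¹ := measurable_inv.ennreal_ofReal
  have hψ : ∀ b : Fin m → ℂ, Measurable fun Y : Matrix (Fin m) (Fin m) ℂ =>
      ENNReal.ofReal (‖Y.det‖⁻¹) * φ (conjBlock y b Y) := fun b =>
    (measurable_det m).norm.inv.ennreal_ofReal.mul
      (hφ.comp (Measurable.conjBlock measurable_const measurable_const measurable_id))
  have hin : Measurable fun q : ((Fin m → ℂ) × ℝ) × G m =>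
      φ (conjBlock y q.1.1 (q.1.2 ^ (1 / (m : ℝ)) • gram q.2)) := by
    have hs : Measurable fun q : ((Fin m → ℂ) × ℝ) × G m =>
        q.1.2 ^ (1 / (m : ℝ)) • gram q.2 :=
      measurable_smul_matrix ((measurable_snd.comp measurable_fst).pow_const _)
        ((measurable_gram m).comp measurable_snd)
    exact hφ.comp (Measurable.conjBlock measurable_const (measurable_fst.comp measurable_fst) hs)
  have hin' := hin.lintegral_prod_right' (ν := κ)
  have h1 : ∀ b : Fin m → ℂ, ∫⁻ Y, ENNReal.ofReal (‖Y.det‖⁻¹) * φ (conjBlock y b Y)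
      ∂(posMeasure m) = ∫⁻ t in Set.Ioi 0, ENNReal.ofReal t⁻¹ * (ENNReal.ofReal t⁻¹ *
        ∫⁻ A, φ (conjBlock y b (t ^ (1 / (m : ℝ)) • gram A)) ∂κ) := fun b => by
    rw [← hκ _ (hψ b)]
    refine setLIntegral_congr_fun measurableSet_Ioi fun t ht => ?_
    have ht : 0 < t := ht
    -- One factor `t⁻¹` of the result is the density of `dt/t`, the other is this `|det Y|⁻¹`.
    have hdet : ∀ A : G m, ‖(t ^ (1 / (m : ℝ)) • gram A).det‖⁻¹ = t⁻¹ := fun A => by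
      rw [det_rpow_smul_gram hm ht, Complex.norm_real, Real.norm_of_nonneg ht.le]
    simp only [hdet, lintegral_const_mul' _ _ ENNReal.ofReal_ne_top]
  have hjoint : Measurable fun q : (Fin m → ℂ) × ℝ => ENNReal.ofReal q.2⁻¹ *
      (ENNReal.ofReal q.2⁻¹ * ∫⁻ A, φ (conjBlock y q.1 (q.2 ^ (1 / (m : ℝ)) • gram A)) ∂κ) :=
    (hinv.comp measurable_snd).mul ((hinv.comp measurable_snd).mul hin')
  simp only [h1]
  rw [lintegral_lintegral_swap hjoint.aemeasurable]
  simp only [lintegral_const_mul' _ _ ENNReal.ofReal_ne_top]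
  rfl

variable [κ.IsMulRightInvariant]

theorem lintegral_lower_gram (hm : m ≠ 0) (hφ : Measurable φ) {a r : ℝ} (hr : 0 < r)
    (har : a = r ^ (1 / ((m + 1 : ℕ) : ℝ))) {x : Fin (m + 1) → ℂ} (hx : x 0 ≠ 0) :
    ∫⁻ p, φ (a • gram (lower p.1 p.2 * rowSection x)) ∂(lowerMeasure κ) =
      fiberInt κ φ (a * sqNorm x) (r / (a * sqNorm x)) := by
  have hF : Measurable fun g : G (m + 1) => φ (a • gram g) :=
    hφ.comp (measurable_smul_matrix measurable_const (measurable_gram _))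
  obtain ⟨g, hg, hg'⟩ := exists_row0_eq hm hx
  rw [lintegral_lower_mul_congr κ hF ((row0_rowSection hm hx).trans hg.symm)]
  have hv : a * sqNorm x ^ (-(1 / (m : ℝ))) = (r / (a * sqNorm x)) ^ (1 / (m : ℝ)) := by
    rw [har, mul_rpow_eq_div_rpow hm hr (sqNorm_pos hx)]
  have h1 : ∀ p : G m × (Fin m → ℂ), a • gram (lower p.1 p.2 * g) =
      conjBlock (a * sqNorm x) p.2 ((r / (a * sqNorm x)) ^ (1 / (m : ℝ)) • gram p.1) := fun p => by
    rw [smul_gram_lower_mul a _ _ hg', hv]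
  simp only [h1]
  have h2 : Measurable fun p : G m × (Fin m → ℂ) =>
      φ (conjBlock (a * sqNorm x) p.2 ((r / (a * sqNorm x)) ^ (1 / (m : ℝ)) • gram p.1)) :=
    hφ.comp (Measurable.conjBlock measurable_const measurable_snd
      (measurable_smul_matrix measurable_const ((measurable_gram m).comp measurable_fst)))
  rw [lintegral_prod_symm _ h2.aemeasurable, fiberInt]

/-- After integration over the stabilizer the integrand depends on `x` only through `u = |x|²`, and
the prefactor cancels the constant of `lintegral_sqNorm`. The substitution `y = a u` turns `u^m du`
into `a^{-(m+1)} y^m dy = r⁻¹ y^m dy`. -/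
theorem lintegral_rowMeasure_gram (hm : m ≠ 0) (hφ : Measurable φ) {a r : ℝ} (hr : 0 < r)
    (hadef : a = r ^ (1 / ((m + 1 : ℕ) : ℝ))) :
    ENNReal.ofReal (m.factorial / Real.pi ^ (m + 1)) *
      ∫⁻ g, φ (a • gram g) ∂(rowMeasure κ) =
    ENNReal.ofReal r⁻¹ *
      ∫⁻ y in Set.Ioi 0, ENNReal.ofReal (y ^ m) * fiberInt κ φ y (r / y) := by
  have ha : 0 < a := by rw [hadef]; exact Real.rpow_pos_of_pos hr _
  have har : a ^ (m + 1) = r := by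
    rw [hadef, one_div, Real.rpow_inv_natCast_pow hr.le (Nat.succ_ne_zero m)]
  have hF : Measurable fun g : G (m + 1) => φ (a • gram g) :=
    hφ.comp (measurable_smul_matrix measurable_const (measurable_gram _))
  have hfib : Measurable fun y : ℝ => fiberInt κ φ y (r / y) :=
    (measurable_fiberInt (κ := κ) hφ).comp (f := fun y : ℝ => (y, r / y))
      (measurable_id.prodMk (measurable_id.const_div r))
  have hrow : ∀ᵐ x : Fin (m + 1) → ℂ,
      ∫⁻ p, φ (a • gram (lower p.1 p.2 * rowSection x)) ∂(lowerMeasure κ) =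
        fiberInt κ φ (a * sqNorm x) (r / (a * sqNorm x)) := by
    filter_upwards [ae_zero_ne m] with x hx
    exact lintegral_lower_gram hm hφ hr hadef hx
  have hc : 0 < (m.factorial : ℝ) / Real.pi ^ (m + 1) := by positivity
  have hc' : (m.factorial : ℝ) / Real.pi ^ (m + 1) * (Real.pi ^ (m + 1) / m.factorial) = 1 := by
    field_simp
  rw [lintegral_rowMeasure κ hF, lintegral_congr_ae hrow,
    lintegral_sqNorm m (H := fun u => fiberInt κ φ (a * u) (r / (a * u)))
      (hfib.comp (measurable_const_mul a)), ← mul_assoc, ← ENNReal.ofReal_mul hc.le,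
    hc', ENNReal.ofReal_one, one_mul,
    lintegral_Ioi_comp_mul ha (H := fun y => ENNReal.ofReal (y ^ m) * fiberInt κ φ y (r / y))
      ((measurable_id.pow_const m).ennreal_ofReal.mul hfib), ← mul_assoc,
    ← ENNReal.ofReal_mul (by positivity), ← lintegral_const_mul' _ _ ENNReal.ofReal_ne_top]
  refine setLIntegral_congr_fun measurableSet_Ioi fun u hu => ?_
  have hu : 0 < u := hu
  have hpow : u ^ m = r⁻¹ * a * (a * u) ^ m := by
    rw [mul_pow, ← har]
    field_simp
    ring
  rw [← mul_assoc (ENNReal.ofReal (r⁻¹ * a)), ← ENNReal.ofReal_mul (by positivity), hpow]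

/-- Both sides become integrals of `fiberInt κ φ y t` over `y, t > 0`. On the group side `r = y t`
turns `r⁻² y^m dr dy` into `y^{m-1} t⁻² dt dy`; on the matrix side the weight is `y^{2m-(m+1)} t⁻²`,
which is the same. -/
theorem isDecomposed_rowMeasure (hm : m ≠ 0) (hκ : IsDecomposed m κ) :
    IsDecomposed (m + 1) (ENNReal.ofReal (m.factorial / Real.pi ^ (m + 1)) • rowMeasure κ) := by
  intro φ hφ
  have hfib := measurable_fiberInt (κ := κ) hφ
  have hpow : Measurable fun y : ℝ => ENNReal.ofReal (y ^ m) :=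
    (measurable_id.pow_const m).ennreal_ofReal
  have hinv : Measurable fun r : ℝ => ENNReal.ofReal r⁻¹ := measurable_inv.ennreal_ofReal
  have hjoint : Measurable fun q : ℝ × ℝ => ENNReal.ofReal q.1⁻¹ * (ENNReal.ofReal q.1⁻¹ *
      (ENNReal.ofReal (q.2 ^ m) * fiberInt κ φ q.2 (q.1 / q.2))) :=
    (hinv.comp measurable_fst).mul ((hinv.comp measurable_fst).mul ((hpow.comp measurable_snd).mul
      (hfib.comp (f := fun q : ℝ × ℝ => (q.2, q.1 / q.2))
        (measurable_snd.prodMk (measurable_fst.div measurable_snd)))))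
  have h1 : ∫⁻ r in Set.Ioi 0, ENNReal.ofReal r⁻¹ *
        ∫⁻ g, φ (r ^ (1 / ((m + 1 : ℕ) : ℝ)) • gram g)
        ∂(ENNReal.ofReal (m.factorial / Real.pi ^ (m + 1)) • rowMeasure κ)
      = ∫⁻ r in Set.Ioi 0, ∫⁻ y in Set.Ioi 0, ENNReal.ofReal r⁻¹ * (ENNReal.ofReal r⁻¹ *
          (ENNReal.ofReal (y ^ m) * fiberInt κ φ y (r / y))) := by
    refine setLIntegral_congr_fun measurableSet_Ioi fun r hr => ?_
    rw [lintegral_smul_measure, smul_eq_mul, lintegral_rowMeasure_gram hm hφ hr rfl,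
      lintegral_const_mul' _ _ ENNReal.ofReal_ne_top,
      lintegral_const_mul' _ _ ENNReal.ofReal_ne_top]
  rw [h1, lintegral_lintegral_swap hjoint.aemeasurable, lintegral_posMeasure_succ m hφ]
  refine setLIntegral_congr_fun measurableSet_Ioi fun y hy => ?_
  have hy : 0 < y := hy
  have hH : Measurable fun r : ℝ => ENNReal.ofReal r⁻¹ * (ENNReal.ofReal r⁻¹ *
      (ENNReal.ofReal (y ^ m) * fiberInt κ φ y (r / y))) :=
    hjoint.comp (f := fun r : ℝ => (r, y)) (measurable_id.prodMk measurable_const)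
  rw [lintegral_Ioi_comp_mul hy hH, lintegral_conjBlock_eq hm hκ hφ,
    ← lintegral_const_mul' _ _ ENNReal.ofReal_ne_top,
    ← lintegral_const_mul' _ _ ENNReal.ofReal_ne_top]
  refine setLIntegral_congr_fun measurableSet_Ioi fun t ht => ?_
  have ht : 0 < t := ht
  rw [mul_div_cancel_left₀ _ hy.ne']
  simp only [← mul_assoc]
  congr 1
  rw [← ENNReal.ofReal_mul (by positivity), ← ENNReal.ofReal_mul (by positivity),
    ← ENNReal.ofReal_mul (by positivity), ← ENNReal.ofReal_mul (by positivity),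
    ← ENNReal.ofReal_mul (by positivity)]
  congr 1
  have : y ^ (2 * m) = y ^ m * y ^ m := by rw [two_mul, pow_add]
  rw [this, pow_succ]
  field_simp

end

/-! ### The base case: sizes `0` and `1` -/

theorem posMeasure_zero_univ : posMeasure 0 Set.univ = 1 := by
  have h := lintegral_posMeasure 0 (φ := fun _ => 1) measurable_const
  rw [lintegral_one] at h
  rw [h]
  have hd : ∀ Y : Matrix (Fin 0) (Fin 0) ℂ, posDensity 0 0 Y = 1 := fun Y => by
    have hY : Y.PosDef := by
      rw [Subsingleton.elim Y 1]
      exact Matrix.PosDef.one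
    rw [posDensity, Set.indicator_of_mem (show Y ∈ {Y | Y.PosDef} from hY)]
    simp
  simp only [hd, mul_one, lintegral_one]
  rw [hermLebesgue, Measure.map_apply (measurable_hermMatrix 0) MeasurableSet.univ,
    Set.preimage_univ, Measure.volume_eq_prod, ← Set.univ_prod_univ, Measure.prod_prod]
  have : IsEmpty {p : Fin 0 × Fin 0 // p.1 < p.2} := ⟨fun p => p.1.1.elim0⟩
  rw [volume_pi, volume_pi, Measure.pi_empty_univ, Measure.pi_empty_univ, one_mul]

/-- The decomposition of `posMeasure` also holds from size `0`, where the empty matrix is positive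
definite and has mass `1`; there it reduces to `μ_1 = dy/y`. -/
theorem isDecomposed_one : IsDecomposed 1 (Measure.dirac 1) := by
  intro φ hφ
  rw [lintegral_posMeasure_succ 0 hφ]
  refine setLIntegral_congr_fun measurableSet_Ioi fun r hr => ?_
  have hr : 0 < r := hr
  have hb : ∀ (b : Fin 0 → ℂ) (Y : Matrix (Fin 0) (Fin 0) ℂ),
      conjBlock r b Y = r ^ (1 / ((1 : ℕ) : ℝ)) • gram (1 : G 1) := fun b Y => by
    refine matrix_ext_succ ?_ (fun j => j.elim0) (fun i => i.elim0) fun i => i.elim0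
    rw [conjBlock, lowerMat_one_conj]
    simp [gram]
  have hdet : ∀ Y : Matrix (Fin 0) (Fin 0) ℂ, ‖Y.det‖⁻¹ = 1 := fun Y => by simp
  simp only [hb, hdet, ENNReal.ofReal_one, one_mul, lintegral_const, posMeasure_zero_univ, mul_one]
  have hm : Measurable fun g : G 1 => φ (r ^ (1 / ((1 : ℕ) : ℝ)) • gram g) :=
    hφ.comp (measurable_smul_matrix measurable_const (measurable_gram 1))
  rw [lintegral_dirac' _ hm, volume_pi, Measure.pi_empty_univ, mul_one]
  simp

/-! ### Existence and uniqueness of the symmetrically normalized measure -/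

instance instSubsingletonGOne : Subsingleton (G 1) := by
  refine ⟨fun g h => G_ext ?_⟩
  have hg := det_coeG g
  have hh := det_coeG h
  rw [Matrix.det_fin_one] at hg hh
  ext i j
  rw [Subsingleton.elim i 0, Subsingleton.elim j 0, hg, hh]

theorem isHaarMeasure_dirac_one : (Measure.dirac (1 : G 1)).IsHaarMeasure where
  lt_top_of_isCompact _ _ := measure_lt_top _ _
  map_mul_left_eq_self g := by
    have : (fun h : G 1 => g * h) = id := by
      funext h
      exact Subsingleton.elim _ _
    rw [this, Measure.map_id]
  open_pos U _ hU := by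
    obtain ⟨g, hg⟩ := hU
    rw [Subsingleton.elim g 1] at hg
    rw [Measure.dirac_apply_of_mem hg]
    exact one_ne_zero

theorem exists_isHaarMeasure_isDecomposed {n : ℕ} (hn : 1 ≤ n) :
    ∃ κ : Measure (G n), κ.IsHaarMeasure ∧ IsDecomposed n κ := by
  induction n, hn using Nat.le_induction with
  | base => exact ⟨_, isHaarMeasure_dirac_one, isDecomposed_one⟩
  | succ m hm ih =>
    obtain ⟨κ, hκ, hd⟩ := ih
    have hm0 : m ≠ 0 := Nat.one_le_iff_ne_zero.1 hm
    have := isMulRightInvariant_of_isHaarMeasure hm0 κ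
    have := isHaarMeasure_rowMeasure hm0 κ
    refine ⟨_, Measure.IsHaarMeasure.smul (rowMeasure κ) ?_ ENNReal.ofReal_ne_top,
      isDecomposed_rowMeasure hm0 hd⟩
    rw [ENNReal.ofReal_ne_zero_iff]
    positivity

/-- The orbit map `g ↦ g g*` to `SPos_n(ℂ)`. -/
def orbitMap (n : ℕ) (g : G n) : SPos n := act g (basePoint n)

theorem coe_orbitMap (n : ℕ) (g : G n) :
    (orbitMap n g : Matrix (Fin n) (Fin n) ℂ) = gram g := by
  simp [orbitMap, act, basePoint, gram]

theorem measurable_orbitMap (n : ℕ) : Measurable (orbitMap n) := by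
  refine Measurable.subtype_mk (f := fun g : G n =>
    ((act g (basePoint n) : SPos n) : Matrix (Fin n) (Fin n) ℂ)) ?_
  have : (fun g : G n => ((act g (basePoint n) : SPos n) : Matrix (Fin n) (Fin n) ℂ)) = gram :=
    funext fun g => coe_orbitMap n g
  rw [this]
  exact measurable_gram n

theorem measurable_act {n : ℕ} (g : G n) : Measurable (act g) := by
  refine Measurable.subtype_mk (f := fun Z : SPos n => (g : Matrix (Fin n) (Fin n) ℂ) *
      (Z : Matrix (Fin n) (Fin n) ℂ) * (g : Matrix (Fin n) (Fin n) ℂ)ᴴ) ?_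
  have hc : Continuous fun M : Matrix (Fin n) (Fin n) ℂ => (g : Matrix (Fin n) (Fin n) ℂ) * M *
      (g : Matrix (Fin n) (Fin n) ℂ)ᴴ := (continuous_const.mul continuous_id).mul continuous_const
  exact hc.measurable.comp measurable_subtype_coe

theorem act_orbitMap {n : ℕ} (g h : G n) : act g (orbitMap n h) = orbitMap n (g * h) := by
  apply Subtype.ext
  rw [coe_orbitMap, gram_mul, ← coe_orbitMap]
  rfl

theorem isCompact_norm_entry_le (n : ℕ) (k : ℝ) :
    IsCompact {g : G n | ∀ i j, ‖g i j‖ ≤ k} := by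
  have hK : IsCompact (Set.univ.pi fun _ : Fin n => Set.univ.pi fun _ : Fin n =>
      Metric.closedBall (0 : ℂ) k) :=
    isCompact_univ_pi fun _ => isCompact_univ_pi fun _ => isCompact_closedBall _ _
  have h : Topology.IsClosedEmbedding fun g : G n => (g : Matrix (Fin n) (Fin n) ℂ) :=
    Matrix.SpecialLinearGroup.isClosedEmbedding_val
  convert h.isCompact_preimage hK using 1
  ext g
  simp only [Set.mem_ofPred_eq]
  constructor
  · exact fun hg i _ j _ => by simpa using hg i j
  · exact fun hg i j => by simpa using hg i trivial j trivial

theorem norm_sq_le_gram {n : ℕ} (g : G n) (i j : Fin n) : ‖g i j‖ ^ 2 ≤ ‖gram g i i‖ := by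
  have h : gram g i i = ((∑ k, ‖g i k‖ ^ 2 : ℝ) : ℂ) := by
    rw [gram, Matrix.mul_apply]
    push_cast
    refine Finset.sum_congr rfl fun k _ => ?_
    rw [Matrix.conjTranspose_apply, Complex.star_def, Complex.mul_conj']
  rw [h, Complex.norm_real, Real.norm_of_nonneg (Finset.sum_nonneg fun k _ => by positivity)]
  exact Finset.single_le_sum (f := fun k => ‖g i k‖ ^ 2) (fun k _ => by positivity)
    (Finset.mem_univ j)

/-- The map `g ↦ g g*` is proper: the diagonal of `g g*` consists of the squared row norms of `g`,
so bounding it bounds all entries of `g`. -/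
theorem sigmaFinite_map_orbitMap {n : ℕ} (μ : Measure (G n)) [μ.IsHaarMeasure] :
    SigmaFinite (μ.map (orbitMap n)) := by
  let S : ℕ → Set (SPos n) := fun k => {Z | ∀ i, ‖(Z : Matrix (Fin n) (Fin n) ℂ) i i‖ ≤ (k : ℝ) ^ 2}
  have hS : ∀ k, MeasurableSet (S k) := fun k => by
    simp only [S, Set.ofPred_forall]
    exact MeasurableSet.iInter fun i =>
      measurableSet_le ((measurable_entry i i).comp measurable_subtype_coe).norm measurable_const
  refine ⟨⟨⟨S, fun _ => trivial, fun k => ?_, ?_⟩⟩⟩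
  · rw [Measure.map_apply (measurable_orbitMap n) (hS k)]
    refine lt_of_le_of_lt (measure_mono ?_) (isCompact_norm_entry_le n k).measure_lt_top
    intro g hg i j
    have h1 : ‖gram g i i‖ ≤ (k : ℝ) ^ 2 := by
      rw [← coe_orbitMap]
      exact hg i
    exact le_of_sq_le_sq ((norm_sq_le_gram g i j).trans h1) (Nat.cast_nonneg k)
  · refine Set.eq_univ_of_forall fun Z => Set.mem_iUnion.2 ?_
    -- The summand `1` ensures `1 ≤ k`, hence `k ≤ k²`, which is the bound in `S k`.
    obtain ⟨k, hk⟩ := exists_nat_ge (1 + ∑ i, ‖(Z : Matrix (Fin n) (Fin n) ℂ) i i‖)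
    refine ⟨k, fun i => ?_⟩
    have h0 : ‖(Z : Matrix (Fin n) (Fin n) ℂ) i i‖ ≤
        ∑ i, ‖(Z : Matrix (Fin n) (Fin n) ℂ) i i‖ :=
      Finset.single_le_sum (f := fun i => ‖(Z : Matrix (Fin n) (Fin n) ℂ) i i‖)
        (fun i _ => norm_nonneg _) (Finset.mem_univ i)
    have h1 : (1 : ℝ) ≤ k := by
      have := Finset.sum_nonneg (s := Finset.univ)
        (f := fun i => ‖(Z : Matrix (Fin n) (Fin n) ℂ) i i‖) fun i _ => norm_nonneg _
      linarith
    nlinarith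

theorem lintegral_dilation_prod {n : ℕ} (μ : Measure (G n)) [SFinite (μ.map (orbitMap n))]
    {φ : Matrix (Fin n) (Fin n) ℂ → ℝ≥0∞} (hφ : Measurable φ) :
    ∫⁻ Y, φ Y ∂((dilationMeasure.prod (μ.map (orbitMap n))).map
      (fun p : ℝ × SPos n => (p.1 ^ (1 / (n : ℝ))) • (p.2 : Matrix (Fin n) (Fin n) ℂ))) =
      ∫⁻ r in Set.Ioi 0, ENNReal.ofReal r⁻¹ * ∫⁻ g, φ (r ^ (1 / (n : ℝ)) • gram g) ∂μ := by
  have hm : Measurable fun p : ℝ × SPos n =>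
      (p.1 ^ (1 / (n : ℝ))) • (p.2 : Matrix (Fin n) (Fin n) ℂ) :=
    measurable_smul_matrix (measurable_fst.pow_const _)
      (measurable_subtype_coe.comp measurable_snd)
  have hφm : Measurable fun p : ℝ × SPos n =>
      φ ((p.1 ^ (1 / (n : ℝ))) • (p.2 : Matrix (Fin n) (Fin n) ℂ)) := hφ.comp hm
  rw [lintegral_map hφ hm, lintegral_prod _ hφm.aemeasurable, dilationMeasure,
    lintegral_withDensity_eq_lintegral_mul _ measurable_inv.ennreal_ofReal
      hφm.lintegral_prod_right']
  refine setLIntegral_congr_fun measurableSet_Ioi fun r _ => ?_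
  rw [Pi.mul_apply, lintegral_map (f := fun Z : SPos n =>
    φ ((r ^ (1 / (n : ℝ))) • (Z : Matrix (Fin n) (Fin n) ℂ)))
    (hφm.comp (measurable_const.prodMk measurable_id)) (measurable_orbitMap n)]
  simp only [coe_orbitMap]

theorem isSymmetricallyNormalized_of_isDecomposed {n : ℕ} (μ : Measure (G n))
    [hμ : μ.IsHaarMeasure] (h : IsDecomposed n μ) : IsSymmetricallyNormalized n μ := by
  have hσ := sigmaFinite_map_orbitMap μ
  refine ⟨hμ, hσ, fun g => ?_, Measure.ext_of_lintegral _ fun φ hφ => ?_⟩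
  · change Measure.map (act g) (Measure.map (orbitMap n) μ) = Measure.map (orbitMap n) μ
    rw [Measure.map_map (measurable_act g) (measurable_orbitMap n)]
    conv_rhs => rw [← map_mul_left_eq_self μ g, Measure.map_map (measurable_orbitMap n)
      (measurable_const_mul g)]
    congr 1
    funext h
    exact act_orbitMap g h
  · rw [← h φ hφ]
    exact lintegral_dilation_prod μ hφ

theorem IsSymmetricallyNormalized.isDecomposed {n : ℕ} {μ : Measure (G n)}
    (h : IsSymmetricallyNormalized n μ) : IsDecomposed n μ := by
  intro φ hφ
  have : SigmaFinite (μ.map (orbitMap n)) := h.map_eq.sigmaFinite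
  have h2 := lintegral_dilation_prod μ hφ
  rw [← h2, ← h.map_eq.decomposition]
  rfl

/-! ### Uniqueness of the normalization -/

theorem hermLebesgue_norm_entry_le_lt_top (n : ℕ) (k : ℝ) :
    hermLebesgue n {Y | ∀ i j, ‖Y i j‖ ≤ k} < ⊤ := by
  have hS : MeasurableSet {Y : Matrix (Fin n) (Fin n) ℂ | ∀ i j, ‖Y i j‖ ≤ k} := by
    simp only [Set.ofPred_forall]
    exact MeasurableSet.iInter fun i => MeasurableSet.iInter fun j =>
      measurableSet_le (measurable_entry i j).norm measurable_const
  rw [hermLebesgue, Measure.map_apply (measurable_hermMatrix n) hS]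
  refine lt_of_le_of_lt (measure_mono (t := (Set.univ.pi fun _ : Fin n =>
    Metric.closedBall (0 : ℝ) k) ×ˢ (Set.univ.pi fun _ : {p : Fin n × Fin n // p.1 < p.2} =>
    Metric.closedBall (0 : ℂ) k)) ?_) ?_
  · intro c hc
    refine ⟨fun i _ => ?_, fun p _ => ?_⟩
    · have := hc i i
      simpa [hermMatrix] using this
    · have := hc p.1.1 p.1.2
      simpa [hermMatrix, p.2] using this
  · rw [Measure.volume_eq_prod, Measure.prod_prod, volume_pi, volume_pi, Measure.pi_pi,
      Measure.pi_pi]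
    exact ENNReal.mul_lt_top (ENNReal.prod_lt_top fun _ _ => measure_closedBall_lt_top)
      (ENNReal.prod_lt_top fun _ _ => measure_closedBall_lt_top)

/-- Such an `E` is the test set that forces the ratio of two symmetrically normalized measures to be
`1`. Where `|det Y| ≥ 1` the density is at most `1`, so bounded entries give finite mass. The mass
is positive for large `k` because `r^{1/n} g g*` has determinant `r ≥ 1` for all `r` in `[1, 2]`. -/
theorem exists_posMeasure_ne_zero_ne_top {n : ℕ} (hn : n ≠ 0) {μ : Measure (G n)}
    [μ.IsHaarMeasure] (h : IsDecomposed n μ) :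
    ∃ E, MeasurableSet E ∧ posMeasure n E ≠ 0 ∧ posMeasure n E ≠ ⊤ := by
  let E : ℕ → Set (Matrix (Fin n) (Fin n) ℂ) := fun k =>
    {Y | ∀ i j, ‖Y i j‖ ≤ k} ∩ {Y | 1 ≤ ‖Y.det‖}
  have hE1 : MeasurableSet {Y : Matrix (Fin n) (Fin n) ℂ | 1 ≤ ‖Y.det‖} :=
    measurableSet_le measurable_const (measurable_det n).norm
  have hE : ∀ k, MeasurableSet (E k) := fun k => by
    refine MeasurableSet.inter ?_ hE1
    simp only [Set.ofPred_forall]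
    exact MeasurableSet.iInter fun i => MeasurableSet.iInter fun j =>
      measurableSet_le (measurable_entry i j).norm measurable_const
  have hpos : posMeasure n {Y | 1 ≤ ‖Y.det‖} ≠ 0 := by
    rw [← lintegral_indicator_one hE1, ← h _ (measurable_one.indicator hE1)]
    have hμ : μ Set.univ ≠ 0 := isOpen_univ.measure_ne_zero μ Set.univ_nonempty
    have hle : ∫⁻ r in Set.Icc (1 : ℝ) 2, ENNReal.ofReal 2⁻¹ * μ Set.univ ≤
        ∫⁻ r in Set.Ioi (0 : ℝ), ENNReal.ofReal r⁻¹ *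
          ∫⁻ g, Set.indicator {Y : Matrix (Fin n) (Fin n) ℂ | 1 ≤ ‖Y.det‖} 1
            (r ^ (1 / (n : ℝ)) • gram g) ∂μ := by
      refine (setLIntegral_mono' measurableSet_Icc fun r hr => ?_).trans
        (lintegral_mono_set (s := Set.Icc (1 : ℝ) 2) fun r hr => lt_of_lt_of_le one_pos hr.1)
      have hr0 : 0 < r := lt_of_lt_of_le one_pos hr.1
      refine mul_le_mul' (ENNReal.ofReal_le_ofReal (inv_anti₀ hr0 hr.2)) ?_
      have : ∀ g : G n, Set.indicator {Y : Matrix (Fin n) (Fin n) ℂ | 1 ≤ ‖Y.det‖}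
          (1 : Matrix (Fin n) (Fin n) ℂ → ℝ≥0∞) (r ^ (1 / (n : ℝ)) • gram g) = 1 := fun g => by
        rw [Set.indicator_of_mem, Pi.one_apply]
        rw [Set.mem_ofPred_eq, det_rpow_smul_gram hn hr0, Complex.norm_real,
          Real.norm_of_nonneg hr0.le]
        exact hr.1
      simp only [this, lintegral_one, le_refl]
    intro h0
    rw [h0] at hle
    simp [hμ] at hle
  obtain ⟨k, hk⟩ : ∃ k, posMeasure n (E k) ≠ 0 := by
    by_contra! hcon
    refine hpos (measure_mono_null ?_ (measure_iUnion_null hcon))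
    intro Y hY
    obtain ⟨k, hk⟩ := exists_nat_ge (∑ i, ∑ j, ‖Y i j‖)
    refine Set.mem_iUnion.2 ⟨k, fun i j => le_trans ?_ hk, hY⟩
    refine le_trans ?_ (Finset.single_le_sum (f := fun i => ∑ j, ‖Y i j‖)
      (fun i _ => Finset.sum_nonneg fun j _ => norm_nonneg _) (Finset.mem_univ i))
    exact Finset.single_le_sum (f := fun j => ‖Y i j‖) (fun j _ => norm_nonneg _)
      (Finset.mem_univ j)
  refine ⟨E k, hE k, hk, ne_of_lt ?_⟩
  refine lt_of_le_of_lt ?_ (hermLebesgue_norm_entry_le_lt_top n k)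
  rw [← lintegral_indicator_one (hE k), lintegral_posMeasure n (measurable_one.indicator (hE k))]
  refine le_trans ?_ (measure_mono (Set.inter_subset_left : E k ⊆ _))
  rw [← lintegral_indicator_one (hE k)]
  refine lintegral_mono fun Y => ?_
  by_cases hY : Y ∈ E k
  · rw [Set.indicator_of_mem hY, Pi.one_apply, mul_one]
    refine le_trans (Set.indicator_le_self _ _ _) ?_
    rw [← ENNReal.ofReal_one]
    exact ENNReal.ofReal_le_ofReal (inv_le_one_of_one_le₀ (one_le_pow₀ hY.2))
  · rw [Set.indicator_of_notMem hY, mul_zero]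

theorem isSymmetricallyNormalized_unique {n : ℕ} (hn : n ≠ 0) {μ ν : Measure (G n)}
    (hμ : IsSymmetricallyNormalized n μ) (hν : IsSymmetricallyNormalized n ν) : μ = ν := by
  have := hμ.isHaar
  have := hν.isHaar
  obtain ⟨c, hct, hc⟩ := exists_eq_smul_of_isMulLeftInvariant μ ν
    (Measure.measure_univ_ne_zero.1 (isOpen_univ.measure_ne_zero ν Set.univ_nonempty))
  obtain ⟨E, hE, h0, htop⟩ := exists_posMeasure_ne_zero_ne_top hn hν.isDecomposed
  have h1 := hμ.isDecomposed _ (measurable_one.indicator hE)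
  have h2 := hν.isDecomposed _ (measurable_one.indicator hE)
  rw [lintegral_indicator_one hE] at h1 h2
  rw [hc] at h1
  simp only [lintegral_smul_measure, smul_eq_mul, mul_left_comm _ c,
    lintegral_const_mul' c _ hct] at h1
  rw [h2] at h1
  have hc1 : c = 1 := (ENNReal.mul_left_inj h0 htop).1 (by rw [h1, one_mul])
  rw [hc, hc1, one_smul]

theorem existsUnique_isSymmetricallyNormalized {n : ℕ} (hn : 1 ≤ n) :
    ∃! μ : Measure (G n), IsSymmetricallyNormalized n μ := by
  obtain ⟨κ, hκ, hd⟩ := exists_isHaarMeasure_isDecomposed hn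
  exact ⟨κ, isSymmetricallyNormalized_of_isDecomposed κ hd, fun μ hμ =>
    isSymmetricallyNormalized_unique (Nat.one_le_iff_ne_zero.1 hn) hμ
      (isSymmetricallyNormalized_of_isDecomposed κ hd)⟩

/-- The symmetrically normalized measure on `SL_{m+1}(ℂ)` in terms of that on `SL_m(ℂ)`. -/
theorem isSymmetricallyNormalized_succ_eq {m : ℕ} (hm : m ≠ 0) {κ : Measure (G m)}
    {μ : Measure (G (m + 1))} (hκ : IsSymmetricallyNormalized m κ)
    (hμ : IsSymmetricallyNormalized (m + 1) μ) :
    μ = ENNReal.ofReal (m.factorial / Real.pi ^ (m + 1)) • rowMeasure κ := by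
  have := hκ.isHaar
  have := isMulRightInvariant_of_isHaarMeasure hm κ
  have := isHaarMeasure_rowMeasure hm κ
  have : (ENNReal.ofReal (m.factorial / Real.pi ^ (m + 1)) • rowMeasure κ).IsHaarMeasure :=
    Measure.IsHaarMeasure.smul (rowMeasure κ)
      (by rw [ENNReal.ofReal_ne_zero_iff]; positivity) ENNReal.ofReal_ne_top
  exact isSymmetricallyNormalized_unique (Nat.succ_ne_zero m) hμ
    (isSymmetricallyNormalized_of_isDecomposed _ (isDecomposed_rowMeasure hm hκ.isDecomposed))

/-! ### Exact fundamental domains of discrete subgroups -/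

/-- A countable discrete subgroup of a second countable group has a measurable set of
representatives for its left cosets. -/
theorem exists_measurableSet_existsUnique_smul_mem {H : Type*} [Group H] [TopologicalSpace H]
    [IsTopologicalGroup H] [SecondCountableTopology H] [MeasurableSpace H] [BorelSpace H]
    (L : Subgroup H) [Countable L] {U : Set H} (hU : U ∈ nhds (1 : H))
    (hUL : ∀ g ∈ U, g ∈ L → g = 1) :
    ∃ F : Set H, MeasurableSet F ∧ ∀ g : H, ∃! γ : L, γ • g ∈ F := by
  have hc : Filter.Tendsto (fun p : H × H => p.1 * p.2⁻¹) (nhds (1, 1)) (nhds 1) := by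
    have : Continuous fun p : H × H => p.1 * p.2⁻¹ := by fun_prop
    simpa using this.tendsto (1, 1)
  have h1 := hc hU
  rw [Filter.mem_map, nhds_prod_eq, Filter.mem_prod_same_iff] at h1
  obtain ⟨V', hV', hVU⟩ := h1
  obtain ⟨V, hVV', hVo, hV1⟩ := mem_nhds_iff.1 hV'
  -- As `V V⁻¹ ⊆ U` and `U ∩ L` is trivial, each translate of `V` meets every `L`-orbit at most
  -- once.
  have hVU' : ∀ x ∈ V, ∀ y ∈ V, x * y⁻¹ ∈ U := fun x hx y hy =>
    hVU (Set.mk_mem_prod (hVV' hx) (hVV' hy))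
  let W0 : H → Set H := fun g => (fun x => x * g⁻¹) ⁻¹' V
  have hW0 : ∀ g, IsOpen (W0 g) := fun g => hVo.preimage (continuous_mul_const _)
  obtain ⟨s, hs, hsu⟩ := TopologicalSpace.countable_cover_nhds (f := W0) fun g =>
    (hW0 g).mem_nhds (by simpa [W0] using hV1)
  have hsn : s.Nonempty := by
    by_contra hne
    rw [Set.not_nonempty_iff_eq_empty] at hne
    subst hne
    have : (1 : H) ∈ (⋃ x ∈ (∅ : Set H), W0 x) := by rw [hsu]; trivial
    simp at this
  obtain ⟨t, rfl⟩ := hs.exists_eq_range hsn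
  let W : ℕ → Set H := fun i => W0 (t i)
  have hcover : ∀ g, ∃ i, g ∈ W i := fun g => by
    have : g ∈ ⋃ x ∈ Set.range t, W0 x := by rw [hsu]; trivial
    simpa using this
  let S : ℕ → Set H := fun i => ⋃ γ : L, (fun x => γ • x) ⁻¹' W i
  have hSm : ∀ i g, g ∈ S i ↔ ∃ γ : L, γ • g ∈ W i := fun i g => by simp [S]
  have hSi : ∀ i (γ : L) g, γ • g ∈ S i ↔ g ∈ S i := fun i γ g => by
    rw [hSm, hSm]
    constructor
    · rintro ⟨δ, h⟩
      exact ⟨δ * γ, by rwa [mul_smul]⟩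
    · rintro ⟨δ, h⟩
      exact ⟨δ * γ⁻¹, by rwa [mul_smul, inv_smul_smul]⟩
  have hSo : ∀ i, IsOpen (S i) := fun i =>
    isOpen_iUnion fun γ => (hW0 _).preimage (continuous_const_smul γ)
  -- Greedy choice: `S i` is the union of the orbits meeting `W i`, and each orbit is represented in
  -- the first `W i` that it meets.
  refine ⟨⋃ i, W i \ ⋃ j < i, S j, MeasurableSet.iUnion fun i => (hW0 _).measurableSet.diff
    (MeasurableSet.iUnion fun j => MeasurableSet.iUnion fun _ => (hSo j).measurableSet), ?_⟩
  intro g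
  have hex : ∃ i, g ∈ S i := (hcover g).imp fun i hi => (hSm i g).2 ⟨1, by simpa using hi⟩
  classical
  have key : ∀ γ : L, γ • g ∈ (⋃ i, W i \ ⋃ j < i, S j) ↔ γ • g ∈ W (Nat.find hex) := by
    intro γ
    simp only [Set.mem_iUnion, Set.mem_sdiff, not_exists, hSi]
    constructor
    · rintro ⟨i, hi, hj⟩
      have : i = Nat.find hex := by
        symm
        rw [Nat.find_eq_iff]
        exact ⟨(hSm i g).2 ⟨γ, hi⟩, fun j hji => hj j hji⟩
      rwa [← this]
    · intro h
      exact ⟨_, h, fun j hj => Nat.find_min hex hj⟩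
  obtain ⟨γ, hγ⟩ := (hSm _ _).1 (Nat.find_spec hex)
  refine ⟨γ, (key γ).2 hγ, fun δ hδ => ?_⟩
  have hδ' := (key δ).1 hδ
  have := hUL _ (hVU' _ hδ' _ hγ) (by
    have : δ • g * (t (Nat.find hex))⁻¹ * (γ • g * (t (Nat.find hex))⁻¹)⁻¹ = (δ * γ⁻¹ : L) := by
      simp [Subgroup.smul_def, mul_assoc]
    rw [this]
    exact SetLike.coe_mem _)
  rw [mul_inv_eq_one, mul_left_inj] at this
  exact Subtype.ext (mul_right_cancel (b := g) this)

/-! ### The group of Gaussian integer matrices -/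

/-- `SL_n(ℤ[i])`, as an abstract group. -/
abbrev SLZ (n : ℕ) : Type := Matrix.SpecialLinearGroup (Fin n) GaussianInt

/-- The embedding of `SL_n(ℤ[i])` in `SL_n(ℂ)`. -/
def toG (n : ℕ) : SLZ n →* G n := Matrix.SpecialLinearGroup.map (n := Fin n) GaussianInt.toComplex

theorem toG_apply {n : ℕ} (γ : SLZ n) (i j : Fin n) :
    toG n γ i j = GaussianInt.toComplex (γ i j) := rfl

theorem toG_injective (n : ℕ) : Function.Injective (toG n) := by
  intro γ δ h
  ext i j : 1
  have := congrArg (fun g : G n => g i j) h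
  simp only [toG_apply, GaussianInt.toComplex_inj] at this
  exact this

/-- The isomorphism of `SL_n(ℤ[i])` with `Γ n`. -/
def toΓ (n : ℕ) : SLZ n ≃* Γ n := MonoidHom.ofInjective (toG_injective n)

theorem toΓ_smul {n : ℕ} (γ : SLZ n) (g : G n) : toΓ n γ • g = toG n γ * g := rfl

instance instCountableGaussianInt : Countable GaussianInt := by
  refine Function.Injective.countable (f := fun z : GaussianInt => (z.re, z.im)) fun z w h => ?_
  simp only [Prod.mk.injEq] at h
  exact Zsqrtd.ext h.1 h.2

instance instCountableSLZ (n : ℕ) : Countable (SLZ n) := by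
  refine Function.Injective.countable (f := fun (γ : SLZ n) (i j : Fin n) => γ i j) fun γ δ h => ?_
  ext i j : 1
  exact congrFun (congrFun h i) j

instance instCountableΓ (n : ℕ) : Countable (Γ n) := (toΓ n).symm.toEquiv.countable_iff.2 inferInstance

theorem eq_zero_of_norm_toComplex_lt_one {z : GaussianInt} (h : ‖GaussianInt.toComplex z‖ < 1) :
    z = 0 := by
  have h1 : ‖GaussianInt.toComplex z‖ ^ 2 < 1 := by
    nlinarith [norm_nonneg (GaussianInt.toComplex z)]
  rw [← Complex.normSq_eq_norm_sq, ← GaussianInt.intCast_real_norm] at h1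
  have h2 : Zsqrtd.norm z < 1 := by exact_mod_cast h1
  have h3 := GaussianInt.norm_nonneg z
  exact GaussianInt.norm_eq_zero.1 (by omega)

/-- The domain is exact, with no exceptional null set: sums of its indicator over `SL_n(ℤ[i])` equal
`1` at every point, as the unfolding below requires. -/
theorem exists_fundamentalSet (n : ℕ) :
    ∃ F : Set (G n), MeasurableSet F ∧ ∀ g : G n, ∃! γ : SLZ n, toG n γ * g ∈ F := by
  have hU : IsOpen {g : G n | ∀ i j, ‖g i j - (1 : G n) i j‖ < 1} := by
    simp only [Set.ofPred_forall]
    refine isOpen_iInter_of_finite fun i => isOpen_iInter_of_finite fun j => ?_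
    have : Continuous fun g : G n => g i j :=
      (continuous_apply j).comp ((continuous_apply i).comp continuous_subtype_val)
    exact isOpen_lt (by fun_prop) continuous_const
  obtain ⟨F, hF, h⟩ := exists_measurableSet_existsUnique_smul_mem (Γ n)
    (hU.mem_nhds (by simp)) (by
      rintro _ hg ⟨γ, rfl⟩
      change toG n γ = 1
      rw [← map_one (toG n)]
      congr 1
      ext i j : 1
      have := hg i j
      rw [← map_one (toG n)] at this
      change ‖toG n γ i j - toG n 1 i j‖ < 1 at this
      rw [toG_apply, toG_apply, ← map_sub] at this
      exact sub_eq_zero.1 (eq_zero_of_norm_toComplex_lt_one this))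
  refine ⟨F, hF, fun g => ?_⟩
  obtain ⟨γ, h1, h2⟩ := h g
  refine ⟨(toΓ n).symm γ, ?_, fun δ hδ => ?_⟩
  · change toG n _ * g ∈ F
    rw [← toΓ_smul, MulEquiv.apply_symm_apply]
    exact h1
  · rw [MulEquiv.eq_symm_apply]
    exact h2 _ hδ

/-- An exact measurable fundamental domain for `SL_n(ℤ[i])` acting on `SL_n(ℂ)`. -/
def fundamentalSet (n : ℕ) : Set (G n) := (exists_fundamentalSet n).choose

theorem measurableSet_fundamentalSet (n : ℕ) : MeasurableSet (fundamentalSet n) :=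
  (exists_fundamentalSet n).choose_spec.1

theorem existsUnique_toG_mul_mem {n : ℕ} (g : G n) : ∃! γ : SLZ n, toG n γ * g ∈ fundamentalSet n :=
  (exists_fundamentalSet n).choose_spec.2 g

theorem isFundamentalDomain_fundamentalSet {n : ℕ} (μ : Measure (G n)) :
    IsFundamentalDomain (Γ n) (fundamentalSet n) μ := by
  refine IsFundamentalDomain.mk' (measurableSet_fundamentalSet n).nullMeasurableSet fun g => ?_
  obtain ⟨γ, h1, h2⟩ := existsUnique_toG_mul_mem g
  refine ⟨toΓ n γ, h1, fun δ hδ => ?_⟩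
  rw [← MulEquiv.symm_apply_eq]
  apply h2
  rw [← toΓ_smul, MulEquiv.apply_symm_apply]
  exact hδ

theorem hasFundamentalDomain {n : ℕ} (μ : Measure (G n)) : HasFundamentalDomain (Γ n) (G n) μ :=
  ⟨_, isFundamentalDomain_fundamentalSet μ⟩

theorem V_eq {n : ℕ} (μ : Measure (G n)) [μ.IsHaarMeasure] : V n μ = μ (fundamentalSet n) :=
  (isFundamentalDomain_fundamentalSet μ).covolume_eq_volume _

/-- Integration over the group, by unfolding over the fundamental domain. -/
theorem lintegral_eq_tsum_fundamentalSet {n : ℕ} (μ : Measure (G n)) [μ.IsMulLeftInvariant]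
    (f : G n → ℝ≥0∞) :
    ∫⁻ g, f g ∂μ = ∑' γ : SLZ n, ∫⁻ g in fundamentalSet n, f (toG n γ * g) ∂μ := by
  rw [(isFundamentalDomain_fundamentalSet μ).lintegral_eq_tsum'' f,
    ← (toΓ n).toEquiv.tsum_eq]
  rfl

/-! ### Gaussian integer vectors -/

/-- The complex vector attached to a vector of Gaussian integers. -/
def cvec (n : ℕ) : (Fin n → GaussianInt) →+ (Fin n → ℂ) where
  toFun v j := GaussianInt.toComplex (v j)
  map_zero' := by funext; simp
  map_add' v w := by funext; simp

theorem cvec_apply {n : ℕ} (v : Fin n → GaussianInt) (j : Fin n) :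
    cvec n v j = GaussianInt.toComplex (v j) := rfl

theorem cvec_injective (n : ℕ) : Function.Injective (cvec n) := fun v w h => by
  funext j
  exact GaussianInt.toComplex_inj.1 (congrFun h j)

theorem cvec_mulVec {n : ℕ} (A : SLZ n) (v : Fin n → GaussianInt) :
    cvec n ((A : Matrix (Fin n) (Fin n) GaussianInt) *ᵥ v) =
      (toG n A : Matrix (Fin n) (Fin n) ℂ) *ᵥ cvec n v := by
  funext i
  simp only [cvec_apply, Matrix.mulVec, dotProduct, map_sum, map_mul]
  rfl

/-- The unit box of `ℂ^n`. -/
def unitBox (n : ℕ) : Set (Fin n → ℂ) :=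
  Set.univ.pi fun _ => Complex.measurableEquivRealProd ⁻¹' (Set.Ico 0 1 ×ˢ Set.Ico 0 1)

theorem mem_unitBox {n : ℕ} {x : Fin n → ℂ} :
    x ∈ unitBox n ↔ ∀ i, ((x i).re ∈ Set.Ico (0 : ℝ) 1) ∧ (x i).im ∈ Set.Ico (0 : ℝ) 1 := by
  simp [unitBox, Complex.measurableEquivRealProd]

theorem measurableSet_unitBox (n : ℕ) : MeasurableSet (unitBox n) :=
  MeasurableSet.univ_pi fun _ =>
    (measurableSet_Ico.prod measurableSet_Ico).preimage Complex.measurableEquivRealProd.measurable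

theorem volume_unitBox (n : ℕ) : volume (unitBox n) = 1 := by
  rw [unitBox, volume_pi_pi]
  refine Finset.prod_eq_one fun i _ => ?_
  rw [Complex.volume_preserving_equiv_real_prod.measure_preimage
    (measurableSet_Ico.prod measurableSet_Ico).nullMeasurableSet, Measure.volume_eq_prod,
    Measure.prod_prod]
  simp

theorem isAddFundamentalDomain_unitBox (n : ℕ) :
    IsAddFundamentalDomain (cvec n).range (unitBox n) := by
  refine IsAddFundamentalDomain.mk' (measurableSet_unitBox n).nullMeasurableSet fun x => ?_
  refine ⟨⟨cvec n fun i => ⟨-⌊(x i).re⌋, -⌊(x i).im⌋⟩, ⟨_, rfl⟩⟩, ?_, ?_⟩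
  · change cvec n _ + x ∈ unitBox n
    rw [mem_unitBox]
    intro i
    simp only [Pi.add_apply, cvec_apply, Complex.add_re, Complex.add_im, ← GaussianInt.intCast_re,
      ← GaussianInt.intCast_im, Int.cast_neg]
    have h1 := Int.floor_le (x i).re
    have h2 := Int.lt_floor_add_one (x i).re
    have h3 := Int.floor_le (x i).im
    have h4 := Int.lt_floor_add_one (x i).im
    exact ⟨⟨by linarith, by linarith⟩, ⟨by linarith, by linarith⟩⟩
  · rintro ⟨_, β, rfl⟩ h
    change cvec n β + x ∈ unitBox n at h
    rw [mem_unitBox] at h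
    refine Subtype.ext (congrArg (cvec n) (funext fun i => ?_))
    have hi := h i
    simp only [Pi.add_apply, cvec_apply, Complex.add_re, Complex.add_im, ← GaussianInt.intCast_re,
      ← GaussianInt.intCast_im] at hi
    have h1 : ⌊(x i).re⌋ = -(β i).re := Int.floor_eq_iff.2
      ⟨by push_cast; linarith [hi.1.1], by push_cast; linarith [hi.1.2]⟩
    have h2 : ⌊(x i).im⌋ = -(β i).im := Int.floor_eq_iff.2
      ⟨by push_cast; linarith [hi.2.1], by push_cast; linarith [hi.2.2]⟩
    ext <;> simp [h1, h2]

/-- The lattice of Gaussian integer vectors, as an additive group. -/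
def cvecEquiv (n : ℕ) : (Fin n → GaussianInt) ≃+ (cvec n).range :=
  AddMonoidHom.ofInjective (cvec_injective n)

theorem lintegral_eq_tsum_unitBox {n : ℕ} (f : (Fin n → ℂ) → ℝ≥0∞) :
    ∫⁻ x, f x = ∑' β : Fin n → GaussianInt, ∫⁻ x in unitBox n, f (cvec n β + x) := by
  have : Countable (cvec n).range := (cvecEquiv n).symm.toEquiv.countable_iff.2 inferInstance
  rw [(isAddFundamentalDomain_unitBox n).lintegral_eq_tsum'' f, ← (cvecEquiv n).toEquiv.tsum_eq]
  rfl

/-- Multiplication by the block matrix `[1 0; Aβ A]` in coordinates. -/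
def blockShift {m : ℕ} (A : SLZ m) (β : Fin m → GaussianInt) (q : G m × (Fin m → ℂ)) :
    G m × (Fin m → ℂ) :=
  (toG m A * q.1, (toG m A : Matrix (Fin m) (Fin m) ℂ) *ᵥ (cvec m β + q.2))

theorem measurable_blockShift {m : ℕ} (A : SLZ m) (β : Fin m → GaussianInt) :
    Measurable (blockShift A β) := by
  refine Measurable.prodMk (measurable_fst.const_mul _) ?_
  exact (measurePreserving_mulVec (toG m A)).measurable.comp
    (f := fun q : G m × (Fin m → ℂ) => cvec m β + q.2) (measurable_snd.const_add _)

/-- The volume-preserving substitution `b ↦ A b` is followed by cutting `ℂ^m` into translates of the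
unit box. This is why the lower left entry is parametrized as `Aβ` and not as `β`. -/
theorem lintegral_eq_tsum_blockShift {m : ℕ} {w : G m × (Fin m → ℂ) → ℝ≥0∞} (hw : Measurable w)
    (A : SLZ m) (A' : G m) : ∫⁻ b, w (toG m A * A', b) =
      ∑' β : Fin m → GaussianInt, ∫⁻ b in unitBox m, w (blockShift A β (A', b)) := by
  have hb : Measurable fun b : Fin m → ℂ => w (toG m A * A', b) :=
    hw.comp (f := fun b => (toG m A * A', b)) (measurable_const.prodMk measurable_id)
  rw [← (measurePreserving_mulVec (toG m A)).lintegral_comp hb, lintegral_eq_tsum_unitBox]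
  rfl

/-- A function on `G m × ℂ^m` whose sum over the group of lower triangular block matrices with
Gaussian integer coefficients is `1` has integral the volume of a fundamental domain. -/
theorem lintegral_lowerMeasure_eq {m : ℕ} (κ : Measure (G m)) [SFinite κ] [κ.IsMulLeftInvariant]
    {w : G m × (Fin m → ℂ) → ℝ≥0∞} (hw : Measurable w)
    (h : ∀ q, ∑' p : SLZ m × (Fin m → GaussianInt), w (blockShift p.1 p.2 q) = 1) :
    ∫⁻ p, w p ∂(lowerMeasure κ) = κ (fundamentalSet m) := by
  have hmeas : ∀ (A : SLZ m) (β : Fin m → GaussianInt),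
      Measurable fun q => w (blockShift A β q) := fun A β => hw.comp (measurable_blockShift A β)
  -- Unfolding over `SLZ m` in `A` and over the lattice in `b` leaves the integral of the full sum,
  -- which is `1`, over the product of `fundamentalSet m` with a box of volume `1`.
  rw [lowerMeasure, lintegral_prod _ hw.aemeasurable,
    lintegral_eq_tsum_fundamentalSet κ fun A' => ∫⁻ b, w (A', b)]
  simp only [lintegral_eq_tsum_blockShift hw]
  generalize blockShift (m := m) = Φ at hmeas h
  have hsec : ∀ (A : SLZ m) (β : Fin m → GaussianInt) (A' : G m),
      Measurable fun b : Fin m → ℂ => w (Φ A β (A', b)) := fun A β A' =>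
    (hmeas A β).comp (f := fun b => (A', b)) (measurable_const.prodMk measurable_id)
  have hm2 : ∀ A : SLZ m, Measurable fun A' : G m =>
      ∑' β : Fin m → GaussianInt, ∫⁻ b in unitBox m, w (Φ A β (A', b)) := fun A =>
    Measurable.tsum fun β => (hmeas A β).lintegral_prod_right'
  have h2 : ∀ A', ∑' A : SLZ m, ∑' β : Fin m → GaussianInt, ∫⁻ b in unitBox m,
      w (Φ A β (A', b)) = 1 := by
    intro A'
    rw [← ENNReal.tsum_prod (f := fun (A : SLZ m) (β : Fin m → GaussianInt) =>
      ∫⁻ b in unitBox m, w (Φ A β (A', b))),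
      ← lintegral_tsum (f := fun (p : SLZ m × (Fin m → GaussianInt)) b => w (Φ p.1 p.2 (A', b)))
        fun p => (hsec p.1 p.2 A').aemeasurable]
    simp only [h, lintegral_one, Measure.restrict_apply_univ, volume_unitBox]
  rw [← lintegral_tsum fun A => (hm2 A).aemeasurable]
  simp only [h2, lintegral_one, Measure.restrict_apply_univ]

/-! ### Primitive vectors -/

/-- The vectors that are first rows of elements of `SL_n(ℤ[i])`. -/
abbrev Prim (m : ℕ) : Type :=
  {v : Fin (m + 1) → GaussianInt // ∃ γ : SLZ (m + 1), (fun j => γ 0 j) = v}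

/-- An element of `SL_{m+1}(ℤ[i])` with prescribed first row. -/
def primLift {m : ℕ} (v : Prim m) : SLZ (m + 1) := v.2.choose

theorem primLift_spec {m : ℕ} (v : Prim m) : (fun j => primLift v 0 j) = v.1 := v.2.choose_spec

theorem row0_toG {m : ℕ} (γ : SLZ (m + 1)) :
    row0 (toG (m + 1) γ) = cvec (m + 1) fun j => γ 0 j := rfl

theorem row0_toG_primLift {m : ℕ} (v : Prim m) :
    row0 (toG (m + 1) (primLift v)) = cvec (m + 1) v.1 := by
  rw [row0_toG, primLift_spec]

/-- The element `[1 0; Aβ A]` of `SL_{m+1}(ℤ[i])`. -/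
def lowerZ {m : ℕ} (A : SLZ m) (β : Fin m → GaussianInt) : SLZ (m + 1) :=
  ⟨lowerMat A ((A : Matrix (Fin m) (Fin m) GaussianInt) *ᵥ β), by rw [det_lowerMat, A.2]⟩

theorem toG_lowerZ {m : ℕ} (A : SLZ m) (β : Fin m → GaussianInt) :
    toG (m + 1) (lowerZ A β) =
      lower (toG m A) ((toG m A : Matrix (Fin m) (Fin m) ℂ) *ᵥ cvec m β) := by
  apply G_ext
  rw [← cvec_mulVec]
  apply matrix_ext_succ
  · exact (toG_apply _ _ _).trans (map_one _)
  · exact fun j => (toG_apply _ _ _).trans (map_zero _)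
  · exact fun j => rfl
  · exact fun i j => rfl

theorem toG_lowerZ_mul_lower {m : ℕ} (A : SLZ m) (β : Fin m → GaussianInt) (A' : G m)
    (b : Fin m → ℂ) :
    toG (m + 1) (lowerZ A β) * lower A' b =
      lower (blockShift A β (A', b)).1 (blockShift A β (A', b)).2 := by
  rw [toG_lowerZ, lower_mul, blockShift, Matrix.mulVec_add]

theorem exists_eq_lowerZ {m : ℕ} {q : SLZ (m + 1)}
    (h : row0 (toG (m + 1) q) = Pi.single 0 1) : ∃ A β, q = lowerZ A β := by
  have h' : ∀ j, GaussianInt.toComplex (q 0 j) = (Pi.single 0 1 : Fin (m + 1) → ℂ) j :=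
    fun j => congrFun h j
  have h0 : q 0 0 = 1 := GaussianInt.toComplex_inj.1 (by rw [h', map_one, Pi.single_eq_same])
  have h1 : ∀ j : Fin m, q 0 j.succ = 0 := fun j =>
    GaussianInt.toComplex_inj.1 (by rw [h', map_zero, Pi.single_eq_of_ne (Fin.succ_ne_zero j)])
  have he := eq_lowerMat h0 h1
  have hd : ((q : Matrix (Fin (m + 1)) (Fin (m + 1)) GaussianInt).submatrix
      Fin.succ Fin.succ).det = 1 := by
    rw [← det_lowerMat _ fun i => q i.succ 0, ← he, q.2]
  let A : SLZ m := ⟨_, hd⟩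
  refine ⟨A, ((A⁻¹ : SLZ m) : Matrix (Fin m) (Fin m) GaussianInt) *ᵥ fun i => q i.succ 0, ?_⟩
  apply Subtype.ext
  rw [lowerZ]
  simp only
  rw [Matrix.mulVec_mulVec, ← Matrix.SpecialLinearGroup.coe_mul, mul_inv_cancel,
    Matrix.SpecialLinearGroup.coe_one, Matrix.one_mulVec]
  exact he

theorem lowerZ_injective {m : ℕ} {A B : SLZ m} {β γ : Fin m → GaussianInt}
    (h : lowerZ A β = lowerZ B γ) : A = B ∧ β = γ := by
  have hA : A = B := by
    ext i j : 1
    exact congrArg (fun q : SLZ (m + 1) => q i.succ j.succ) h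
  subst hA
  refine ⟨rfl, ?_⟩
  have h2 : (A : Matrix (Fin m) (Fin m) GaussianInt) *ᵥ β =
      (A : Matrix (Fin m) (Fin m) GaussianInt) *ᵥ γ := by
    funext i
    exact congrArg (fun q : SLZ (m + 1) => q i.succ 0) h
  have h3 := congrArg (fun x => ((A⁻¹ : SLZ m) : Matrix (Fin m) (Fin m) GaussianInt) *ᵥ x) h2
  simpa only [Matrix.mulVec_mulVec, ← Matrix.SpecialLinearGroup.coe_mul, inv_mul_cancel,
    Matrix.SpecialLinearGroup.coe_one, Matrix.one_mulVec] using h3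

/-- This is the coset decomposition of `SL_{m+1}(ℤ[i])` by the stabilizer of the first basis vector;
the component `v` is the first row of the inverse of the product. -/
theorem bijective_primLift_inv_mul_lowerZ (m : ℕ) :
    Function.Bijective fun p : Prim m × (SLZ m × (Fin m → GaussianInt)) =>
      (primLift p.1)⁻¹ * lowerZ p.2.1 p.2.2 := by
  constructor
  · rintro ⟨v, A, β⟩ ⟨w, B, γ⟩ h
    simp only at h
    have h1 : (lowerZ A β)⁻¹ * primLift v = (lowerZ B γ)⁻¹ * primLift w := by
      rw [← _root_.inv_inj, _root_.mul_inv_rev, _root_.mul_inv_rev, inv_inv, inv_inv, h]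
    have h2 : ∀ (A : SLZ m) β, row0 (toG (m + 1) (lowerZ A β)⁻¹) = Pi.single 0 1 := fun A β => by
      have : row0 (toG (m + 1) (lowerZ A β * (lowerZ A β)⁻¹)) =
          row0 (toG (m + 1) (lowerZ A β)⁻¹) := by
        rw [map_mul, toG_lowerZ, row0_lower_mul]
      rw [← this, mul_inv_cancel, map_one, row0_one]
    have h3 : cvec (m + 1) v.1 = cvec (m + 1) w.1 := by
      rw [← row0_toG_primLift, ← row0_toG_primLift, ← row0_lower_mul (m := m) 1 0,
        ← row0_lower_mul (m := m) 1 0 (toG (m + 1) (primLift w))]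
      rw [row0_mul, row0_mul, row0_lower, ← h2 A β, ← row0_mul, ← map_mul, h1, map_mul, row0_mul,
        h2, h2]
    have h4 : v = w := Subtype.ext (cvec_injective _ h3)
    subst h4
    obtain ⟨rfl, rfl⟩ := lowerZ_injective (mul_left_cancel h)
    rfl
  · intro γ
    let v : Prim m := ⟨fun j => γ⁻¹ 0 j, γ⁻¹, rfl⟩
    obtain ⟨A, β, h⟩ := exists_eq_lowerZ (q := primLift v * γ) (by
      rw [map_mul, row0_mul, row0_toG_primLift]
      change row0 (toG (m + 1) γ⁻¹) ᵥ* _ = _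
      rw [← row0_mul, ← map_mul, inv_mul_cancel, map_one, row0_one])
    exact ⟨(v, A, β), by simp [← h]⟩

/-- The unfolding formula for sums over primitive vectors. -/
theorem lintegral_tsum_prim_rowMeasure {m : ℕ} (hm : m ≠ 0) (κ : Measure (G m))
    [κ.IsHaarMeasure] {f : (Fin (m + 1) → ℂ) → ℝ≥0∞} (hf : Measurable f) :
    ∫⁻ g in fundamentalSet (m + 1),
        ∑' v : Prim m, f (cvec (m + 1) v.1 ᵥ* (g : Matrix (Fin (m + 1)) (Fin (m + 1)) ℂ))
          ∂(rowMeasure κ) =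
      κ (fundamentalSet m) * ∫⁻ x, f x := by
  have hHaar := isHaarMeasure_rowMeasure hm κ
  have hFm := measurableSet_fundamentalSet (m + 1)
  obtain ⟨W, hW⟩ : ∃ W : G (m + 1) → ℝ≥0∞, ∀ g, W g = ∑' v : Prim m,
    (fundamentalSet (m + 1)).indicator 1 ((toG (m + 1) (primLift v))⁻¹ * g) := ⟨_, fun _ => rfl⟩
  have hind : Measurable ((fundamentalSet (m + 1)).indicator (1 : G (m + 1) → ℝ≥0∞)) :=
    measurable_one.indicator hFm
  have hWm : Measurable W := by
    rw [funext hW]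
    exact Measurable.tsum fun v => hind.comp (measurable_const_mul _)
  have hrow : Measurable fun g : G (m + 1) => f (row0 g) := hf.comp (measurable_row0 m)
  -- Summing `W`, already a sum over coset representatives, over the stabilizer gives the sum over
  -- the whole group of the indicator of the fundamental domain.
  have hsum : ∀ g : G (m + 1), ∑' p : SLZ m × (Fin m → GaussianInt),
      W (toG (m + 1) (lowerZ p.1 p.2) * g) = 1 := by
    intro g
    simp only [hW]
    rw [ENNReal.tsum_comm, ← ENNReal.tsum_prod (f := fun (v : Prim m)
      (p : SLZ m × (Fin m → GaussianInt)) => (fundamentalSet (m + 1)).indicator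
        (1 : G (m + 1) → ℝ≥0∞)
        ((toG (m + 1) (primLift v))⁻¹ * (toG (m + 1) (lowerZ p.1 p.2) * g)))]
    have e := (Equiv.ofBijective _ (bijective_primLift_inv_mul_lowerZ m)).tsum_eq
      fun γ => (fundamentalSet (m + 1)).indicator (1 : G (m + 1) → ℝ≥0∞) (toG (m + 1) γ * g)
    simp only [Equiv.ofBijective_apply, map_mul, map_inv, mul_assoc] at e
    rw [e]
    obtain ⟨γ, h1, h2⟩ := existsUnique_toG_mul_mem g
    rw [tsum_eq_single γ fun δ hδ => Set.indicator_of_notMem (fun h => hδ (h2 δ h)) _,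
      Set.indicator_of_mem h1, Pi.one_apply]
  have hWg : ∀ g, Measurable fun p : G m × (Fin m → ℂ) => W (lower p.1 p.2 * g) := fun g =>
    hWm.comp (f := fun p : G m × (Fin m → ℂ) => lower p.1 p.2 * g)
      ((measurable_lower m).mul_const g)
  have hinner : ∀ g : G (m + 1),
      ∫⁻ p, W (lower p.1 p.2 * g) ∂(lowerMeasure κ) = κ (fundamentalSet m) := by
    intro g
    refine lintegral_lowerMeasure_eq κ (w := fun p => W (lower p.1 p.2 * g)) (hWg g) fun q => ?_
    rw [← hsum (lower q.1 q.2 * g)]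
    refine tsum_congr fun p => congrArg W ?_
    rw [← mul_assoc, toG_lowerZ_mul_lower]
  have hleft : ∀ v : Prim m, ∫⁻ g in fundamentalSet (m + 1),
      f (cvec (m + 1) v.1 ᵥ* (g : Matrix (Fin (m + 1)) (Fin (m + 1)) ℂ)) ∂(rowMeasure κ) =
      ∫⁻ g, (fundamentalSet (m + 1)).indicator 1 ((toG (m + 1) (primLift v))⁻¹ * g) *
        f (row0 g) ∂(rowMeasure κ) := by
    intro v
    -- Translating by a lift of `v` turns `v g` into the first row of `g`; the dependence on `v`
    -- moves into the domain of integration.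
    rw [← lintegral_indicator hFm, ← lintegral_mul_left_eq_self
      (fun g => (fundamentalSet (m + 1)).indicator 1 ((toG (m + 1) (primLift v))⁻¹ * g) *
        f (row0 g)) (toG (m + 1) (primLift v))]
    refine lintegral_congr fun g => ?_
    have e : (toG (m + 1) (primLift v))⁻¹ * (toG (m + 1) (primLift v) * g) = g :=
      inv_mul_cancel_left _ _
    rw [e, row0_mul, row0_toG_primLift]
    by_cases hg : g ∈ fundamentalSet (m + 1) <;> simp [hg]
  rw [lintegral_tsum fun v => ?_]
  · simp only [hleft]
    rw [← lintegral_tsum fun v => ?_]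
    · simp only [ENNReal.tsum_mul_right]
      simp only [← hW]
      -- In the coordinates `(A, b, x)` the factor `f` depends on `x` alone, and by `hinner` the
      -- integral of `W` over each coset is `κ (fundamentalSet m)`.
      rw [lintegral_rowMeasure κ (F := fun g => W g * f (row0 g)) (hWm.mul hrow)]
      rw [← lintegral_const_mul _ hf]
      refine lintegral_congr_ae ((ae_zero_ne m).mono fun x hx => ?_)
      simp only [row0_lower_mul, row0_rowSection hm hx]
      rw [lintegral_mul_const _ (hWg _), hinner]
    · exact ((hind.comp (measurable_const_mul _)).mul hrow).aemeasurable
  · have : Measurable fun g : G (m + 1) => f (row0 (toG (m + 1) (primLift v) * g)) :=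
      hrow.comp (measurable_const_mul _)
    simp only [row0_mul, row0_toG_primLift] at this
    exact this.aemeasurable

/-! ### Norms of Gaussian integers -/

/-- The basis `1, i` of the Gaussian integers. -/
def gaussianBasis : Module.Basis (Fin 2) ℤ GaussianInt :=
  Module.Basis.ofEquivFun (AddEquiv.toIntLinearEquiv
    { toFun := fun z => ![z.re, z.im]
      invFun := fun v => ⟨v 0, v 1⟩
      left_inv := fun z => rfl
      right_inv := fun v => by funext i; fin_cases i <;> rfl
      map_add' := fun z w => by funext i; fin_cases i <;> rfl })

theorem gaussianBasis_repr (z : GaussianInt) (i : Fin 2) :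
    gaussianBasis.repr z i = ![z.re, z.im] i := rfl

theorem gaussianBasis_zero : gaussianBasis 0 = ⟨1, 0⟩ := by
  apply gaussianBasis.repr.injective
  ext i
  rw [Module.Basis.repr_self, gaussianBasis_repr]
  fin_cases i <;> simp

theorem gaussianBasis_one : gaussianBasis 1 = ⟨0, 1⟩ := by
  apply gaussianBasis.repr.injective
  ext i
  rw [Module.Basis.repr_self, gaussianBasis_repr]
  fin_cases i <;> simp

theorem algebraNorm_eq_norm (z : GaussianInt) : Algebra.norm ℤ z = Zsqrtd.norm z := by
  rw [Algebra.norm_eq_matrix_det gaussianBasis, Matrix.det_fin_two]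
  simp only [Algebra.leftMulMatrix_eq_repr_mul, gaussianBasis_repr, gaussianBasis_zero,
    gaussianBasis_one, Zsqrtd.norm_def]
  simp

theorem natCard_quotient_span (z : GaussianInt) :
    Nat.card (GaussianInt ⧸ Ideal.span {z}) = (Zsqrtd.norm z).natAbs := by
  have : Module.Free ℤ GaussianInt := Module.Free.of_basis gaussianBasis
  have : Module.Finite ℤ GaussianInt := Module.Finite.of_basis gaussianBasis
  rw [← Submodule.cardQuot_apply, ← Ideal.absNorm_apply, Ideal.absNorm_span_singleton,
    algebraNorm_eq_norm]

theorem natCard_quotient_span_eq_norm_sq (z : GaussianInt) :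
    (Nat.card (GaussianInt ⧸ Ideal.span {z}) : ℝ) = ‖GaussianInt.toComplex z‖ ^ 2 := by
  rw [natCard_quotient_span, ← Complex.normSq_eq_norm_sq, ← GaussianInt.intCast_real_norm,
    Nat.cast_natAbs, abs_of_nonneg (GaussianInt.norm_nonneg z)]

/-! ### Completion of primitive rows -/

/-- A matrix of determinant `a x + b y`, with first row `(a, b, 0, …, 0)`. -/
def bezoutMat {R : Type*} [CommRing R] (m : ℕ) (a b x y : R) :
    Matrix (Fin (m + 2)) (Fin (m + 2)) R :=
  Matrix.of (Fin.cons (Fin.cons a (Fin.cons b 0))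
    (Fin.cons (Fin.cons (-y) (Fin.cons x 0)) fun i => Fin.cons 0 (Fin.cons 0 (Pi.single i 1))))

theorem det_bezoutMat {R : Type*} [CommRing R] (m : ℕ) (a b x y : R) :
    (bezoutMat m a b x y).det = a * x + b * y := by
  have h0 : (bezoutMat m a b x y).submatrix Fin.succ (Fin.succAbove 0) =
      Matrix.diagonal (Fin.cons x 1) := by
    ext i j
    refine Fin.cases ?_ (fun i => ?_) i <;> refine Fin.cases ?_ (fun j => ?_) j <;>
      simp [bezoutMat, Matrix.diagonal_apply, Pi.single_apply, Fin.succ_ne_zero, eq_comm]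
  have h1 : (bezoutMat m a b x y).submatrix Fin.succ (Fin.succAbove 1) =
      Matrix.diagonal (Fin.cons (-y) 1) := by
    ext i j
    have e : ∀ j : Fin m, (Fin.succAbove 1 j.succ : Fin (m + 2)) = j.succ.succ := fun j => by
      rw [← Fin.succ_zero_eq_one, Fin.succ_succAbove_succ, Fin.succAbove_zero]
    have e0 : (Fin.succAbove 1 0 : Fin (m + 2)) = 0 := rfl
    refine Fin.cases ?_ (fun i => ?_) i <;> refine Fin.cases ?_ (fun j => ?_) j <;>
      simp [bezoutMat, Matrix.diagonal_apply, Pi.single_apply, Fin.succ_ne_zero, eq_comm, e, e0]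
  rw [Matrix.det_succ_row_zero, Fin.sum_univ_succ, Fin.sum_univ_succ, h0, Fin.succ_zero_eq_one, h1]
  have h2 : ∀ i : Fin m, bezoutMat m a b x y 0 i.succ.succ = 0 := fun i => rfl
  have h3 : bezoutMat m a b x y 0 0 = a := rfl
  have h4 : bezoutMat m a b x y 0 1 = b := rfl
  simp only [h2, h3, h4, Matrix.det_diagonal, Fin.prod_univ_succ, Fin.cons_zero, Fin.cons_succ]
  simp

theorem exists_bezout (p q : GaussianInt) :
    ∃ d a b x y : GaussianInt, p = d * a ∧ q = d * b ∧ a * x + b * y = 1 := by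
  by_cases h : p = 0 ∧ q = 0
  · exact ⟨0, 1, 0, 1, 0, by simp [h.1], by simp [h.2], by simp⟩
  · have hd : EuclideanDomain.gcd p q ≠ 0 := fun h0 => h (EuclideanDomain.gcd_eq_zero_iff.1 h0)
    obtain ⟨a, ha⟩ := EuclideanDomain.gcd_dvd_left p q
    obtain ⟨b, hb⟩ := EuclideanDomain.gcd_dvd_right p q
    refine ⟨_, a, b, EuclideanDomain.gcdA p q, EuclideanDomain.gcdB p q, ha, hb, ?_⟩
    apply mul_left_cancel₀ hd
    have := EuclideanDomain.gcd_eq_gcd_ab p q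
    rw [mul_add, ← mul_assoc, ← mul_assoc, ← ha, ← hb, mul_one]
    exact this.symm

/-- Euclid's algorithm, by induction on the length: the tail is `d` times a row of `γ`, and a Bézout
matrix for the pair `(v 0, d)` merges the head with that row. -/
theorem exists_eq_smul_row (m : ℕ) (v : Fin (m + 1) → GaussianInt) :
    ∃ (d : GaussianInt) (γ : SLZ (m + 1)), v = d • fun j => γ 0 j := by
  induction m with
  | zero =>
    refine ⟨v 0, 1, ?_⟩
    funext j
    rw [Fin.fin_one_eq_zero j]
    simp
  | succ m ih =>
    obtain ⟨d, γ, h⟩ := ih (Fin.tail v)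
    obtain ⟨e, a, b, x, y, h0, h1, hab⟩ := exists_bezout (v 0) d
    let E : SLZ (m + 2) := ⟨bezoutMat m a b x y, by rw [det_bezoutMat, hab]⟩
    refine ⟨e, E * lowerZ γ 0, ?_⟩
    funext j
    have hE0 : E 0 0 = a := rfl
    have hE1 : E 0 1 = b := rfl
    have hE2 : ∀ i : Fin m, E 0 i.succ.succ = 0 := fun i => rfl
    have hL0 : lowerZ γ 0 0 0 = 1 := rfl
    have hL1 : ∀ j : Fin (m + 1), lowerZ γ 0 0 j.succ = 0 := fun j => rfl
    have hL2 : ∀ i : Fin (m + 1), lowerZ γ 0 i.succ 0 = 0 := fun i => by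
      change ((γ : Matrix (Fin (m + 1)) (Fin (m + 1)) GaussianInt) *ᵥ 0) i = 0
      simp
    have hL3 : ∀ j : Fin (m + 1), lowerZ γ 0 1 j.succ = γ 0 j := fun j => rfl
    have hL4 : lowerZ γ 0 1 0 = 0 := hL2 0
    rw [Pi.smul_apply, Matrix.SpecialLinearGroup.coe_mul, Matrix.mul_apply, Fin.sum_univ_succ,
      Fin.sum_univ_succ]
    simp only [Fin.succ_zero_eq_one, hE0, hE1, hE2, zero_mul, Finset.sum_const_zero, add_zero,
      smul_eq_mul]
    refine Fin.cases ?_ (fun j => ?_) j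
    · rw [hL0, hL4, h0]; ring
    · have := congrFun h j
      simp only [Fin.tail, Pi.smul_apply, smul_eq_mul] at this
      rw [hL1, hL3, this, h1]; ring

theorem Prim.exists_sum_eq_one {m : ℕ} (v : Prim m) :
    ∃ w : Fin (m + 1) → GaussianInt, ∑ j, v.1 j * w j = 1 := by
  obtain ⟨_, γ, rfl⟩ := v
  refine ⟨fun j => γ⁻¹ j 0, ?_⟩
  have : (γ * γ⁻¹) 0 0 = 1 := by rw [mul_inv_cancel]; rfl
  rwa [Matrix.SpecialLinearGroup.coe_mul, Matrix.mul_apply] at this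

/-- The entries of a primitive vector generate the unit ideal. So `d • v` determines the ideal
`(d)`, which yields uniqueness in the factorization of vectors. -/
theorem span_range_smul_prim {m : ℕ} (d : GaussianInt) (v : Prim m) :
    Ideal.span (Set.range (d • v.1)) = Ideal.span {d} := by
  apply le_antisymm
  · rw [Ideal.span_le]
    rintro _ ⟨j, rfl⟩
    exact Ideal.mem_span_singleton.2 (Dvd.intro (v.1 j) rfl)
  · rw [Ideal.span_singleton_le_iff_mem]
    obtain ⟨w, hw⟩ := v.exists_sum_eq_one
    have : d = ∑ j, w j * (d • v.1) j := by
      simp only [Pi.smul_apply, smul_eq_mul]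
      conv_lhs => rw [← mul_one d, ← hw, Finset.mul_sum]
      exact Finset.sum_congr rfl fun j _ => by ring
    have hmem : ∑ j, w j * (d • v.1) j ∈ Ideal.span (Set.range (d • v.1)) :=
      Ideal.sum_mem _ fun j _ => Ideal.mul_mem_left _ _ (Ideal.subset_span (Set.mem_range_self j))
    rwa [← this] at hmem

/-- The nonzero ideals of the Gaussian integers. -/
abbrev NonzeroIdeal : Type := {I : Ideal GaussianInt // I ≠ ⊥}

/-- A generator of an ideal of Gaussian integers. -/
def idealGen (I : NonzeroIdeal) : GaussianInt := Submodule.IsPrincipal.generator I.1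

theorem span_idealGen (I : NonzeroIdeal) : Ideal.span {idealGen I} = I.1 :=
  Ideal.span_singleton_generator I.1

theorem idealGen_ne_zero (I : NonzeroIdeal) : idealGen I ≠ 0 := fun h => by
  have := span_idealGen I
  rw [h, Ideal.span_singleton_eq_bot.2 rfl] at this
  exact I.2 this.symm

theorem Prim.ne_zero {m : ℕ} (v : Prim m) : v.1 ≠ 0 := fun h => by
  obtain ⟨w, hw⟩ := v.exists_sum_eq_one
  simp [h] at hw

/-- Every nonzero vector is, in a unique way, the product of the chosen generator of a nonzero
ideal and of a primitive vector. -/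
theorem bijective_idealGen_smul {m : ℕ} (hm : m ≠ 0) :
    Function.Bijective fun p : NonzeroIdeal × Prim m =>
      (⟨idealGen p.1 • p.2.1, smul_ne_zero (idealGen_ne_zero p.1) p.2.ne_zero⟩ :
        {v : Fin (m + 1) → GaussianInt // v ≠ 0}) := by
  constructor
  · rintro ⟨I, v⟩ ⟨J, w⟩ h
    simp only [Subtype.mk.injEq] at h
    have hIJ : I = J := Subtype.ext (by
      rw [← span_idealGen I, ← span_idealGen J, ← span_range_smul_prim _ v, h,
        span_range_smul_prim])
    subst hIJ
    exact Prod.ext rfl (Subtype.ext (smul_right_injective _ (idealGen_ne_zero I) h))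
  · rintro ⟨v, hv⟩
    obtain ⟨d, γ, h⟩ := exists_eq_smul_row m v
    have hd : d ≠ 0 := by
      rintro rfl
      exact hv (by rw [h, zero_smul])
    let I : NonzeroIdeal := ⟨Ideal.span {d}, fun h0 => hd (Ideal.span_singleton_eq_bot.1 h0)⟩
    -- The chosen generator may differ from `d` by a unit `u`. It is absorbed into the primitive row
    -- by left multiplication with `diag(u, u⁻¹, 1, …)`, which needs size at least `2`.
    obtain ⟨u, hu⟩ := Ideal.span_singleton_eq_span_singleton.1 (span_idealGen I)
    obtain ⟨k, rfl⟩ := Nat.exists_eq_succ_of_ne_zero hm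
    let E : SLZ (k + 2) := ⟨bezoutMat k (u : GaussianInt) 0 (u⁻¹ : GaussianIntˣ) 0, by
      rw [det_bezoutMat, zero_mul, add_zero, Units.mul_inv]⟩
    have hE0 : E 0 0 = u := rfl
    have hE1 : ∀ i : Fin (k + 1), E 0 i.succ = 0 := fun i => by
      refine Fin.cases ?_ (fun i => ?_) i <;> rfl
    refine ⟨(I, ⟨_, E * γ, rfl⟩), Subtype.ext ?_⟩
    change idealGen I • (fun j => (E * γ) 0 j) = v
    rw [h]
    funext j
    rw [Pi.smul_apply, Matrix.SpecialLinearGroup.coe_mul, Matrix.mul_apply, Fin.sum_univ_succ]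
    simp only [hE0, hE1, zero_mul, Finset.sum_const_zero, add_zero, smul_eq_mul, Pi.smul_apply]
    rw [← mul_assoc, hu]

/-! ### The zeta function -/

/-- The sum of `N(I)^{-n}` over the nonzero ideals, as an extended real number. -/
def zetaSum (n : ℕ) : ℝ≥0∞ :=
  ∑' I : NonzeroIdeal, ENNReal.ofReal ((‖GaussianInt.toComplex (idealGen I)‖ ^ (2 * n))⁻¹)

theorem natCard_quotient (I : NonzeroIdeal) :
    (Nat.card (GaussianInt ⧸ I.1) : ℝ) = ‖GaussianInt.toComplex (idealGen I)‖ ^ 2 := by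
  rw [← natCard_quotient_span_eq_norm_sq, span_idealGen]

/-- Comparison with the sum over `ℤ²` in the sup norm, which converges for exponents above `2`. The
term at `z = 0` is `0⁻¹ = 0`. -/
theorem summable_norm_pow_inv {n : ℕ} (hn : 2 ≤ n) :
    Summable fun z : GaussianInt => (‖GaussianInt.toComplex z‖ ^ (2 * n))⁻¹ := by
  have hs := EisensteinSeries.summable_one_div_norm_rpow (k := 2 * n) (by
    have : (2 : ℝ) ≤ n := by exact_mod_cast hn
    linarith)
  let e : GaussianInt ≃ (Fin 2 → ℤ) := gaussianBasis.equivFun.toEquiv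
  have hs' := e.summable_iff.2 hs
  refine Summable.of_nonneg_of_le (fun z => by positivity) (fun z => ?_) hs'
  by_cases hz : z = 0
  · subst hz
    rw [map_zero, norm_zero, zero_pow (by omega), _root_.inv_zero]
    exact Real.rpow_nonneg (norm_nonneg _) _
  have he : ‖e z‖ ≤ ‖GaussianInt.toComplex z‖ := by
    rw [pi_norm_le_iff_of_nonneg (norm_nonneg _)]
    intro i
    fin_cases i
    · change ‖(z.re : ℤ)‖ ≤ _
      rw [Int.norm_eq_abs, GaussianInt.intCast_re]
      exact Complex.abs_re_le_norm _
    · change ‖(z.im : ℤ)‖ ≤ _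
      rw [Int.norm_eq_abs, GaussianInt.intCast_im]
      exact Complex.abs_im_le_norm _
  have hez : 0 < ‖e z‖ := by
    rw [norm_pos_iff]
    intro h
    exact hz (gaussianBasis.equivFun.map_eq_zero_iff.1 h)
  change _ ≤ ‖e z‖ ^ (-(2 * n : ℝ))
  rw [Real.rpow_neg (norm_nonneg _)]
  have : ‖e z‖ ^ (2 * n : ℝ) = ‖e z‖ ^ (2 * n) := by
    rw [← Real.rpow_natCast]
    push_cast
    rfl
  rw [this]
  exact inv_anti₀ (by positivity) (pow_le_pow_left₀ hez.le he _)

theorem summable_idealGen {n : ℕ} (hn : 2 ≤ n) :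
    Summable fun I : NonzeroIdeal => (‖GaussianInt.toComplex (idealGen I)‖ ^ (2 * n))⁻¹ :=
  (summable_norm_pow_inv hn).comp_injective fun I J h => Subtype.ext (by
    rw [← span_idealGen I, ← span_idealGen J, h])

theorem zetaSum_eq {n : ℕ} (hn : 2 ≤ n) : zetaSum n = ENNReal.ofReal
    (∑' I : NonzeroIdeal, (‖GaussianInt.toComplex (idealGen I)‖ ^ (2 * n))⁻¹) :=
  (ENNReal.ofReal_tsum_of_nonneg (fun _ => by positivity) (summable_idealGen hn)).symm

theorem zetaSum_ne_top {n : ℕ} (hn : 2 ≤ n) : zetaSum n ≠ ⊤ := by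
  rw [zetaSum_eq hn]
  exact ENNReal.ofReal_ne_top

theorem zetaQi_eq {n : ℕ} (hn : 2 ≤ n) : zetaQi n = ((zetaSum n).toReal : ℂ) := by
  rw [zetaSum_eq hn, ENNReal.toReal_ofReal (tsum_nonneg fun _ => by positivity),
    Complex.ofReal_tsum, zetaQi]
  refine tsum_congr fun I => ?_
  have h : (Nat.card (GaussianInt ⧸ I.1) : ℂ) = ((Nat.card (GaussianInt ⧸ I.1) : ℝ) : ℂ) := by
    push_cast
    rfl
  rw [h, natCard_quotient, Complex.cpow_neg, Complex.cpow_natCast]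
  push_cast
  rw [pow_mul]

theorem lintegral_comp_complex_smul {n : ℕ} {z : ℂ} (hz : z ≠ 0) {f : (Fin n → ℂ) → ℝ≥0∞}
    (hf : Measurable f) :
    ∫⁻ x, f (z • x) = ENNReal.ofReal ((‖z‖ ^ (2 * n))⁻¹) * ∫⁻ x, f x := by
  have hd : LinearMap.det (z • (LinearMap.id : (Fin n → ℂ) →ₗ[ℂ] (Fin n → ℂ))) = z ^ n := by
    rw [LinearMap.det_smul, LinearMap.det_id, Module.finrank_fin_fun, mul_one]
  have h := map_complexLinearMap_volume (z • (LinearMap.id : (Fin n → ℂ) →ₗ[ℂ] (Fin n → ℂ)))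
    (by rw [hd]; exact pow_ne_zero n hz)
  rw [hd, norm_pow, ← pow_mul, mul_comm n 2] at h
  have h2 : Measurable fun x : Fin n → ℂ => z • x := measurable_const_smul z
  have h3 : Measure.map (fun x : Fin n → ℂ => z • x) volume =
      ENNReal.ofReal ((‖z‖ ^ (2 * n))⁻¹) • volume := h
  rw [← lintegral_map hf h2, h3, lintegral_smul_measure, smul_eq_mul]

theorem cvec_smul {n : ℕ} (d : GaussianInt) (v : Fin n → GaussianInt) :
    cvec n (d • v) = GaussianInt.toComplex d • cvec n v := by
  funext j
  simp [cvec_apply]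

theorem measurable_tsum_vecMul {m : ℕ} {ι : Type*} [Countable ι] (u : ι → Fin (m + 1) → ℂ)
    {f : (Fin (m + 1) → ℂ) → ℝ≥0∞} (hf : Measurable f) :
    Measurable fun g : G (m + 1) =>
      ∑' i, f (u i ᵥ* (g : Matrix (Fin (m + 1)) (Fin (m + 1)) ℂ)) := by
  refine Measurable.tsum fun i => hf.comp (measurable_pi_iff.2 fun j => ?_)
  have : Measurable fun g : G (m + 1) => ∑ k, u i k * g k j :=
    Finset.measurable_sum _ fun k _ => (measurable_G_entry k j).const_mul _
  exact this

instance instCountableNonzeroIdeal : Countable NonzeroIdeal :=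
  Function.Injective.countable (f := idealGen) fun I J h => Subtype.ext (by
    rw [← span_idealGen I, ← span_idealGen J, h])

/-- The unfolding formula for sums over nonzero vectors. -/
theorem lintegral_tsum_ne_zero_rowMeasure {m : ℕ} (hm : m ≠ 0) (κ : Measure (G m))
    [κ.IsHaarMeasure] {f : (Fin (m + 1) → ℂ) → ℝ≥0∞} (hf : Measurable f) :
    ∫⁻ g in fundamentalSet (m + 1), ∑' v : {v : Fin (m + 1) → GaussianInt // v ≠ 0},
        f (cvec (m + 1) v.1 ᵥ* (g : Matrix (Fin (m + 1)) (Fin (m + 1)) ℂ)) ∂(rowMeasure κ) =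
      zetaSum (m + 1) * κ (fundamentalSet m) * ∫⁻ x, f x := by
  have h1 : ∀ g : G (m + 1), ∑' v : {v : Fin (m + 1) → GaussianInt // v ≠ 0},
      f (cvec (m + 1) v.1 ᵥ* (g : Matrix (Fin (m + 1)) (Fin (m + 1)) ℂ)) =
      ∑' I : NonzeroIdeal, ∑' v : Prim m, f (GaussianInt.toComplex (idealGen I) •
        (cvec (m + 1) v.1 ᵥ* (g : Matrix (Fin (m + 1)) (Fin (m + 1)) ℂ))) := by
    intro g
    rw [← (Equiv.ofBijective _ (bijective_idealGen_smul hm)).tsum_eq, ← ENNReal.tsum_prod]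
    refine tsum_congr fun p => ?_
    rw [Equiv.ofBijective_apply, cvec_smul, Matrix.smul_vecMul]
  have hfI : ∀ I : NonzeroIdeal, Measurable fun x : Fin (m + 1) → ℂ =>
      f (GaussianInt.toComplex (idealGen I) • x) := fun I => hf.comp (measurable_const_smul _)
  simp only [h1]
  rw [lintegral_tsum fun I => (measurable_tsum_vecMul _ (hfI I)).aemeasurable]
  simp only [fun I => lintegral_tsum_prim_rowMeasure hm κ (hfI I)]
  -- Scaling by a generator of `I` divides the integral by its norm to the power `2(m + 1)`, that is
  -- by `N(I)^{m+1}`; summing over `I` gives the zeta value.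
  rw [zetaSum, mul_assoc, ← ENNReal.tsum_mul_right]
  refine tsum_congr fun I => ?_
  rw [lintegral_comp_complex_smul _ hf]
  · ring
  · rw [Ne, GaussianInt.toComplex_eq_zero]
    exact idealGen_ne_zero I

/-! ### Counting lattice points -/

/-- The indicator function of the ball of radius `R` in `ℂ^n`. -/
def ballInd (n : ℕ) (R : ℝ) : (Fin n → ℂ) → ℝ≥0∞ := (Metric.ball 0 R).indicator 1

theorem ballInd_of_lt {n : ℕ} {R : ℝ} {x : Fin n → ℂ} (h : ‖x‖ < R) : ballInd n R x = 1 :=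
  Set.indicator_of_mem (mem_ball_zero_iff.2 h) _

theorem ballInd_of_le {n : ℕ} {R : ℝ} {x : Fin n → ℂ} (h : R ≤ ‖x‖) : ballInd n R x = 0 :=
  Set.indicator_of_notMem (fun h' => not_lt.2 h (mem_ball_zero_iff.1 h')) _

theorem ballInd_le_ballInd {n : ℕ} {R S : ℝ} {x y : Fin n → ℂ} (h : ‖x‖ < R → ‖y‖ < S) :
    ballInd n R x ≤ ballInd n S y := by
  by_cases hx : ‖x‖ < R
  · rw [ballInd_of_lt hx, ballInd_of_lt (h hx)]
  · rw [ballInd_of_le (not_lt.1 hx)]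
    exact zero_le

theorem measurable_ballInd (n : ℕ) (R : ℝ) : Measurable (ballInd n R) :=
  measurable_one.indicator measurableSet_ball

/-- The norm on `Fin n → ℂ` is the sup norm, so the ball is a polydisc. Its volume is left
unevaluated, since it cancels in `rowMeasure_fundamentalSet`. -/
theorem lintegral_ballInd (n : ℕ) {R : ℝ} (hR : 0 < R) :
    ∫⁻ x, ballInd n R x =
      ENNReal.ofReal (R ^ (2 * n)) * volume (Metric.ball (0 : Fin n → ℂ) 1) := by
  rw [ballInd, lintegral_indicator_one measurableSet_ball, Measure.addHaar_ball_of_pos _ _ hR,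
    Module.finrank_pi_fintype]
  simp [mul_comm]

/-- The number of vectors of norm less than `R` in the lattice `ℤ[i]^n g`. -/
def latticeCount {n : ℕ} (g : G n) (R : ℝ) : ℝ≥0∞ :=
  ∑' v : Fin n → GaussianInt, ballInd n R (cvec n v ᵥ* (g : Matrix (Fin n) (Fin n) ℂ))

/-- The number of nonzero vectors of norm less than `R` in the lattice `ℤ[i]^n g`. -/
def latticeCountNeZero {n : ℕ} (g : G n) (R : ℝ) : ℝ≥0∞ :=
  ∑' v : {v : Fin n → GaussianInt // v ≠ 0},
    ballInd n R (cvec n v.1 ᵥ* (g : Matrix (Fin n) (Fin n) ℂ))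

theorem tsum_eq_zero_add_tsum_ne {α : Type*} [Zero α] (f : α → ℝ≥0∞) :
    ∑' v, f v = f 0 + ∑' v : {v : α // v ≠ 0}, f v := by
  have h1 : ∑' v : {v : α // v ≠ 0}, f v = ∑' v, ({0}ᶜ : Set α).indicator f v :=
    tsum_subtype ({0}ᶜ : Set α) f
  have h2 : f 0 = ∑' v, ({0} : Set α).indicator f v := by
    rw [← tsum_subtype ({0} : Set α) f, tsum_singleton 0 f]
  rw [h1, h2, ← ENNReal.tsum_add]
  exact tsum_congr fun v => (Set.indicator_self_add_compl_apply _ _ _).symm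

theorem latticeCount_eq {n : ℕ} (g : G n) {R : ℝ} (hR : 0 < R) :
    latticeCount g R = 1 + latticeCountNeZero g R := by
  have h0 : ballInd n R (cvec n 0 ᵥ* (g : Matrix (Fin n) (Fin n) ℂ)) = 1 := by
    have h : cvec n 0 = 0 := map_zero _
    rw [h, Matrix.zero_vecMul]
    exact ballInd_of_lt (by rwa [norm_zero])
  have h1 := tsum_eq_zero_add_tsum_ne fun v : Fin n → GaussianInt =>
    ballInd n R (cvec n v ᵥ* (g : Matrix (Fin n) (Fin n) ℂ))
  simp only [h0] at h1
  exact h1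

theorem norm_le_two_of_mem_unitBox {n : ℕ} {x : Fin n → ℂ} (hx : x ∈ unitBox n) : ‖x‖ ≤ 2 := by
  rw [mem_unitBox] at hx
  rw [pi_norm_le_iff_of_nonneg (by norm_num)]
  intro i
  have h1 := abs_le.2 (⟨by linarith [(hx i).1.1], (hx i).1.2.le⟩ : -1 ≤ (x i).re ∧ (x i).re ≤ 1)
  have h2 := abs_le.2 (⟨by linarith [(hx i).2.1], (hx i).2.2.le⟩ : -1 ≤ (x i).im ∧ (x i).im ≤ 1)
  linarith [Complex.norm_le_abs_re_add_abs_im (x i)]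

theorem exists_norm_vecMul_le {n : ℕ} (g : G n) : ∃ D : ℝ, 0 ≤ D ∧ ∀ x ∈ unitBox n,
    ‖x ᵥ* (g : Matrix (Fin n) (Fin n) ℂ)‖ ≤ D := by
  let L := (Matrix.vecMulLinear (g : Matrix (Fin n) (Fin n) ℂ)).toContinuousLinearMap
  refine ⟨‖L‖ * 2, by positivity, fun x hx => (L.le_opNorm x).trans ?_⟩
  gcongr
  exact norm_le_two_of_mem_unitBox hx

theorem lintegral_ballInd_eq_tsum {n : ℕ} (g : G n) (R : ℝ) :
    ∫⁻ x, ballInd n R x = ∑' v : Fin n → GaussianInt, ∫⁻ b in unitBox n,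
      ballInd n R (cvec n v ᵥ* (g : Matrix (Fin n) (Fin n) ℂ) +
        b ᵥ* (g : Matrix (Fin n) (Fin n) ℂ)) := by
  rw [← (measurePreserving_vecMul g).lintegral_comp (measurable_ballInd n R),
    lintegral_eq_tsum_unitBox]
  simp only [Matrix.add_vecMul]

theorem latticeCount_eq_tsum {n : ℕ} (g : G n) (R : ℝ) :
    latticeCount g R = ∑' v : Fin n → GaussianInt, ∫⁻ _ in unitBox n,
      ballInd n R (cvec n v ᵥ* (g : Matrix (Fin n) (Fin n) ℂ)) := by
  simp only [lintegral_const, Measure.restrict_apply_univ, volume_unitBox, mul_one]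
  rfl

/-- Each lattice point carries a cell of volume `1`, the translated image of the unit box, whose
points lie within `D` of it. The cells tile space, so those meeting the ball of radius `R - D`
belong to points of norm less than `R`. -/
theorem lintegral_ballInd_le_latticeCount {n : ℕ} (g : G n) {D : ℝ}
    (hD : ∀ x ∈ unitBox n, ‖x ᵥ* (g : Matrix (Fin n) (Fin n) ℂ)‖ ≤ D) (R : ℝ) :
    ∫⁻ x, ballInd n (R - D) x ≤ latticeCount g R := by
  rw [lintegral_ballInd_eq_tsum g, latticeCount_eq_tsum]
  refine ENNReal.tsum_le_tsum fun v => setLIntegral_mono' (measurableSet_unitBox n) fun b hb =>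
    ballInd_le_ballInd fun h => ?_
  have := norm_sub_le (cvec n v ᵥ* (g : Matrix (Fin n) (Fin n) ℂ) +
    b ᵥ* (g : Matrix (Fin n) (Fin n) ℂ)) (b ᵥ* (g : Matrix (Fin n) (Fin n) ℂ))
  rw [add_sub_cancel_right] at this
  linarith [hD b hb]

theorem latticeCount_le_lintegral_ballInd {n : ℕ} (g : G n) {D : ℝ}
    (hD : ∀ x ∈ unitBox n, ‖x ᵥ* (g : Matrix (Fin n) (Fin n) ℂ)‖ ≤ D) (R : ℝ) :
    latticeCount g R ≤ ∫⁻ x, ballInd n (R + D) x := by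
  rw [lintegral_ballInd_eq_tsum g, latticeCount_eq_tsum]
  refine ENNReal.tsum_le_tsum fun v => setLIntegral_mono' (measurableSet_unitBox n) fun b hb =>
    ballInd_le_ballInd fun h => ?_
  have := norm_add_le (cvec n v ᵥ* (g : Matrix (Fin n) (Fin n) ℂ))
    (b ᵥ* (g : Matrix (Fin n) (Fin n) ℂ))
  linarith [hD b hb]

theorem tendsto_latticeCount {n : ℕ} (g : G n) :
    Filter.Tendsto (fun k : ℕ => ENNReal.ofReal (((k : ℝ) ^ (2 * n))⁻¹) * latticeCount g k)
      Filter.atTop (nhds (volume (Metric.ball (0 : Fin n → ℂ) 1))) := by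
  obtain ⟨D, hD0, hD⟩ := exists_norm_vecMul_le g
  have key : ∀ s : ℝ, Filter.Tendsto (fun k : ℕ => ENNReal.ofReal ((1 + s / k) ^ (2 * n)) *
      volume (Metric.ball (0 : Fin n → ℂ) 1)) Filter.atTop
      (nhds (volume (Metric.ball (0 : Fin n → ℂ) 1))) := fun s => by
    have h1 : Filter.Tendsto (fun k : ℕ => (1 + s / k) ^ (2 * n)) Filter.atTop (nhds 1) := by
      simpa using ((tendsto_const_div_atTop_nhds_zero_nat s).const_add 1).pow (2 * n)
    simpa using ENNReal.Tendsto.mul_const (ENNReal.tendsto_ofReal h1)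
      (Or.inr (measure_ball_lt_top (μ := (volume : Measure (Fin n → ℂ)))).ne)
  have hscale : ∀ (k : ℕ) (s : ℝ), 0 < k → 0 < (k : ℝ) + s →
      ENNReal.ofReal ((1 + s / k) ^ (2 * n)) * volume (Metric.ball (0 : Fin n → ℂ) 1) =
        ENNReal.ofReal (((k : ℝ) ^ (2 * n))⁻¹) * ∫⁻ x, ballInd n (k + s) x := fun k s hk hs => by
    have hk' : (k : ℝ) ≠ 0 := by positivity
    rw [lintegral_ballInd n hs, ← mul_assoc, ← ENNReal.ofReal_mul (by positivity), ← inv_pow,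
      ← mul_pow]
    congr 4
    field_simp
  refine tendsto_of_tendsto_of_tendsto_of_le_of_le' (key (-D)) (key D) ?_ ?_
  · filter_upwards [Filter.eventually_ge_atTop (⌈D⌉₊ + 1)] with k hk
    have hDk : D < k := (Nat.le_ceil D).trans_lt (by exact_mod_cast (by omega : ⌈D⌉₊ < k))
    rw [hscale k (-D) (by omega) (by linarith)]
    gcongr
    exact lintegral_ballInd_le_latticeCount g hD k
  · filter_upwards [Filter.eventually_ge_atTop 1] with k hk
    rw [hscale k D (by omega) (by positivity)]
    gcongr
    exact latticeCount_le_lintegral_ballInd g hD k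

theorem tendsto_latticeCountNeZero {n : ℕ} (hn : n ≠ 0) (g : G n) :
    Filter.Tendsto (fun k : ℕ => ENNReal.ofReal (((k : ℝ) ^ (2 * n))⁻¹) * latticeCountNeZero g k)
      Filter.atTop (nhds (volume (Metric.ball (0 : Fin n → ℂ) 1))) := by
  have h0 : Filter.Tendsto (fun k : ℕ => ENNReal.ofReal (((k : ℝ) ^ (2 * n))⁻¹))
      Filter.atTop (nhds 0) := by
    rw [← ENNReal.ofReal_zero]
    refine ENNReal.tendsto_ofReal (Filter.Tendsto.inv_tendsto_atTop ?_)
    exact (Filter.tendsto_pow_atTop (by omega)).comp tendsto_natCast_atTop_atTop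
  have h := ENNReal.Tendsto.sub (tendsto_latticeCount g) h0 (Or.inr ENNReal.zero_ne_top)
  rw [tsub_zero] at h
  refine h.congr' ?_
  filter_upwards [Filter.eventually_ge_atTop 1] with k hk
  rw [latticeCount_eq g (by exact_mod_cast hk), mul_add, mul_one,
    ENNReal.add_sub_cancel_left ENNReal.ofReal_ne_top]

/-- The number of lattice points in a ball of radius `1/2` is at most that in the ball of radius
`1` around the origin. -/
theorem tsum_ballInd_sub_le {n : ℕ} (g : G n) (x : Fin n → ℂ) :
    ∑' v : Fin n → GaussianInt,
      ballInd n (1 / 2) (x - cvec n v ᵥ* (g : Matrix (Fin n) (Fin n) ℂ)) ≤ latticeCount g 1 := by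
  by_cases h : ∃ v : Fin n → GaussianInt,
      ‖x - cvec n v ᵥ* (g : Matrix (Fin n) (Fin n) ℂ)‖ < 1 / 2
  · obtain ⟨w, hw⟩ := h
    rw [latticeCount, ← (Equiv.subRight w).tsum_eq fun v : Fin n → GaussianInt =>
      ballInd n 1 (cvec n v ᵥ* (g : Matrix (Fin n) (Fin n) ℂ))]
    refine ENNReal.tsum_le_tsum fun v => ballInd_le_ballInd fun h => ?_
    rw [Equiv.subRight_apply, map_sub, Matrix.sub_vecMul]
    have := norm_sub_le (x - cvec n w ᵥ* (g : Matrix (Fin n) (Fin n) ℂ))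
      (x - cvec n v ᵥ* (g : Matrix (Fin n) (Fin n) ℂ))
    rw [sub_sub_sub_cancel_left] at this
    linarith
  · push Not at h
    rw [ENNReal.tsum_eq_zero.2 fun v => ballInd_of_le (h v)]
    exact zero_le

/-- The error in `tendsto_latticeCount` depends on `g`; this bound has a uniform constant and
supplies the dominating function. Pairs of a lattice point `p` with `|p| < k` and a point `x` with
`|x - p| < 1/2` are counted twice: all `x` lie in the ball of radius `k + 1`, and each is close to
at most `latticeCount g 1` lattice points. The `4` bounds `2(k + 1)/k`. -/
theorem latticeCount_le {n : ℕ} (g : G n) {k : ℕ} (hk : 1 ≤ k) :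
    ENNReal.ofReal (((k : ℝ) ^ (2 * n))⁻¹) * latticeCount g k ≤
      ENNReal.ofReal (4 ^ (2 * n)) * latticeCount g 1 := by
  set c := volume (Metric.ball (0 : Fin n → ℂ) 1) with hc
  have hk1 : (1 : ℝ) ≤ k := by exact_mod_cast hk
  have hc0 : c ≠ 0 := (Metric.measure_ball_pos _ _ one_pos).ne'
  have hct : c ≠ ⊤ := measure_ball_lt_top.ne
  have h1 : latticeCount g k * ∫⁻ x, ballInd n (1 / 2) x ≤
      (∫⁻ x, ballInd n (k + 1) x) * latticeCount g 1 := by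
    rw [latticeCount, ← ENNReal.tsum_mul_right,
      ← lintegral_mul_const _ (measurable_ballInd n (k + 1))]
    have h2 : ∀ v : Fin n → GaussianInt, ∫⁻ x, ballInd n (1 / 2) x =
        ∫⁻ x, ballInd n (1 / 2) (x - cvec n v ᵥ* (g : Matrix (Fin n) (Fin n) ℂ)) := fun v =>
      (lintegral_sub_right_eq_self _ _).symm
    have h3 : ∀ v : Fin n → GaussianInt, Measurable fun x : Fin n → ℂ =>
        ballInd n (1 / 2) (x - cvec n v ᵥ* (g : Matrix (Fin n) (Fin n) ℂ)) := fun v =>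
      (measurable_ballInd n _).comp (measurable_id.sub_const _)
    calc ∑' v : Fin n → GaussianInt, ballInd n k (cvec n v ᵥ* (g : Matrix (Fin n) (Fin n) ℂ)) *
          ∫⁻ x, ballInd n (1 / 2) x
        = ∑' v : Fin n → GaussianInt, ∫⁻ x,
            ballInd n k (cvec n v ᵥ* (g : Matrix (Fin n) (Fin n) ℂ)) *
            ballInd n (1 / 2) (x - cvec n v ᵥ* (g : Matrix (Fin n) (Fin n) ℂ)) :=
          tsum_congr fun v => by rw [lintegral_const_mul _ (h3 v), ← h2 v]
      _ ≤ ∑' v : Fin n → GaussianInt, ∫⁻ x, ballInd n (k + 1) x *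
            ballInd n (1 / 2) (x - cvec n v ᵥ* (g : Matrix (Fin n) (Fin n) ℂ)) := by
          refine ENNReal.tsum_le_tsum fun v => lintegral_mono fun x => ?_
          by_cases hx : ‖x - cvec n v ᵥ* (g : Matrix (Fin n) (Fin n) ℂ)‖ < 1 / 2
          · gcongr
            refine ballInd_le_ballInd fun h => ?_
            have := norm_add_le (x - cvec n v ᵥ* (g : Matrix (Fin n) (Fin n) ℂ))
              (cvec n v ᵥ* (g : Matrix (Fin n) (Fin n) ℂ))
            rw [sub_add_cancel] at this
            linarith
          · rw [ballInd_of_le (not_lt.1 hx), mul_zero, mul_zero]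
      _ = ∫⁻ x, ballInd n (k + 1) x * ∑' v : Fin n → GaussianInt,
            ballInd n (1 / 2) (x - cvec n v ᵥ* (g : Matrix (Fin n) (Fin n) ℂ)) := by
          simp only [← ENNReal.tsum_mul_left]
          rw [lintegral_tsum fun v => ?_]
          exact ((measurable_ballInd n _).mul (h3 v)).aemeasurable
      _ ≤ ∫⁻ x, ballInd n (k + 1) x * latticeCount g 1 := by
          refine lintegral_mono fun x => ?_
          gcongr
          exact tsum_ballInd_sub_le g x
  rw [lintegral_ballInd n (by norm_num), lintegral_ballInd n (by positivity), ← hc] at h1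
  have h4 : latticeCount g k * ENNReal.ofReal ((1 / 2) ^ (2 * n)) ≤
      ENNReal.ofReal ((k + 1) ^ (2 * n)) * latticeCount g 1 := by
    rw [← mul_assoc, mul_right_comm _ c] at h1
    exact (ENNReal.mul_le_mul_iff_left hc0 hct).1 h1
  calc ENNReal.ofReal (((k : ℝ) ^ (2 * n))⁻¹) * latticeCount g k
      = ENNReal.ofReal ((2 / k) ^ (2 * n)) *
          (latticeCount g k * ENNReal.ofReal ((1 / 2) ^ (2 * n))) := by
        rw [mul_comm (latticeCount g k), ← mul_assoc, ← ENNReal.ofReal_mul (by positivity),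
          ← mul_pow, ← inv_pow]
        congr 3
        field_simp
    _ ≤ ENNReal.ofReal ((2 / k) ^ (2 * n)) *
          (ENNReal.ofReal ((k + 1) ^ (2 * n)) * latticeCount g 1) := by gcongr
    _ = ENNReal.ofReal ((2 / k * (k + 1)) ^ (2 * n)) * latticeCount g 1 := by
        rw [← mul_assoc, ← ENNReal.ofReal_mul (by positivity), ← mul_pow]
    _ ≤ ENNReal.ofReal (4 ^ (2 * n)) * latticeCount g 1 := by
        gcongr
        rw [div_mul_eq_mul_div, div_le_iff₀ (by positivity)]
        linarith

/-! ### The recursion for the volumes -/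

theorem lintegral_latticeCountNeZero {m : ℕ} (hm : m ≠ 0) (κ : Measure (G m)) [κ.IsHaarMeasure]
    {R : ℝ} (hR : 0 < R) :
    ∫⁻ g in fundamentalSet (m + 1), latticeCountNeZero g R ∂(rowMeasure κ) =
      zetaSum (m + 1) * κ (fundamentalSet m) * (ENNReal.ofReal (R ^ (2 * (m + 1))) *
        volume (Metric.ball (0 : Fin (m + 1) → ℂ) 1)) := by
  rw [← lintegral_ballInd _ hR]
  exact lintegral_tsum_ne_zero_rowMeasure hm κ (measurable_ballInd _ R)

theorem measurable_latticeCountNeZero (m : ℕ) (R : ℝ) :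
    Measurable fun g : G (m + 1) => latticeCountNeZero g R :=
  measurable_tsum_vecMul (fun v : {v : Fin (m + 1) → GaussianInt // v ≠ 0} => cvec (m + 1) v.1)
    (measurable_ballInd (m + 1) R)

/-- The normalized counts `Φ k` have the same integral `a * c` for every `k ≥ 1` and converge
pointwise to the constant `c`, so the domain must have measure `a`. -/
theorem rowMeasure_fundamentalSet {m : ℕ} (hm : m ≠ 0) (κ : Measure (G m)) [κ.IsHaarMeasure]
    (hκ : κ (fundamentalSet m) ≠ ⊤) :
    rowMeasure κ (fundamentalSet (m + 1)) = zetaSum (m + 1) * κ (fundamentalSet m) := by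
  set c := volume (Metric.ball (0 : Fin (m + 1) → ℂ) 1) with hc
  set a := zetaSum (m + 1) * κ (fundamentalSet m) with ha
  set ρ := (rowMeasure κ).restrict (fundamentalSet (m + 1)) with hρ
  have hρu : ρ Set.univ = rowMeasure κ (fundamentalSet (m + 1)) := Measure.restrict_apply_univ _
  have hc0 : c ≠ 0 := (Metric.measure_ball_pos _ _ one_pos).ne'
  have hct : c ≠ ⊤ := measure_ball_lt_top.ne
  have hat : a ≠ ⊤ := ENNReal.mul_ne_top (zetaSum_ne_top (by omega)) hκ
  let Φ : ℕ → G (m + 1) → ℝ≥0∞ := fun k g =>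
    ENNReal.ofReal (((k : ℝ) ^ (2 * (m + 1)))⁻¹) * latticeCountNeZero g k
  have hΦm : ∀ k, Measurable (Φ k) := fun k =>
    (measurable_latticeCountNeZero m k).const_mul _
  have hΦi : ∀ k, 1 ≤ k → ∫⁻ g, Φ k g ∂ρ = a * c := by
    intro k hk
    have hk' : (0 : ℝ) < k := by exact_mod_cast hk
    rw [lintegral_const_mul _ (measurable_latticeCountNeZero m k), hρ,
      lintegral_latticeCountNeZero hm κ hk', ← ha, ← hc, mul_left_comm, ← mul_assoc (ENNReal.ofReal _),
      ← ENNReal.ofReal_mul (by positivity), inv_mul_cancel₀ (by positivity), ENNReal.ofReal_one,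
      one_mul]
  have hΦt : ∀ g, Filter.Tendsto (fun k => Φ k g) Filter.atTop (nhds c) := fun g =>
    tendsto_latticeCountNeZero (Nat.succ_ne_zero m) g
  have hit : Filter.Tendsto (fun k => ∫⁻ g, Φ k g ∂ρ) Filter.atTop (nhds (a * c)) := by
    refine tendsto_const_nhds.congr' ?_
    filter_upwards [Filter.eventually_ge_atTop 1] with k hk
    exact (hΦi k hk).symm
  -- Fatou's lemma comes first: constants must be known to be integrable before the dominating
  -- function below can be used.
  have hfatou : c * ρ Set.univ ≤ a * c := by
    have h := lintegral_liminf_le (μ := ρ) (u := Filter.atTop) hΦm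
    simp only [fun g => (hΦt g).liminf_eq, hit.liminf_eq, lintegral_const] at h
    exact h
  have hρt : ρ Set.univ ≠ ⊤ := fun h => by
    rw [h, ENNReal.mul_top hc0] at hfatou
    exact ENNReal.mul_ne_top hat hct (top_le_iff.1 hfatou)
  have hint1 : ∫⁻ g, latticeCountNeZero g 1 ∂ρ ≠ ⊤ := by
    rw [hρ, lintegral_latticeCountNeZero hm κ one_pos]
    exact ENNReal.mul_ne_top hat (ENNReal.mul_ne_top ENNReal.ofReal_ne_top hct)
  let C : ℝ≥0∞ := ENNReal.ofReal (4 ^ (2 * (m + 1)))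
  have hbound : ∀ k, 1 ≤ k → ∀ g : G (m + 1), Φ k g ≤ C * (1 + latticeCountNeZero g 1) := by
    intro k hk g
    rw [← latticeCount_eq g one_pos]
    refine le_trans ?_ (latticeCount_le g hk)
    simp only [Φ]
    gcongr
    rw [latticeCount_eq g (by exact_mod_cast hk)]
    exact le_add_self
  have hdom : ∫⁻ g, C * (1 + latticeCountNeZero g 1) ∂ρ ≠ ⊤ := by
    rw [lintegral_const_mul _ ((measurable_latticeCountNeZero m 1).const_add 1),
      lintegral_add_left measurable_const, lintegral_one]
    exact ENNReal.mul_ne_top ENNReal.ofReal_ne_top (ENNReal.add_ne_top.2 ⟨hρt, hint1⟩)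
  -- The index is shifted by one because the domination holds only for `k ≥ 1`.
  have hlim := tendsto_lintegral_of_dominated_convergence (μ := ρ)
    (F := fun k => Φ (k + 1)) (f := fun _ => c) (fun g => C * (1 + latticeCountNeZero g 1))
    (fun k => hΦm (k + 1)) (fun k => Filter.Eventually.of_forall (hbound (k + 1) (by omega)))
    hdom (Filter.Eventually.of_forall fun g => (hΦt g).comp (Filter.tendsto_add_atTop_nat 1))
  have heq := tendsto_nhds_unique hlim (hit.comp (Filter.tendsto_add_atTop_nat 1))
  rw [lintegral_const, mul_comm a] at heq
  rw [← hρu]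
  exact (ENNReal.mul_right_inj hc0 hct).1 heq

theorem V_succ {m : ℕ} (hm : m ≠ 0) {κ : Measure (G m)} {μ : Measure (G (m + 1))}
    (hκ : IsSymmetricallyNormalized m κ) (hμ : IsSymmetricallyNormalized (m + 1) μ)
    (hV : V m κ ≠ ⊤) :
    V (m + 1) μ = ENNReal.ofReal (m.factorial / Real.pi ^ (m + 1)) *
      (zetaSum (m + 1) * V m κ) := by
  have := hκ.isHaar
  have := hμ.isHaar
  rw [V_eq] at hV
  rw [V_eq, V_eq, isSymmetricallyNormalized_succ_eq hm hκ hμ, Measure.smul_apply,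
    rowMeasure_fundamentalSet hm κ hV, smul_eq_mul]

/-- `SL_1(ℂ)` is a single point of mass `1`, and the fundamental domain must contain it. -/
theorem V_one {μ : Measure (G 1)} (hμ : IsSymmetricallyNormalized 1 μ) : V 1 μ = 1 := by
  have hd : IsSymmetricallyNormalized 1 (Measure.dirac (1 : G 1)) := by
    have := isHaarMeasure_dirac_one
    exact isSymmetricallyNormalized_of_isDecomposed _ isDecomposed_one
  rw [isSymmetricallyNormalized_unique one_ne_zero hμ hd]
  have := isHaarMeasure_dirac_one
  rw [V_eq, Measure.dirac_apply' _ (measurableSet_fundamentalSet 1)]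
  refine Set.indicator_of_mem ?_ _
  obtain ⟨γ, h, -⟩ := existsUnique_toG_mul_mem (1 : G 1)
  rwa [Subsingleton.elim (1 : G 1) (toG 1 γ * 1)]

theorem V_ne_top {n : ℕ} (hn : 1 ≤ n) {μ : Measure (G n)} (hμ : IsSymmetricallyNormalized n μ) :
    V n μ ≠ ⊤ := by
  induction n, hn using Nat.le_induction with
  | base =>
    rw [V_one hμ]
    exact ENNReal.one_ne_top
  | succ n hn ih =>
    obtain ⟨κ, hκ, -⟩ := existsUnique_isSymmetricallyNormalized hn
    rw [V_succ (by omega) hκ hμ (ih hκ)]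
    exact ENNReal.mul_ne_top ENNReal.ofReal_ne_top
      (ENNReal.mul_ne_top (zetaSum_ne_top (by omega)) (ih hκ))

theorem lambdaZeta_succ {m : ℕ} (hm : m ≠ 0) : lambdaZeta ((m + 1 : ℕ) : ℂ) =
    ((ENNReal.ofReal (m.factorial / Real.pi ^ (m + 1)) * zetaSum (m + 1)).toReal : ℂ) := by
  rw [ENNReal.toReal_mul, ENNReal.toReal_ofReal (by positivity), lambdaZeta,
    zetaQi_eq (by omega), Complex.cpow_neg, Complex.cpow_natCast]
  push_cast
  rw [Complex.Gamma_nat_eq_factorial]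
  ring

theorem toReal_V_succ {m : ℕ} (hm : m ≠ 0) {κ : Measure (G m)} {μ : Measure (G (m + 1))}
    (hκ : IsSymmetricallyNormalized m κ) (hμ : IsSymmetricallyNormalized (m + 1) μ) :
    ((V (m + 1) μ).toReal : ℂ) = lambdaZeta ((m + 1 : ℕ) : ℂ) * ((V m κ).toReal : ℂ) := by
  rw [V_succ hm hκ hμ (V_ne_top (by omega) hκ), lambdaZeta_succ hm, ← mul_assoc,
    ENNReal.toReal_mul (b := V m κ), Complex.ofReal_mul]

end GaussianCovolume

end

/-! ### Existence, finiteness, recursion and product formula -/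

theorem mainTheorem10 :
    (∀ n : ℕ, 1 ≤ n →
      ∃! μ : Measure (GaussianCovolume.G n), GaussianCovolume.IsSymmetricallyNormalized n μ) ∧
    ∀ μ : (n : ℕ) → Measure (GaussianCovolume.G n),
      (∀ n : ℕ, 1 ≤ n → GaussianCovolume.IsSymmetricallyNormalized n (μ n)) →
        (∀ n : ℕ, 1 ≤ n →
          HasFundamentalDomain (GaussianCovolume.Γ n) (GaussianCovolume.G n) (μ n) ∧
          GaussianCovolume.V n (μ n) < ⊤) ∧
        (∀ n : ℕ, 2 ≤ n →
          ((GaussianCovolume.V n (μ n)).toReal : ℂ) =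
            GaussianCovolume.lambdaZeta n *
              ((GaussianCovolume.V (n - 1) (μ (n - 1))).toReal : ℂ)) ∧
        (∀ n : ℕ, 1 ≤ n →
          ((GaussianCovolume.V n (μ n)).toReal : ℂ) =
            ∏ k ∈ Finset.Icc 2 n, GaussianCovolume.lambdaZeta k) := by
  refine ⟨fun n hn => GaussianCovolume.existsUnique_isSymmetricallyNormalized hn,
    fun μ hμ => ?_⟩
  have hrec : ∀ m : ℕ, 1 ≤ m → ((GaussianCovolume.V (m + 1) (μ (m + 1))).toReal : ℂ) =
      GaussianCovolume.lambdaZeta ((m + 1 : ℕ) : ℂ) *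
        ((GaussianCovolume.V m (μ m)).toReal : ℂ) := fun m hm =>
    GaussianCovolume.toReal_V_succ (by omega) (hμ m hm) (hμ (m + 1) (by omega))
  refine ⟨fun n hn => ⟨GaussianCovolume.hasFundamentalDomain _,
    (GaussianCovolume.V_ne_top hn (hμ n hn)).lt_top⟩, fun n hn => ?_, fun n hn => ?_⟩
  · obtain ⟨m, rfl⟩ : ∃ m, n = m + 1 := ⟨n - 1, by omega⟩
    exact hrec m (by omega)
  · induction n, hn using Nat.le_induction with
    | base => simp [GaussianCovolume.V_one (hμ 1 le_rfl)]
    | succ n hn ih => rw [hrec n hn, ih, Finset.prod_Icc_succ_top (by omega), mul_comm]
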